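/- **Setting.** Let $A$ (actions), $X$ (clocks), $AP$ (propositions) be finite sets. Guards are finite conjunctions of constraints $x\sim c$ and $x-y\sim c$ with $x,y\in X$, $c\in\mathbb N$, ${\sim}\in\{\le,<,>,\ge\}$. For $N\in\mathbb N$, regions (elements of $\Theta_N(X)$) are the classes of clock valuations $v:X\to\mathbb R_{\ge 0}$ satisfying the same guards with constants $\le N$; $\mathrm{Succ}(\theta)$ is the union of the regions reached from $\theta$ by letting time elapse; $\theta[Y:=0]$ is the region obtained by resetting the clocks in $Y$. A *PTA* $\mathcal M=(L,A,X,AP,V,T,l_0)$ has a finite set $L$ of locations, labels $V(l)\subseteq AP$, and finitely many edges $l\xrightarrow{g,a}\mu$ with $g$ a guard, $a\in A$, $\mu\in \mathrm{Dist}(2^X\times L)$. An *APTA* $\mathcal A=(L',A,X,AP,V',T',l_0')$ has a finite $L'$, sets of admissible labels $V'(l')\subseteq 2^{AP}$, and finitely many must-edges or may-edges $(l',g,a,\varphi)$, where $\varphi$ is a constraint, from an arbitrary language, denoting a set $\mathrm{Sat}(\varphi)\subseteq\mathrm{Dist}(2^X\times L')$. A state $(l,\theta)$ is *reachable* in $\mathcal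 M$ if it is $(l_0,[\bar 0])$, or it is $(l,\theta''[Y:=0])$ where $(l_1,\theta_1)$ is reachable, $l_1\xrightarrow{g,a}\mu$, $\theta''\subseteq \mathrm{Succ}(\theta_1)\cap g$ is a region and $\mu(Y,l)>0$; for $\mathcal A$, likewise with may- or must-edges and some $\mu\in\mathrm{Sat}(\varphi)$. $\mathcal M$ is in *normal form* (for $N$) if it is isomorphic, comparing guards as sets of valuations, to the reachable part of its region automaton, read as a PTA with locations $(l,\theta)$ and, for $l\xrightarrow{g,a}\mu$ and each region $\theta''\subseteq\mathrm{Succ}(\theta)\cap g$, an edge with guard $\theta''$, action $a$ and the distribution giving $(Y,(l',\theta''[Y:=0]))$ the probability $\mu(Y,l')$. $\mathcal M$ is an *implementation* of $\mathcal A$ ($\mathcal M\models\mathcal A$) if for some $N$ bounding all constants of both, $\mathcal M$ is in normal form and there is $R\subseteq L\times L'$ with $(l_0,l_0')\in R$ such that for all $(l,l')\in R$: 1. for each must-edge $(l',g,a,\varphi)$ and each $\theta\in\Theta_N(X)$ with $(l,\theta)$ and $(l',\theta)$ reachable in $\mathcal M$ and $\mathcal A$ respectively, there are finitely many edges $l\xrightarrow{g_i,a}\mu_i$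 with $\mathrm{Succ}(\theta)\cap g\subseteq\mathrm{Succ}(\theta)\cap\bigcup_i g_i$, and each $\mu_i\Subset_R\mu_i'$ for some $\mu'_i\in\mathrm{Sat}(\varphi)$; 2. for each edge $l\xrightarrow{g,a}\mu$ there are a may- or must-edge $(l',g',a,\varphi)$ with $g\subseteq g'$ and a $\mu'\in\mathrm{Sat}(\varphi)$ with $\mu\Subset_R\mu'$; 3. $V(l)\in V'(l')$. Here $\mu\Subset_R\mu'$ means that some $\delta:2^X\times L\to\mathrm{Dist}(2^X\times L')$ satisfies $\sum_s\mu(s)\,\delta(s)=\mu'$, and $\mu(Y,l)>0$, $\delta(Y,l)(Y',l')>0$ imply $Y=Y'$ and $(l,l')\in R$. **Divergence.** In the dense-time semantics of $\mathcal M$, started in $l_0$ with all clocks $0$, a (deterministic, history-dependent) scheduler picks after each finite path either a delay $t\ge0$ together with an edge of the current location enabled after that delay, or lets time pass forever. A path is time divergent if its total duration is infinite. $\mathcal M$ is *strictly divergent* if under every scheduler every path (all of whose random steps have positive probability) is time divergent, and *probabilistically divergent* if under every scheduler the path is time divergent with probability $1$. $\mathcal A$ is *$\mathsf{Sd}$-consistent*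 (resp. *$\mathsf{Pd}$-consistent*) if it has a strictly (resp. probabilistically) divergent implementation. **The game.** Let $N$ bound all constants of $\mathcal A$. The stochastic two-player game $\mathcal G(\mathcal A)$ is played on positions $(l,\theta)$, where $l\in L'$ and $\theta\in\Theta_{\max(N,1)}(X\cup\{z\})$ for a fresh clock $z$, starting from $(l_0',[\bar 0])$. In each round: * the $\bullet$-player offers a set $C$ of triples $(\theta'',a,\mu)$ such that each is allowed (that is, $\theta''\subseteq\mathrm{Succ}(\theta)\cap\{z\le1\}\cap g$ and $\mu\in\mathrm{Sat}(\varphi)$ for some may- or must-edge $(l,g,a,\varphi)$), and such that for every must-edge $(l,g,a,\varphi)$ and every region $\theta''\subseteq\mathrm{Succ}(\theta)\cap\{z\le1\}\cap g$ some $(\theta'',a,\mu)\in C$ has $\mu\in\mathrm{Sat}(\varphi)$; this move also requires $V'(l)\ne\emptyset$, and the $\bullet$-player loses if he has no legal move; * the $\circ$-player then either plays $\mathit{tick}$ (time elapses until $z=1$, $z$ is reset, the location stays the same), or chooses some $(\theta'',a,\mu)\in C$, in which case $(Y,l_1)$ is drawn from $\mu$ and the next position is $(l_1,\theta''[Y:=0])$.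 **Theorem.** For every APTA $\mathcal A$ and every $N\in\mathbb N$ bounding its constants: * $\mathcal A$ is $\mathsf{Pd}$-consistent if and only if the $\bullet$-player has a strategy in $\mathcal G(\mathcal A)$ that, against every strategy of the $\circ$-player, ensures that with probability $1$ infinitely many ticks occur (objective $\mathbb P_{=1}(\square\Diamond\mathit{tick})$); * $\mathcal A$ is $\mathsf{Sd}$-consistent if and only if the $\bullet$-player has a strategy in $\mathcal G(\mathcal A)$ that, against every strategy of the $\circ$-player, ensures that infinitely many ticks occur on every play all of whose random steps have positive probability (objective $\square\Diamond\mathit{tick}$). -/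

import Mathlib

open MeasureTheory ProbabilityTheory Filter
open scoped NNReal ENNReal

universe u

namespace APTA

/-! ### Clocks, guards and regions -/

/-- Clock valuations `X → ℝ₊`. -/
abbrev Valuation (X : Type u) : Type u := X → ℝ≥0

/-- `v + t`: let `t` time units elapse. -/
def Valuation.delay {X : Type u} (v : Valuation X) (t : ℝ≥0) : Valuation X := fun x => v x + t

open Classical in
/-- `v[Y := 0]`. -/
noncomputable def Valuation.reset {X : Type u} (v : Valuation X) (Y : Set X) : Valuation X :=
  fun x => if x ∈ Y then 0 else v x

/-- The comparisons `≤, <, >, ≥`. -/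
inductive Cmp
  | le | lt | gt | ge

/-- `r ∼ c`. -/
def Cmp.Holds : Cmp → ℝ → ℝ → Prop
  | .le, r, c => r ≤ c
  | .lt, r, c => r < c
  | .gt, r, c => r > c
  | .ge, r, c => r ≥ c

/-- Atomic clock constraints `x ∼ c` and `x - y ∼ c` with `c ∈ ℕ`. -/
inductive Atom (X : Type u) : Type u
  | clock (x : X) (r : Cmp) (c : ℕ)
  | diff (x y : X) (r : Cmp) (c : ℕ)

/-- The constant of an atomic constraint. -/
def Atom.const {X : Type u} : Atom X → ℕ
  | .clock _ _ c => c
  | .diff _ _ _ c => c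

/-- Satisfaction of an atomic constraint by a valuation. -/
def Atom.Holds {X : Type u} (v : Valuation X) : Atom X → Prop
  | .clock x r c => r.Holds (v x : ℝ) (c : ℝ)
  | .diff x y r c => r.Holds ((v x : ℝ) - (v y : ℝ)) (c : ℝ)

/-- `CC(X)`: finite conjunctions of atomic constraints (the empty one is `true`). -/
abbrev Guard (X : Type u) : Type u := List (Atom X)

/-- The set of valuations satisfying the guard. -/
def Guard.sat {X : Type u} (g : Guard X) : Set (Valuation X) := {v | ∀ a ∈ g, a.Holds v}

/-- `g ∈ CC_N(X)`: all constants of `g` are at most `N`. -/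
def Guard.BoundedBy {X : Type u} (N : ℕ) (g : Guard X) : Prop := ∀ a ∈ g, a.const ≤ N

/-- Two valuations are region equivalent if they satisfy exactly the same guards of `CC_N(X)`. -/
def regionSetoid (N : ℕ) (X : Type u) : Setoid (Valuation X) where
  r v w := ∀ g : Guard X, g.BoundedBy N → (v ∈ g.sat ↔ w ∈ g.sat)
  iseqv :=
    { refl := fun _ _ _ => Iff.rfl
      symm := fun h g hg => (h g hg).symm
      trans := fun h k g hg => (h g hg).trans (k g hg) }

/-- `Θ_N(X)`: the regions. -/
def Region (N : ℕ) (X : Type u) : Type u := Quotient (regionSetoid N X)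

namespace Region

variable {N : ℕ} {X : Type u}

/-- The region of a valuation. -/
def of (N : ℕ) (v : Valuation X) : Region N X := Quotient.mk (regionSetoid N X) v

/-- A region as a set of valuations. -/
def toSet (θ : Region N X) : Set (Valuation X) := {v | of N v = θ}

/-- The region of the valuation that assigns `0` to all clocks. -/
def zero (N : ℕ) (X : Type u) : Region N X := of N (fun _ => 0)

/-- `θ'` can be obtained from `θ` by letting time elapse. -/
def IsSucc (θ θ' : Region N X) : Prop := ∃ v ∈ θ.toSet, ∃ t : ℝ≥0, v.delay t ∈ θ'.toSet

/-- `Succ(θ)`: the union of all time successors of `θ`. -/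
def succ (θ : Region N X) : Set (Valuation X) := {w | θ.IsSucc (of N w)}

theorem equiv_iff_atoms {v w : Valuation X} :
    (regionSetoid N X) v w ↔ ∀ a : Atom X, a.const ≤ N → (a.Holds v ↔ a.Holds w) := by
  constructor
  · intro h a ha
    have := h [a] (by intro b hb; simp only [List.mem_singleton] at hb; subst hb; exact ha)
    simpa [Guard.sat] using this
  · intro h g hg
    exact forall₂_congr fun a ha => h a (hg a ha)

theorem equiv_reset {v w : Valuation X} (h : (regionSetoid N X) v w) (Y : Set X) :
    (regionSetoid N X) (v.reset Y) (w.reset Y) := by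
  rw [equiv_iff_atoms] at h ⊢
  have key : ∀ y : X, (v y : ℝ) = 0 ↔ (w y : ℝ) = 0 := by
    intro y
    have h1 := h (.clock y .le 0) (Nat.zero_le _)
    simp only [Atom.Holds, Cmp.Holds, Nat.cast_zero] at h1
    have hv : (0 : ℝ) ≤ v y := (v y).2
    have hw : (0 : ℝ) ≤ w y := (w y).2
    exact ⟨fun e => le_antisymm (h1.1 e.le) hw, fun e => le_antisymm (h1.2 e.le) hv⟩
  intro a ha
  cases a with
  | clock x r c =>
    by_cases hx : x ∈ Y
    · simp [Atom.Holds, Valuation.reset, hx]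
    · simpa [Atom.Holds, Valuation.reset, hx] using h (.clock x r c) ha
  | diff x y r c =>
    by_cases hx : x ∈ Y
    · by_cases hy : y ∈ Y
      · simp [Atom.Holds, Valuation.reset, hx, hy]
      · have hc : (0 : ℝ) ≤ (c : ℝ) := Nat.cast_nonneg c
        have hv : (0 : ℝ) ≤ v y := (v y).2
        have hw : (0 : ℝ) ≤ w y := (w y).2
        have ky := key y
        cases r <;>
          simp only [Atom.Holds, Valuation.reset, hx, hy, if_true, if_false, NNReal.coe_zero,
            Cmp.Holds, zero_sub, gt_iff_lt, ge_iff_le]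
        · constructor <;> intro _ <;> linarith
        · constructor
          · intro h1
            by_contra h2
            have e1 : (w y : ℝ) = 0 := by linarith
            have := ky.2 e1
            linarith
          · intro h1
            by_contra h2
            have e1 : (v y : ℝ) = 0 := by linarith
            have := ky.1 e1
            linarith
        · constructor <;> intro _ <;> linarith
        · constructor
          · intro h1
            have e1 : (v y : ℝ) = 0 := by linarith
            have := ky.1 e1
            linarith
          · intro h1
            have e1 : (w y : ℝ) = 0 := by linarith
            have := ky.2 e1
            linarith
    · by_cases hy : y ∈ Y
      · simpa [Atom.Holds, Valuation.reset, hx, hy] using h (.clock x r c) ha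
      · simpa [Atom.Holds, Valuation.reset, hx, hy] using h (.diff x y r c) ha

/-- `θ[Y := 0]`. -/
noncomputable def reset (θ : Region N X) (Y : Set X) : Region N X :=
  Quotient.map (fun v => Valuation.reset v Y) (fun _ _ h => equiv_reset h Y) θ

end Region

/-! ### Laws of discrete-time processes

`f h` is the distribution of the next outcome after the finite history `h` of outcomes, written
with the most recent outcome first. -/

/-- The first `n` outcomes of an infinite sequence, most recent first. -/
def history {O : Type u} (ω : ℕ → O) : ℕ → List O
  | 0 => []
  | n + 1 => ω n :: history ω n

/-- Finite histories all of whose outcomes have positive probability. -/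
def FeasibleHistory {O : Type u} (f : List O → PMF O) : List O → Prop
  | [] => True
  | o :: h => o ∈ (f h).support ∧ FeasibleHistory f h

/-- Infinite sequences all of whose outcomes have positive probability. -/
def Feasible {O : Type u} (f : List O → PMF O) (ω : ℕ → O) : Prop :=
  ∀ n, ω n ∈ (f (history ω n)).support

/-- The list `[x n, …, x 0]`. -/
def listOfIic {O : Type u} {n : ℕ} (x : (i : Finset.Iic n) → O) : List O :=
  history (fun k => if h : k ≤ n then x ⟨k, Finset.mem_Iic.2 h⟩ else
    x ⟨n, Finset.mem_Iic.2 le_rfl⟩) (n + 1)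

section Law

attribute [local instance] Classical.propDecidable

variable {O : Type u} [MeasurableSpace O] [DiscreteMeasurableSpace O] [Finite O]

/-- The transition kernel from the outcomes `0, …, n` to the outcome `n + 1`. -/
noncomputable def stepKernel (f : List O → PMF O) (n : ℕ) :
    Kernel ((i : Finset.Iic n) → O) O where
  toFun x := (f (listOfIic x)).toMeasure
  measurable' := Measurable.of_discrete

instance (f : List O → PMF O) (n : ℕ) : IsMarkovKernel (stepKernel f n) :=
  ⟨fun x => by
    change IsProbabilityMeasure (f (listOfIic x)).toMeasure
    infer_instance⟩

/-- The law of the sequence of outcomes (by the Ionescu-Tulcea theorem). -/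
noncomputable def pathLaw (f : List O → PMF O) : Measure (ℕ → O) :=
  Kernel.trajMeasure (X := fun _ => O) (f []).toMeasure (stepKernel f)

end Law

/-- `p` holds with probability one (the finite set `O` carries its discrete `σ`-algebra). -/
def AlmostSurely {O : Type u} [Finite O] (f : List O → PMF O) (p : (ℕ → O) → Prop) : Prop :=
  letI : MeasurableSpace O := ⊤
  ∀ᵐ ω ∂(pathLaw f), p ω

/-! ### Probabilistic timed automata -/

/-- A probabilistic timed automaton over the actions `A`, clocks `X` and propositions `AP`. -/
structure PTA (A X AP : Type u) where
  Loc : Type u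
  finite_loc : Finite Loc
  init : Loc
  V : Loc → Set AP
  T : Loc → Guard X → A → PMF (Set X × Loc) → Bool
  finite_edges : {e : Loc × Guard X × A × PMF (Set X × Loc) |
    T e.1 e.2.1 e.2.2.1 e.2.2.2 = true}.Finite

namespace PTA

variable {A X AP : Type u} (M : PTA A X AP)

instance : Finite M.Loc := M.finite_loc

/-- All guards of `M` are in `CC_N(X)`. -/
def BoundedBy (N : ℕ) : Prop := ∀ l g a μ, M.T l g a μ = true → g.BoundedBy N

/-- The reachable states `(l, θ)` of the region automaton. -/
inductive Reach (N : ℕ) : M.Loc × Region N X → Prop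
  | init : Reach N (M.init, Region.zero N X)
  | step {l : M.Loc} {θ θ' : Region N X} {g : Guard X} {a : A} {μ : PMF (Set X × M.Loc)}
      {Y : Set X} {l' : M.Loc} :
      Reach N (l, θ) → M.T l g a μ = true → θ.IsSucc θ' → θ'.toSet ⊆ g.sat →
      (Y, l') ∈ μ.support → Reach N (l', θ'.reset Y)

/-- The edges of the region automaton, read again as probabilistic edges with clock resets:
from the reachable state `(l, θ)`, within the region `θ'`, with action `a`. The reset set is kept
in the target distribution. -/
inductive RegionEdge (N : ℕ) : M.Loc × Region N X → Region N X → A →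
    PMF (Set X × (M.Loc × Region N X)) → Prop
  | mk {l : M.Loc} {θ θ' : Region N X} {g : Guard X} {a : A} {μ : PMF (Set X × M.Loc)} :
      M.Reach N (l, θ) → M.T l g a μ = true → θ.IsSucc θ' → θ'.toSet ⊆ g.sat →
      RegionEdge N (l, θ) θ' a (μ.map fun o => (o.1, (o.2, θ'.reset o.1)))

/-- `M` is in normal form: it is isomorphic to the reachable part of its region automaton read
as a PTA whose guards are regions (guards are compared as sets of valuations). -/
def NormalForm (N : ℕ) : Prop :=
  ∃ e : M.Loc ≃ {s : M.Loc × Region N X // M.Reach N s},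
    (e M.init).1 = (M.init, Region.zero N X) ∧
    (∀ l, M.V l = M.V (e l).1.1) ∧
    (∀ l g a μ, M.T l g a μ = true → ∃ θ' : Region N X, g.sat = θ'.toSet ∧
      M.RegionEdge N (e l).1 θ' a (μ.map fun o => (o.1, (e o.2).1))) ∧
    (∀ l (θ' : Region N X) a ν, M.RegionEdge N (e l).1 θ' a ν →
      ∃ g μ, M.T l g a μ = true ∧ g.sat = θ'.toSet ∧ ν = μ.map fun o => (o.1, (e o.2).1))

/-- Schedulers of the dense-time semantics. After a finite path a scheduler chooses a delay `t`
and an edge to be taken after that delay, or (`none`) it lets time pass forever. Since schedulers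
are deterministic, the finite path is determined by its (reset, location) outcomes. -/
abbrev Scheduler : Type u :=
  List (Set X × M.Loc) → Option (ℝ≥0 × Guard X × A × PMF (Set X × M.Loc))

variable {M}

/-- The location and the clock valuation after a history. -/
noncomputable def Scheduler.state (σ : M.Scheduler) : List (Set X × M.Loc) → M.Loc × Valuation X
  | [] => (M.init, fun _ => 0)
  | o :: h =>
    match σ h with
    | none => Scheduler.state σ h
    | some c => (o.2, ((Scheduler.state σ h).2.delay c.1).reset o.1)

/-- Only edges of the current location that are enabled after the delay may be chosen. -/
def Scheduler.Legal (σ : M.Scheduler) : Prop :=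
  ∀ h t g a μ, σ h = some (t, g, a, μ) →
    M.T (σ.state h).1 g a μ = true ∧ (σ.state h).2.delay t ∈ g.sat

/-- The distribution of the next outcome (immaterial once time passes forever). -/
noncomputable def Scheduler.law (σ : M.Scheduler) (h : List (Set X × M.Loc)) :
    PMF (Set X × M.Loc) :=
  match σ h with
  | none => PMF.pure (∅, (σ.state h).1)
  | some c => c.2.2.2

/-- The duration of the next step. -/
noncomputable def Scheduler.duration (σ : M.Scheduler) (h : List (Set X × M.Loc)) : ℝ≥0∞ :=
  match σ h with
  | none => ⊤
  | some c => (c.1 : ℝ≥0∞)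

/-- The path `ω` is time divergent: its total duration is infinite. -/
def Scheduler.Divergent (σ : M.Scheduler) (ω : ℕ → Set X × M.Loc) : Prop :=
  ∑' n, σ.duration (history ω n) = ⊤

variable (M)

/-- Strict divergence: under every scheduler, every path is time divergent. -/
def StrictDivergent : Prop :=
  ∀ σ : M.Scheduler, σ.Legal → ∀ ω, Feasible σ.law ω → σ.Divergent ω

/-- Probabilistic divergence: under every scheduler, time diverges with probability one. -/
def ProbDivergent [Finite X] : Prop :=
  ∀ σ : M.Scheduler, σ.Legal → AlmostSurely σ.law σ.Divergent

end PTA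

/-! ### Abstract probabilistic timed automata -/

/-- A language of probability constraints over `S`; the language itself is not fixed. -/
structure ConstraintLanguage (S : Type u) where
  Constraint : Type u
  Sat : Constraint → Set (PMF S)
  tt : Constraint
  ff : Constraint
  sat_tt : Sat tt = Set.univ
  sat_ff : Sat ff = ∅

/-- The three truth values `⊥, ?, ⊤` of edges. -/
inductive Modality
  | absent | may | must

end APTA

/-- An abstract probabilistic timed automaton over the actions `A`, clocks `X` and
propositions `AP`. -/
structure APTA (A X AP : Type u) where
  Loc : Type u
  finite_loc : Finite Loc
  init : Loc
  PC : APTA.ConstraintLanguage (Set X × Loc)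
  V : Loc → Set (Set AP)
  T : Loc → APTA.Guard X → A → PC.Constraint → APTA.Modality
  finite_edges : {e : Loc × APTA.Guard X × A × PC.Constraint |
    T e.1 e.2.1 e.2.2.1 e.2.2.2 ≠ APTA.Modality.absent}.Finite

namespace APTA

variable {A X AP : Type u}

instance (𝒜 : APTA A X AP) : Finite 𝒜.Loc := 𝒜.finite_loc

/-- All guards of `𝒜` are in `CC_N(X)`. -/
def BoundedBy (𝒜 : APTA A X AP) (N : ℕ) : Prop :=
  ∀ l g a φ, 𝒜.T l g a φ ≠ Modality.absent → g.BoundedBy N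

/-- The reachable states `(l, θ)` of the region automaton of `𝒜`. -/
inductive Reach (𝒜 : APTA A X AP) (N : ℕ) : 𝒜.Loc × Region N X → Prop
  | init : Reach 𝒜 N (𝒜.init, Region.zero N X)
  | step {l : 𝒜.Loc} {θ θ' : Region N X} {g : Guard X} {a : A} {φ : 𝒜.PC.Constraint}
      {μ : PMF (Set X × 𝒜.Loc)} {Y : Set X} {l' : 𝒜.Loc} :
      Reach 𝒜 N (l, θ) → 𝒜.T l g a φ ≠ Modality.absent → θ.IsSucc θ' → θ'.toSet ⊆ g.sat →
      μ ∈ 𝒜.PC.Sat φ → (Y, l') ∈ μ.support → Reach 𝒜 N (l', θ'.reset Y)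

/-- `μ ⋐_R μ'`: there is a correspondence function `δ` that redistributes `μ` to `μ'` along `R`
and preserves the set of clocks that are reset. -/
def Lifting {L L' : Type u} (R : L → L' → Prop) (μ : PMF (Set X × L)) (μ' : PMF (Set X × L')) :
    Prop :=
  ∃ δ : Set X × L → PMF (Set X × L'), μ.bind δ = μ' ∧
    ∀ s ∈ μ.support, ∀ s' ∈ (δ s).support, s.1 = s'.1 ∧ R s.2 s'.2

/-- Satisfaction relations between the PTA `M` and the APTA `𝒜`, with respect to the regions
`Θ_N(X)`. -/
structure IsSatisfaction (N : ℕ) (M : PTA A X AP) (𝒜 : APTA A X AP)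
    (R : M.Loc → 𝒜.Loc → Prop) : Prop where
  must : ∀ l l', R l l' → ∀ (a : A) (φ : 𝒜.PC.Constraint) (g : Guard X) (θ : Region N X),
    𝒜.T l' g a φ = Modality.must → M.Reach N (l, θ) → 𝒜.Reach N (l', θ) →
    ∃ (n : ℕ) (gs : Fin n → Guard X) (μs : Fin n → PMF (Set X × M.Loc)),
      θ.succ ∩ g.sat ⊆ θ.succ ∩ ⋃ i, (gs i).sat ∧
      ∀ i, M.T l (gs i) a (μs i) = true ∧ ∃ μ' ∈ 𝒜.PC.Sat φ, Lifting R (μs i) μ'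
  may : ∀ l l', R l l' → ∀ (a : A) (μ : PMF (Set X × M.Loc)) (g : Guard X),
    M.T l g a μ = true →
    ∃ (g' : Guard X) (φ : 𝒜.PC.Constraint), 𝒜.T l' g' a φ ≠ Modality.absent ∧
      g.sat ⊆ g'.sat ∧ ∃ μ' ∈ 𝒜.PC.Sat φ, Lifting R μ μ'
  label : ∀ l l', R l l' → M.V l ∈ 𝒜.V l'

/-- `M ⊨ 𝒜`: `M` is an implementation of `𝒜`, that is, with regions taken for a common bound `N`
on the constants, `M` is in normal form and a satisfaction relation relates the initial
locations. -/
def Satisfies (M : PTA A X AP) (𝒜 : APTA A X AP) : Prop :=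
  ∃ N : ℕ, M.BoundedBy N ∧ 𝒜.BoundedBy N ∧ M.NormalForm N ∧
    ∃ R : M.Loc → 𝒜.Loc → Prop, IsSatisfaction N M 𝒜 R ∧ R M.init 𝒜.init

/-- `𝒜` admits a strictly divergent implementation. -/
def SdConsistent (𝒜 : APTA A X AP) : Prop :=
  ∃ M : PTA A X AP, Satisfies M 𝒜 ∧ M.StrictDivergent

/-- `𝒜` admits a probabilistically divergent implementation. -/
def PdConsistent [Finite X] (𝒜 : APTA A X AP) : Prop :=
  ∃ M : PTA A X AP, Satisfies M 𝒜 ∧ M.ProbDivergent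

/-! ### Stochastic two-player games -/

/-- A turn-based stochastic game played in rounds: at a position the `●`-player moves, then the
`○`-player moves, then an outcome is drawn at random and determines the next position. -/
structure StochasticGame where
  Pos : Type u
  init : Pos
  BMove : Type u
  BLegal : Pos → BMove → Prop
  CMove : Type u
  CLegal : Pos → BMove → CMove → Prop
  Out : Type u
  finite_out : Finite Out
  law : Pos → CMove → PMF Out
  next : Pos → CMove → Out → Pos
  tick : Set CMove

namespace StochasticGame

variable (G : StochasticGame.{u})

instance : Finite G.Out := G.finite_out

/-- What happened in one round. -/
structure Round where
  bullet : G.BMove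
  circ : G.CMove
  out : G.Out

/-- The position after a finite history of rounds (most recent first). -/
def pos : List G.Round → G.Pos
  | [] => G.init
  | r :: h => G.next (pos h) r.circ r.out

/-- Strategies of the `●`-player. -/
abbrev BStrategy : Type u := List G.Round → G.BMove

/-- Strategies of the `○`-player, who sees the current move of the `●`-player. -/
abbrev CStrategy : Type u := List G.Round → G.BMove → G.CMove

variable {G}

/-- The history of rounds determined by two strategies and a history of outcomes. -/
def play (σ : G.BStrategy) (τ : G.CStrategy) : List G.Out → List G.Round
  | [] => []
  | o :: h => ⟨σ (play σ τ h), τ (play σ τ h) (σ (play σ τ h)), o⟩ :: play σ τ h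

/-- The next move of the `●`-player. -/
def bmove (σ : G.BStrategy) (τ : G.CStrategy) (h : List G.Out) : G.BMove := σ (play σ τ h)

/-- The next move of the `○`-player. -/
def cmove (σ : G.BStrategy) (τ : G.CStrategy) (h : List G.Out) : G.CMove :=
  τ (play σ τ h) (bmove σ τ h)

/-- The distribution of the next outcome. -/
noncomputable def playLaw (σ : G.BStrategy) (τ : G.CStrategy) (h : List G.Out) : PMF G.Out :=
  G.law (G.pos (play σ τ h)) (cmove σ τ h)

/-- The `●`-player only makes legal moves in the plays of `σ` against `τ`. -/
def BObeys (σ : G.BStrategy) (τ : G.CStrategy) : Prop :=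
  ∀ h, FeasibleHistory (playLaw σ τ) h → G.BLegal (G.pos (play σ τ h)) (bmove σ τ h)

/-- The `○`-player answers legal moves by legal moves in the plays of `σ` against `τ`. -/
def CObeys (σ : G.BStrategy) (τ : G.CStrategy) : Prop :=
  ∀ h, FeasibleHistory (playLaw σ τ) h → G.BLegal (G.pos (play σ τ h)) (bmove σ τ h) →
    G.CLegal (G.pos (play σ τ h)) (bmove σ τ h) (cmove σ τ h)

/-- `□◇ tick`: infinitely many rounds are ticks. -/
def InfTick (σ : G.BStrategy) (τ : G.CStrategy) (ω : ℕ → G.Out) : Prop :=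
  ∃ᶠ n in atTop, cmove σ τ (history ω n) ∈ G.tick

variable (G)

/-- The `●`-player has a winning strategy for the objective `□◇ tick`. -/
def SureWin : Prop :=
  ∃ σ : G.BStrategy, ∀ τ : G.CStrategy, CObeys σ τ →
    BObeys σ τ ∧ ∀ ω, Feasible (playLaw σ τ) ω → InfTick σ τ ω

/-- The `●`-player has a winning strategy for the objective `P_{=1}(□◇ tick)`. -/
def AlmostSureWin : Prop :=
  ∃ σ : G.BStrategy, ∀ τ : G.CStrategy, CObeys σ τ →
    BObeys σ τ ∧ AlmostSurely (playLaw σ τ) (InfTick σ τ)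

end StochasticGame

/-! ### The game of an APTA -/

/-- Regions over the clocks `X` and an additional clock `none`, the tick clock. -/
abbrev TickRegion (N : ℕ) (X : Type u) : Type u := Region (max N 1) (Option X)

/-- All valuations of the region satisfy the guard `g`, which does not involve the tick clock. -/
def TickRegion.Within {N : ℕ} (θ : TickRegion N X) (g : Guard X) : Prop :=
  ∀ v ∈ Region.toSet θ, (fun x => v (some x)) ∈ g.sat

/-- A probabilistic edge offered by the `●`-player: within which region it is taken, its action
and its distribution over resets and target locations. -/
structure OfferedEdge (𝒜 : APTA A X AP) (N : ℕ) where
  region : TickRegion N X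
  action : A
  dist : PMF (Set X × 𝒜.Loc)

/-- Moves of the `○`-player: let time elapse until the tick clock equals `1` and reset it,
arriving in the given region, or take an offered edge. -/
inductive CircMove (𝒜 : APTA A X AP) (N : ℕ)
  | tick (θ : TickRegion N X)
  | edge (e : OfferedEdge 𝒜 N)

/-- `θ'` is a time successor of `θ` in which the tick clock has not exceeded `1`. -/
def TickRegion.IsSucc {N : ℕ} (θ θ' : TickRegion N X) : Prop :=
  Region.IsSucc θ θ' ∧ ∀ v ∈ Region.toSet θ', v none ≤ 1

/-- The `●`-player may offer the set `C` of edges at location `l` in region `θ` iff `l` has an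
admissible label, every must-edge is implemented in every region in which it can be taken, and
every offered edge is allowed by some may- or must-edge. -/
structure LegalOffer (𝒜 : APTA A X AP) (N : ℕ) (l : 𝒜.Loc) (θ : TickRegion N X)
    (C : Set (OfferedEdge 𝒜 N)) : Prop where
  label : (𝒜.V l).Nonempty
  must : ∀ g a φ, 𝒜.T l g a φ = Modality.must →
    ∀ θ' : TickRegion N X, TickRegion.IsSucc θ θ' → θ'.Within g →
      ∃ μ ∈ 𝒜.PC.Sat φ, (⟨θ', a, μ⟩ : OfferedEdge 𝒜 N) ∈ C
  may : ∀ e ∈ C, TickRegion.IsSucc θ e.region ∧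
    ∃ g φ, 𝒜.T l g e.action φ ≠ Modality.absent ∧ e.region.Within g ∧ e.dist ∈ 𝒜.PC.Sat φ

/-- Legal moves of the `○`-player after the offer `C`. -/
def LegalCirc {𝒜 : APTA A X AP} {N : ℕ} (θ : TickRegion N X) (C : Set (OfferedEdge 𝒜 N)) :
    CircMove 𝒜 N → Prop
  | .tick θ₁ => ∃ θ' : TickRegion N X, Region.IsSucc θ θ' ∧
      (∀ v ∈ Region.toSet θ', v none = 1) ∧ θ₁ = Region.reset θ' {none}
  | .edge e => e ∈ C

/-- The game `G(𝒜)`, over the regions for the bound `N` on the constants. -/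
noncomputable def game (𝒜 : APTA A X AP) [Finite X] (N : ℕ) : StochasticGame.{u} where
  Pos := 𝒜.Loc × TickRegion N X
  init := (𝒜.init, Region.zero (max N 1) (Option X))
  BMove := Set (OfferedEdge 𝒜 N)
  BLegal p C := LegalOffer 𝒜 N p.1 p.2 C
  CMove := CircMove 𝒜 N
  CLegal p C c := LegalCirc p.2 C c
  Out := Set X × 𝒜.Loc
  finite_out := inferInstance
  law p c :=
    match c with
    | .tick _ => PMF.pure (∅, p.1)
    | .edge e => e.dist
  next p c o :=
    match c with
    | .tick θ₁ => (p.1, θ₁)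
    | .edge e => (o.2, e.region.reset (some '' o.1))
  tick := {c | ∃ θ₁, c = .tick θ₁}

end APTA

namespace APTA

/-! ### Laws of processes -/

section RandomSequence

variable {O : Type u}

/-! The two objectives differ only in a quantifier over random outcomes, so both equivalences are
proved at once for a `Mode`: progress is demanded on every outcome, or on some outcome of positive
probability. The game has finitely many positions, and nested attractors give a `Solution`
(`exists_solution`). Inside its region the ●-player can stay inside and lower a rank until the next
tick. Outside, some answer of the ○-player either lowers a stage with positive probability without
entering the region, or avoids the tick without raising the stage. Hence winning means starting in
the region (`game_winnable_iff`).

From implementations to strategies: suppose that the initial position lies outside the region. Every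
related state of an implementation yields a legal offer (`JointState.legalOffer`). The ○-player's
answers to these offers become decisions of a scheduler, ticks being merged into the delay before
the next edge (`exists_decision`). From a reachable state of least stage no more ticks are needed,
so the tick clock, which stays at most 1, bounds the remaining time on some path that divergence
should cover (`init_mem_of_satisfies`).

From strategies to implementations: an automaton over `X` cannot observe the tick clock. Its
locations are therefore game positions, read as beliefs about that clock. When an edge is taken in a
region of `X`, the belief assumes the earliest moment, up to region equivalence, at which this
region could have been reached (`exists_update`). The belief then never overestimates the elapsed
time, where valuations are compared by `Coarse`. Edges that count no tick lower the rank, so edges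
that count ticks recur unless time passes forever, and the real time is at least the number of
counted ticks (`exists_sim`, `beliefPTA_divergent`). -/

theorem history_congr {ω ω' : ℕ → O} {n : ℕ} (h : ∀ k < n, ω k = ω' k) :
    history ω n = history ω' n := by
  induction n with
  | zero => rfl
  | succ n ih =>
    simp only [history, h n (Nat.lt_succ_self n), ih fun k hk => h k (hk.trans (Nat.lt_succ_self n))]

theorem listOfIic_frestrictLe (ω : ℕ → O) (n : ℕ) :
    listOfIic (Preorder.frestrictLe (π := fun _ => O) n ω) = history ω (n + 1) := by
  unfold listOfIic
  apply history_congr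
  intro k hk
  have : k ≤ n := Nat.lt_succ_iff.1 hk
  simp [this]

theorem feasible_iff {f : List O → PMF O} {ω : ℕ → O} :
    Feasible f ω ↔ ∀ n, FeasibleHistory f (history ω n) := by
  constructor
  · intro h n
    induction n with
    | zero => trivial
    | succ n ih => exact ⟨h n, ih⟩
  · intro h n
    exact (h (n + 1)).1

theorem lintegral_toMeasure_eq_tsum [MeasurableSpace O] [DiscreteMeasurableSpace O] [Finite O]
    (p : PMF O) (g : O → ℝ≥0∞) : ∫⁻ o, g o ∂p.toMeasure = ∑' o, p o * g o := by
  rw [lintegral_countable']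
  congr 1
  ext o
  rw [PMF.toMeasure_apply_singleton _ _ (MeasurableSet.singleton o), mul_comm]

open Classical in
/-- The probability to avoid `Good` histories for `j` steps after the history `h`. -/
noncomputable def avoidProb (f : List O → PMF O) (Good : List O → Prop) : ℕ → List O → ℝ≥0∞
  | 0, _ => 1
  | j + 1, h => if Good h then 0 else ∑' o, f h o * avoidProb f Good j (o :: h)

theorem avoidProb_succ_le (f : List O → PMF O) (Good : List O → Prop) (j : ℕ) :
    ∀ h, avoidProb f Good (j + 1) h ≤ avoidProb f Good j h := by
  classical
  induction j with
  | zero =>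
    intro h
    simp only [avoidProb, mul_one]
    split_ifs
    · exact zero_le
    · exact (f h).tsum_coe.le
  | succ j ih =>
    intro h
    rw [avoidProb, avoidProb]
    split_ifs
    · exact le_rfl
    · exact ENNReal.tsum_le_tsum fun o => mul_le_mul_right (ih _) _

theorem avoidProb_antitone (f : List O → PMF O) (Good : List O → Prop) (h : List O) :
    Antitone fun j => avoidProb f Good j h :=
  antitone_nat_of_succ_le fun j => avoidProb_succ_le f Good j h

/-- From rank below `r`, fewer than `r` favourable outcomes in a row, each of probability at least
`ε`, lead to a good history, which removes the share `ε ^ r` from the bound `s`; all other outcomes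
are still bounded by `s`. The additive form keeps truncated subtraction out of the induction. -/
theorem avoidProb_add_le {f : List O → PMF O} {Good : List O → Prop} {rank : List O → ℕ}
    {ε : ℝ≥0∞} (hε : ε ≤ 1)
    (hstep : ∀ h, FeasibleHistory f h → ¬ Good h → ∃ o, o ∈ (f h).support ∧ ε ≤ f h o ∧
      rank (o :: h) < rank h) {j : ℕ} {s : ℝ≥0∞}
    (hs : ∀ h, FeasibleHistory f h → avoidProb f Good j h ≤ s) (r : ℕ) :
    ∀ h, FeasibleHistory f h → rank h < r → avoidProb f Good (j + r) h + ε ^ r * s ≤ s := by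
  classical
  induction r with
  | zero => intro h _ h'; omega
  | succ r ih =>
    intro h hf hr
    rw [← add_assoc, avoidProb]
    split_ifs with hg
    · rw [zero_add]
      exact mul_le_of_le_one_left' (pow_le_one' hε _)
    obtain ⟨o, ho, hεo, hro⟩ := hstep h hf hg
    have h1 := ih (o :: h) ⟨ho, hf⟩ (by omega)
    -- The whole deficit is charged to the single favourable outcome `o`.
    have h2 : ε ^ (r + 1) * s ≤ ∑' o', f h o' * (if o' = o then ε ^ r * s else 0) := by
      rw [tsum_eq_single o (by intro o' h'; simp [h'])]
      simp only [if_true]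
      rw [pow_succ', mul_assoc]
      gcongr
    calc _ ≤ (∑' o', f h o' * avoidProb f Good (j + r) (o' :: h)) +
          ∑' o', f h o' * (if o' = o then ε ^ r * s else 0) := by gcongr
      _ = ∑' o', f h o' * (avoidProb f Good (j + r) (o' :: h) +
            (if o' = o then ε ^ r * s else 0)) := by
          rw [← ENNReal.tsum_add]; simp only [mul_add]
      _ ≤ ∑' o', f h o' * s := by
          refine ENNReal.tsum_le_tsum fun o' => ?_
          by_cases e : o' = o
          · subst e; simp only [if_true]; gcongr
          · by_cases z : f h o' = 0
            · simp [z]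
            · simp only [e, if_false, add_zero]
              gcongr
              exact (avoidProb_antitone f Good _ (Nat.le_add_right j r)).trans
                (hs _ ⟨(PMF.mem_support_iff _ _).2 z, hf⟩)
      _ = s := by rw [ENNReal.tsum_mul_right, (f h).tsum_coe, one_mul]

/-- Ranks are at most `n`, so each block of `n + 1` steps contributes a factor `1 - ε ^ (n + 1)`. -/
theorem avoidProb_mul_le {f : List O → PMF O} {Good : List O → Prop} {rank : List O → ℕ}
    {ε : ℝ≥0∞} (hε : ε ≤ 1) {n : ℕ} (hrank : ∀ h, rank h ≤ n)
    (hstep : ∀ h, FeasibleHistory f h → ¬ Good h → ∃ o, o ∈ (f h).support ∧ ε ≤ f h o ∧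
      rank (o :: h) < rank h) (j : ℕ) :
    ∀ h, FeasibleHistory f h → avoidProb f Good (j * (n + 1)) h ≤ (1 - ε ^ (n + 1)) ^ j := by
  induction j with
  | zero => intro h _; simp [avoidProb]
  | succ j ih =>
    intro h hf
    have h1 := avoidProb_add_le hε hstep ih (n + 1) h hf (Nat.lt_succ_of_le (hrank h))
    have hfin : ε ^ (n + 1) * (1 - ε ^ (n + 1)) ^ j ≠ ⊤ := by
      refine ENNReal.mul_ne_top (ENNReal.pow_ne_top (ne_top_of_le_ne_top ENNReal.one_ne_top hε))
        (ENNReal.pow_ne_top (ne_top_of_le_ne_top ENNReal.one_ne_top tsub_le_self))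
    rw [show (j + 1) * (n + 1) = j * (n + 1) + (n + 1) by ring]
    calc _ ≤ (1 - ε ^ (n + 1)) ^ j - ε ^ (n + 1) * (1 - ε ^ (n + 1)) ^ j :=
          ENNReal.le_sub_of_add_le_right hfin h1
      _ = _ := by
          rw [pow_succ' (1 - _), ENNReal.sub_mul, one_mul]
          intro _ _
          exact ENNReal.pow_ne_top (ne_top_of_le_ne_top ENNReal.one_ne_top tsub_le_self)

section Law

variable [MeasurableSpace O] [DiscreteMeasurableSpace O] [Finite O]

instance (f : List O → PMF O) : IsProbabilityMeasure (pathLaw f) := by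
  unfold pathLaw; infer_instance

/-- A finite history factors through finitely many coordinates in a finite discrete space, on which
every function is measurable. -/
theorem measurable_history_comp {β : Type*} [MeasurableSpace β] (g : List O → β) (n : ℕ) :
    Measurable fun ω : ℕ → O => g (history ω n) := by
  cases n with
  | zero => simp only [history]; exact measurable_const
  | succ n =>
    have : (fun ω : ℕ → O => g (history ω (n + 1))) =
        (fun x => g (listOfIic x)) ∘ Preorder.frestrictLe (π := fun _ => O) n := by
      ext ω; simp [listOfIic_frestrictLe]
    rw [this]
    exact Measurable.of_discrete.comp (by fun_prop)

theorem map_zero_pathLaw (f : List O → PMF O) :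
    (pathLaw f).map (fun ω => ω 0) = (f []).toMeasure := by
  have h1 : (pathLaw f).map (Preorder.frestrictLe (π := fun _ => O) 0) =
      (f []).toMeasure.map (MeasurableEquiv.piUnique (fun _ : Finset.Iic 0 => O)).symm := by
    unfold pathLaw Kernel.trajMeasure
    rw [Measure.map_comp _ _ (by fun_prop), Kernel.traj_map_frestrictLe, Kernel.partialTraj_self]
    exact Measure.id_comp
  have h2 : (fun ω : ℕ → O => ω 0) =
      (MeasurableEquiv.piUnique (fun _ : Finset.Iic 0 => O)) ∘
        (Preorder.frestrictLe (π := fun _ => O) 0) := by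
    ext ω; rfl
  rw [h2, ← Measure.map_map (by fun_prop) (by fun_prop), h1, Measure.map_map (by fun_prop) (by fun_prop)]
  rw [MeasurableEquiv.self_comp_symm, Measure.map_id]

/-- Averaging over the next outcome. -/
theorem lintegral_history_succ (f : List O → PMF O) (g : List O → ℝ≥0∞) (n : ℕ) :
    ∫⁻ ω, g (history ω (n + 1)) ∂(pathLaw f) =
      ∫⁻ ω, ∑' o, f (history ω n) o * g (o :: history ω n) ∂(pathLaw f) := by
  cases n with
  | zero =>
    have : ∫⁻ ω, g (history ω (0 + 1)) ∂(pathLaw f) =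
        ∫⁻ o, g [o] ∂((pathLaw f).map fun ω => ω 0) := by
      rw [lintegral_map Measurable.of_discrete (by fun_prop)]; rfl
    rw [this, map_zero_pathLaw, lintegral_toMeasure_eq_tsum]
    simp [history]
  | succ n =>
    let G : (Finset.Iic n → O) × O → ℝ≥0∞ := fun x => g (x.2 :: listOfIic x.1)
    have h1 : ∫⁻ ω, g (history ω (n + 1 + 1)) ∂(pathLaw f) =
        ∫⁻ x, G x ∂((pathLaw f).map
          fun ω => (Preorder.frestrictLe (π := fun _ => O) n ω, ω (n + 1))) := by
      rw [lintegral_map Measurable.of_discrete (by fun_prop)]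
      simp only [G, listOfIic_frestrictLe]
      rfl
    have h2 := Kernel.map_frestrictLe_trajMeasure_compProd_eq_map_trajMeasure
      (X := fun _ => O) (μ₀ := (f []).toMeasure) (κ := stepKernel f) (a := n)
    change (pathLaw f).map _ ⊗ₘ _ = (pathLaw f).map _ at h2
    rw [h1, ← h2, Measure.lintegral_compProd Measurable.of_discrete,
      lintegral_map Measurable.of_discrete (by fun_prop)]
    congr 1
    ext ω
    simp only [G, listOfIic_frestrictLe]
    change ∫⁻ b, _ ∂(f (listOfIic _)).toMeasure = _
    rw [lintegral_toMeasure_eq_tsum, listOfIic_frestrictLe]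

theorem measure_history_eq (f : List O → PMF O) (P : List O → Prop) [DecidablePred P] (n : ℕ) :
    pathLaw f {ω | P (history ω n)} =
      ∫⁻ ω, (if P (history ω n) then 1 else 0) ∂(pathLaw f) := by
  have hm : MeasurableSet {ω : ℕ → O | P (history ω n)} :=
    measurableSet_setOfPred.2 (measurable_history_comp P n)
  rw [← lintegral_indicator_one hm]
  congr 1
  ext ω
  by_cases h : P (history ω n) <;> simp [h]

theorem ae_feasibleHistory (f : List O → PMF O) (n : ℕ) :
    ∀ᵐ ω ∂(pathLaw f), FeasibleHistory f (history ω n) := by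
  classical
  induction n with
  | zero => exact Eventually.of_forall fun _ => trivial
  | succ n ih =>
    change pathLaw f {ω | ¬ FeasibleHistory f (history ω (n + 1))} = 0
    rw [measure_history_eq f (fun h => ¬ FeasibleHistory f h),
      lintegral_history_succ f (fun h => if ¬ FeasibleHistory f h then 1 else 0)]
    rw [lintegral_eq_zero_iff (measurable_history_comp
      (fun h => ∑' o, f h o * if ¬ FeasibleHistory f (o :: h) then 1 else 0) n)]
    filter_upwards [ih] with ω hω
    simp only [Pi.zero_apply, ENNReal.tsum_eq_zero, mul_eq_zero]
    intro o
    by_cases ho : f (history ω n) o = 0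
    · exact Or.inl ho
    · right
      rw [if_neg]
      exact not_not.2 ⟨(PMF.mem_support_iff _ _).2 ho, hω⟩

theorem ae_feasible (f : List O → PMF O) : ∀ᵐ ω ∂(pathLaw f), Feasible f ω := by
  simp only [feasible_iff]
  exact ae_all_iff.2 (ae_feasibleHistory f)

/-- Each step multiplies the measure by a positive probability. This turns an almost sure property
into a path extending a prescribed history. -/
theorem pathLaw_cylinder_pos (f : List O → PMF O) :
    ∀ h : List O, FeasibleHistory f h → 0 < pathLaw f {ω | history ω h.length = h} := by
  classical
  intro h
  induction h with
  | nil => intro _; simp [history]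
  | cons o h ih =>
    rintro ⟨ho, hh⟩
    rw [measure_history_eq f (fun h' => h' = o :: h), List.length_cons,
      lintegral_history_succ f (fun h' => if h' = o :: h then 1 else 0)]
    have : ∀ ω : ℕ → O, (∑' o', f (history ω h.length) o' *
        (if o' :: history ω h.length = o :: h then (1 : ℝ≥0∞) else 0)) =
        f h o * (if history ω h.length = h then 1 else 0) := by
      intro ω
      rw [tsum_eq_single o]
      · by_cases e : history ω h.length = h <;> simp [e]
      · intro o' ho'
        simp [ho']
    simp only [this]
    rw [lintegral_const_mul _ (measurable_history_comp (fun h' => if h' = h then 1 else 0) _),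
      ← measure_history_eq f (fun h' => h' = h)]
    exact ENNReal.mul_pos ((PMF.mem_support_iff _ _).1 ho) (ih hh).ne'

/-- This identifies the recursion for `avoidProb` with a probability. The predicate `P` is arbitrary
so that the induction can absorb the condition at time `m` into a predicate on histories of length
`m + 1`. -/
theorem measure_avoid (f : List O → PMF O) (Good : List O → Prop) (j : ℕ) :
    ∀ (m : ℕ) (P : List O → Prop) [DecidablePred P],
      pathLaw f {ω | P (history ω m) ∧ ∀ i < j, ¬ Good (history ω (m + i))} =
        ∫⁻ ω, (if P (history ω m) then avoidProb f Good j (history ω m) else 0) ∂(pathLaw f) := by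
  classical
  induction j with
  | zero =>
    intro m P _
    simp only [Nat.not_lt_zero, false_imp_iff, implies_true, and_true]
    rw [measure_history_eq]
    simp only [avoidProb]
  | succ j ih =>
    intro m P _
    let P' : List O → Prop := fun h => P h.tail ∧ ¬ Good h.tail
    have e : {ω : ℕ → O | P (history ω m) ∧ ∀ i < j + 1, ¬ Good (history ω (m + i))} =
        {ω | P' (history ω (m + 1)) ∧ ∀ i < j, ¬ Good (history ω (m + 1 + i))} := by
      ext ω
      simp only [Set.mem_ofPred_eq, P', history, List.tail_cons]
      constructor
      · rintro ⟨h1, h2⟩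
        refine ⟨⟨h1, h2 0 (Nat.succ_pos j)⟩, fun i hi => ?_⟩
        have := h2 (i + 1) (by omega)
        rwa [show m + (i + 1) = m + 1 + i by ring] at this
      · rintro ⟨⟨h1, h2⟩, h3⟩
        refine ⟨h1, fun i hi => ?_⟩
        cases i with
        | zero => exact h2
        | succ i =>
          rw [show m + (i + 1) = m + 1 + i by ring]
          exact h3 i (by omega)
    rw [e, ih (m + 1) P',
      lintegral_history_succ f (fun h => if P' h then avoidProb f Good j h else 0)]
    congr 1
    ext ω
    simp only [P', List.tail_cons]
    by_cases h1 : P (history ω m) <;> by_cases h2 : Good (history ω m) <;>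
      simp [h1, h2, avoidProb]

/-- For each starting time `m`, avoiding good histories from `m` on has probability below every
power of a number less than 1, and there are only countably many `m`. -/
theorem ae_frequently_of_rank {f : List O → PMF O} {Good : List O → Prop} {rank : List O → ℕ}
    {ε : ℝ≥0∞} (hε0 : ε ≠ 0) {n : ℕ} (hrank : ∀ h, rank h ≤ n)
    (hstep : ∀ h, FeasibleHistory f h → ¬ Good h → ∃ o, o ∈ (f h).support ∧ ε ≤ f h o ∧
      rank (o :: h) < rank h) :
    ∀ᵐ ω ∂(pathLaw f), ∃ᶠ n in atTop, Good (history ω n) := by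
  classical
  -- The geometric estimate needs `ε ≤ 1`; capping `ε` preserves the lower bounds.
  wlog hε : ε ≤ 1 generalizing ε
  · refine this (ε := min ε 1) (by simp [hε0]) (fun h h1 h2 => ?_) (min_le_right _ _)
    obtain ⟨o, ho, h3, h4⟩ := hstep h h1 h2
    exact ⟨o, ho, (min_le_left _ _).trans h3, h4⟩
  simp only [frequently_atTop]
  rw [ae_all_iff]
  intro m
  have hlim : Tendsto (fun j : ℕ => (1 - ε ^ (n + 1)) ^ j) atTop (nhds 0) := by
    apply ENNReal.tendsto_pow_atTop_nhds_zero_of_lt_one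
    exact ENNReal.sub_lt_self ENNReal.one_ne_top one_ne_zero (pow_ne_zero _ hε0)
  have hle : ∀ j : ℕ, pathLaw f {ω | ¬ ∃ b, b ≥ m ∧ Good (history ω b)} ≤
      (1 - ε ^ (n + 1)) ^ j := by
    intro j
    calc _ ≤ pathLaw f {ω | True ∧ ∀ i < j * (n + 1), ¬ Good (history ω (m + i))} := by
          apply measure_mono
          intro ω hω
          refine ⟨trivial, fun i _ hg => hω ⟨m + i, Nat.le_add_right m i, hg⟩⟩
      _ = ∫⁻ ω, avoidProb f Good (j * (n + 1)) (history ω m) ∂(pathLaw f) := by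
          rw [measure_avoid f Good _ m (fun _ => True)]
          simp
      _ ≤ ∫⁻ _, (1 - ε ^ (n + 1)) ^ j ∂(pathLaw f) := by
          apply lintegral_mono_ae
          filter_upwards [ae_feasibleHistory f m] with ω hω
          exact avoidProb_mul_le hε hrank hstep j _ hω
      _ = _ := by simp
  exact le_antisymm (ge_of_tendsto' hlim hle) zero_le

end Law

/-! ### Sure and almost sure winning -/

/-- The two winning modes: on all paths, or with probability one. -/
inductive Mode
  | sure | almost

/-- The random outcome in `s` lies in `p`: certainly, or with positive probability. -/
def Mode.Hits : Mode → Set O → (O → Prop) → Prop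
  | .sure, s, p => ∀ o ∈ s, p o
  | .almost, s, p => ∃ o ∈ s, p o

/-- The random outcome in `s` lies in `p`: with positive probability, or certainly. -/
def Mode.DualHits : Mode → Set O → (O → Prop) → Prop
  | .sure, s, p => ∃ o ∈ s, p o
  | .almost, s, p => ∀ o ∈ s, p o

theorem Mode.not_hits {m : Mode} {s : Set O} {p : O → Prop} :
    ¬ m.Hits s p ↔ m.DualHits s fun o => ¬ p o := by
  cases m <;> simp [Mode.Hits, Mode.DualHits]

theorem Mode.Hits.mono {m : Mode} {s : Set O} {p q : O → Prop} (h : m.Hits s p)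
    (hpq : ∀ o ∈ s, p o → q o) : m.Hits s q := by
  cases m with
  | sure => exact fun o ho => hpq o ho (h o ho)
  | almost =>
    obtain ⟨o, ho, h⟩ := h
    exact ⟨o, ho, hpq o ho h⟩

theorem Mode.DualHits.mono {m : Mode} {s : Set O} {p q : O → Prop} (h : m.DualHits s p)
    (hpq : ∀ o ∈ s, p o → q o) : m.DualHits s q := by
  cases m with
  | sure =>
    obtain ⟨o, ho, h⟩ := h
    exact ⟨o, ho, hpq o ho h⟩
  | almost => exact fun o ho => hpq o ho (h o ho)

theorem Mode.DualHits.exists {m : Mode} {s : Set O} {p : O → Prop} (h : m.DualHits s p)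
    (hs : s.Nonempty) : ∃ o ∈ s, p o := by
  cases m with
  | sure => exact h
  | almost => exact ⟨hs.some, hs.some_mem, h _ hs.some_mem⟩

/-- All feasible paths, or almost all paths, satisfy `p`. -/
def Mode.Wins [Finite O] : Mode → (List O → PMF O) → ((ℕ → O) → Prop) → Prop
  | .sure, f, p => ∀ ω, Feasible f ω → p ω
  | .almost, f, p => AlmostSurely f p

theorem Mode.Wins.mono [Finite O] {m : Mode} {f : List O → PMF O} {p q : (ℕ → O) → Prop}
    (h : m.Wins f p) (hpq : ∀ ω, Feasible f ω → p ω → q ω) : m.Wins f q := by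
  cases m with
  | sure => exact fun ω hω => hpq ω hω (h ω hω)
  | almost =>
    let _ : MeasurableSpace O := ⊤
    have : DiscreteMeasurableSpace O := ⟨fun _ => trivial⟩
    change ∀ᵐ ω ∂(pathLaw f), q ω
    have h' : ∀ᵐ ω ∂(pathLaw f), p ω := h
    filter_upwards [ae_feasible f, h'] with ω h1 h2
    exact hpq ω h1 h2

/-- A natural number cannot decrease forever, which settles the sure mode; in the almost sure mode
the uniform `ε` is what allows the geometric estimate. The criterion serves both for plays of the
game and for runs of the belief automaton. -/
theorem Mode.wins_of_rank [Finite O] {m : Mode} {f : List O → PMF O} {Good : List O → Prop}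
    {rank : List O → ℕ} {ε : ℝ≥0∞} (hε0 : ε ≠ 0) {n : ℕ} (hrank : ∀ h, rank h ≤ n)
    (hstep : ∀ h, FeasibleHistory f h → ¬ Good h →
      (∀ o ∈ (f h).support, ε ≤ f h o) ∧
      m.Hits (f h).support fun o => rank (o :: h) < rank h) :
    m.Wins f fun ω => ∃ᶠ n in atTop, Good (history ω n) := by
  cases m with
  | almost =>
    let _ : MeasurableSpace O := ⊤
    have : DiscreteMeasurableSpace O := ⟨fun _ => trivial⟩
    refine ae_frequently_of_rank hε0 hrank fun h h1 h2 => ?_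
    obtain ⟨h3, o, ho, h4⟩ := hstep h h1 h2
    exact ⟨o, ho, h3 o ho, h4⟩
  | sure =>
    intro ω hω
    rw [frequently_atTop]
    intro a
    by_contra hcon
    push Not at hcon
    have key : ∀ k, rank (history ω (a + k)) + k ≤ rank (history ω a) := by
      intro k
      induction k with
      | zero => simp
      | succ k ih =>
        have := (hstep _ (feasible_iff.1 hω (a + k)) (hcon (a + k) (Nat.le_add_right a k))).2
          (ω (a + k)) (hω (a + k))
        change rank (history ω (a + k + 1)) < _ at this
        rw [show a + (k + 1) = a + k + 1 from rfl]
        omega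
    have := key (rank (history ω a) + 1)
    omega

/-- Extending a finite history to an infinite sequence by always choosing `c`. -/
noncomputable def extendHist (c : List O → O) (h : List O) : ℕ → List O
  | 0 => h
  | n + 1 => c (extendHist c h n) :: extendHist c h n

theorem extendHist_spec (c : List O → O) (h : List O) :
    ∃ ω : ℕ → O, history ω h.length = h ∧
      ∀ n, ω (h.length + n) = c (history ω (h.length + n)) := by
  -- Histories list the most recent outcome first, so time `n` corresponds to the entry `h.length -
  -- 1 - n`.
  let ω : ℕ → O := fun n => if hn : n < h.length then h.get ⟨h.length - 1 - n, by omega⟩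
    else c (extendHist c h (n - h.length))
  have hprefix : ∀ (h' : List O) (ω' : ℕ → O),
      (∀ n (hn : n < h'.length), ω' n = h'.get ⟨h'.length - 1 - n, by omega⟩) →
      history ω' h'.length = h' := by
    intro h'
    induction h' with
    | nil => intro _ _; rfl
    | cons o h' ih =>
      intro ω' hω'
      simp only [List.length_cons, history]
      congr 1
      · have := hω' h'.length (by simp)
        simpa using this
      · apply ih
        intro n hn
        have := hω' n (by simp; omega)
        rw [this]
        simp only [List.length_cons, List.get_eq_getElem]
        rw [List.getElem_cons]
        have : h'.length + 1 - 1 - n ≠ 0 := by omega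
        simp only [this, dite_false]
        congr 1
        omega
  have h0 : history ω h.length = h := hprefix h ω fun n hn => by simp [ω, hn]
  have h1 : ∀ n, history ω (h.length + n) = extendHist c h n := by
    intro n
    induction n with
    | zero => exact h0
    | succ n ih =>
      rw [← add_assoc, history, ih, extendHist]
      congr 1
      simp [ω]
  refine ⟨ω, h0, fun n => ?_⟩
  rw [h1]
  simp [ω]

/-- This is the tool of the opponent. In the almost sure mode all outcomes preserve `S`, so any good
path through the cylinder of `h₀`, which has positive measure, will do. In the sure mode the path is
built by choosing an outcome in `S` at each step. -/
theorem Mode.exists_staying [Finite O] {m : Mode} {f : List O → PMF O} {p : (ℕ → O) → Prop}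
    (hw : m.Wins f p) {h₀ : List O} (hf : FeasibleHistory f h₀) {S : List O → Prop} (h0 : S h₀)
    (hS : ∀ h, FeasibleHistory f h → S h → m.DualHits (f h).support fun o => S (o :: h)) :
    ∃ ω, Feasible f ω ∧ (∀ n, S (history ω (h₀.length + n))) ∧ p ω := by
  cases m with
  | almost =>
    let _ : MeasurableSpace O := ⊤
    have : DiscreteMeasurableSpace O := ⟨fun _ => trivial⟩
    have hw' : ∀ᵐ ω ∂(pathLaw f), p ω := hw
    have : ∃ ω, history ω h₀.length = h₀ ∧ Feasible f ω ∧ p ω := by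
      by_contra hcon
      push Not at hcon
      have hz : pathLaw f {ω | history ω h₀.length = h₀} = 0 := by
        have : ∀ᵐ ω ∂(pathLaw f), ¬ history ω h₀.length = h₀ := by
          filter_upwards [ae_feasible f, hw'] with ω h1 h2 h3
          exact hcon ω h3 h1 h2
        simpa [ae_iff] using this
      exact (pathLaw_cylinder_pos f h₀ hf).ne' hz
    obtain ⟨ω, h1, h2, h3⟩ := this
    refine ⟨ω, h2, fun n => ?_, h3⟩
    induction n with
    | zero => simpa [h1] using h0
    | succ n ih => exact hS _ (feasible_iff.1 h2 _) ih _ (h2 _)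
  | sure =>
    classical
    let c : List O → O := fun h => if hh : ∃ o ∈ (f h).support, S (o :: h) then hh.choose
      else (f h).support_nonempty.some
    obtain ⟨ω, h1, h2⟩ := extendHist_spec c h₀
    have key : ∀ n, FeasibleHistory f (history ω (h₀.length + n)) ∧
        S (history ω (h₀.length + n)) := by
      intro n
      induction n with
      | zero => exact ⟨by simpa [h1] using hf, by simpa [h1] using h0⟩
      | succ n ih =>
        have hh : ∃ o ∈ (f (history ω (h₀.length + n))).support,
          S (o :: history ω (h₀.length + n)) := hS _ ih.1 ih.2
        have hc : ω (h₀.length + n) = hh.choose := by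
          rw [h2]; simp only [c]; rw [dif_pos hh]
        rw [← add_assoc, history, hc]
        exact ⟨⟨hh.choose_spec.1, ih.1⟩, hh.choose_spec.2⟩
    have hfeas : Feasible f ω := by
      have tail : ∀ n k, FeasibleHistory f (history ω (n + k)) → FeasibleHistory f (history ω n) := by
        intro n k
        induction k with
        | zero => exact id
        | succ k ih => exact fun h => ih h.2
      rw [feasible_iff]
      intro n
      apply tail n h₀.length
      rw [add_comm]
      exact (key n).1
    exact ⟨ω, hfeas, fun n => (key n).2, hw ω hfeas⟩

end RandomSequence


theorem exists_pos_lower_bound {α : Type*} {T : Set α} (hT : T.Finite) {g : α → ℝ≥0∞}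
    (hg : ∀ x ∈ T, g x ≠ 0) : ∃ ε : ℝ≥0∞, ε ≠ 0 ∧ ∀ x ∈ T, ε ≤ g x := by
  induction T, hT using Set.Finite.induction_on with
  | empty => exact ⟨1, one_ne_zero, by simp⟩
  | @insert a s _ _ ih =>
    obtain ⟨ε, h0, h⟩ := ih fun x hx => hg x (Set.mem_insert_of_mem a hx)
    refine ⟨min ε (g a), ?_, ?_⟩
    · have := hg a (Set.mem_insert a s)
      simp only [ne_eq, min_eq_iff, not_or, not_and]
      grind
    · rintro x (rfl | hx)
      · exact min_le_right _ _
      · exact (min_le_left _ _).trans (h x hx)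

theorem exists_forall_le_of_finite {α : Type*} [Finite α] (r : α → ℕ) : ∃ n, ∀ x, r x ≤ n := by
  obtain ⟨n, hn⟩ := (Set.finite_range r).bddAbove
  exact ⟨n, fun x => hn ⟨x, rfl⟩⟩

/-! ### Fixed-point solution of finite stochastic games -/

namespace StochasticGame

variable (G : StochasticGame.{u})

/-- The positions from which the `●`-player can, in one round, stay in `Y`, and reach `X`
(certainly or with positive probability, depending on the mode) unless the round is a tick. -/
def pre (m : Mode) (Y X : Set G.Pos) : Set G.Pos :=
  {p | ∃ C, G.BLegal p C ∧ ∀ c, G.CLegal p C c →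
    (∀ o ∈ (G.law p c).support, G.next p c o ∈ Y) ∧
    (c ∉ G.tick → m.Hits (G.law p c).support fun o => G.next p c o ∈ X)}

theorem pre_mono (m : Mode) {Y Y' X X' : Set G.Pos} (hY : Y ⊆ Y') (hX : X ⊆ X') :
    G.pre m Y X ⊆ G.pre m Y' X' := by
  rintro p ⟨C, hC, h⟩
  exact ⟨C, hC, fun c hc => ⟨fun o ho => hY ((h c hc).1 o ho),
    fun ht => ((h c hc).2 ht).mono fun o _ ho => hX ho⟩⟩

/-- The positions from which the `●`-player can enforce a tick within `r` rounds while staying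
in `Y`. -/
def attr (m : Mode) (Y : Set G.Pos) : ℕ → Set G.Pos
  | 0 => ∅
  | r + 1 => G.pre m Y (attr m Y r)

theorem attr_monotone (m : Mode) (Y : Set G.Pos) : Monotone (G.attr m Y) := by
  refine monotone_nat_of_le_succ fun r => ?_
  induction r with
  | zero => exact Set.empty_subset _
  | succ r ih => exact G.pre_mono m subset_rfl ih

theorem attr_mono (m : Mode) {Y Y' : Set G.Pos} (h : Y ⊆ Y') (r : ℕ) :
    G.attr m Y r ⊆ G.attr m Y' r := by
  induction r with
  | zero => exact subset_rfl
  | succ r ih => exact G.pre_mono m h ih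

/-- The `i`-th approximation of the winning region for `□◇ tick`. -/
def approx (m : Mode) : ℕ → Set G.Pos
  | 0 => Set.univ
  | i + 1 => ⋃ r, G.attr m (approx m i) r

theorem approx_antitone (m : Mode) : Antitone (G.approx m) := by
  refine antitone_nat_of_succ_le fun i => ?_
  induction i with
  | zero => exact Set.subset_univ _
  | succ i ih => exact Set.iUnion_mono fun r => G.attr_mono m ih r

/-- A solution of the game: a winning region, in which the `●`-player can decrease the rank until
the next tick, and outside of which the `○`-player can avoid ticks unless the stage decreases. -/
structure Solution (m : Mode) where
  region : Set G.Pos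
  rank : G.Pos → ℕ
  stage : G.Pos → ℕ
  win : ∀ p ∈ region, ∃ C, G.BLegal p C ∧ ∀ c, G.CLegal p C c →
    (∀ o ∈ (G.law p c).support, G.next p c o ∈ region) ∧
    (c ∉ G.tick → m.Hits (G.law p c).support fun o => rank (G.next p c o) < rank p)
  lose : ∀ p ∉ region, ∀ C, G.BLegal p C → ∃ c, G.CLegal p C c ∧
    ((∃ o ∈ (G.law p c).support, G.next p c o ∉ region ∧ stage (G.next p c o) < stage p) ∨
    (c ∉ G.tick ∧ m.DualHits (G.law p c).support fun o =>
      G.next p c o ∉ region ∧ stage (G.next p c o) ≤ stage p))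

/-- On a finite set both the growing attractors and the shrinking approximations stabilise. The rank
is the least attractor level containing a position, the stage the first approximation excluding it.
A position of stage `i + 1` violates `pre` for `approx i` and `approx (i + 1)`: some answer either
may leave `approx i`, which lowers the stage, or is no tick and keeps play outside `approx (i + 1)`.
-/
theorem exists_solution [Finite G.Pos] (m : Mode) : Nonempty (G.Solution m) := by
  classical
  -- The union is attained at a finite level, so a further application of `pre` adds nothing.
  have hpre : ∀ Y, G.pre m Y (⋃ r, G.attr m Y r) ⊆ ⋃ r, G.attr m Y r := by
    intro Y
    obtain ⟨n, hn⟩ := WellFoundedGT.monotone_chain_condition ⟨G.attr m Y, G.attr_monotone m Y⟩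
    have : ⋃ r, G.attr m Y r = G.attr m Y n := by
      refine subset_antisymm (Set.iUnion_subset fun r => ?_) (Set.subset_iUnion _ n)
      rcases le_total r n with h | h
      · exact G.attr_monotone m Y h
      · exact (hn r h).ge
    rw [this]
    exact (hn (n + 1) (Nat.le_succ n)).ge
  obtain ⟨n, hn⟩ := WellFoundedGT.monotone_chain_condition
    (α := (Set G.Pos)ᵒᵈ) ⟨fun i => OrderDual.toDual (G.approx m i), G.approx_antitone m⟩
  have hn' : ∀ k, n ≤ k → G.approx m n = G.approx m k := fun k hk => hn k hk
  set W := G.approx m n with hW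
  have hWsub : ∀ i, W ⊆ G.approx m i := by
    intro i
    rcases le_total i n with h | h
    · exact G.approx_antitone m h
    · exact (hn' i h).le
  have hWfix : W = ⋃ r, G.attr m W r := hn' (n + 1) (Nat.le_succ n)
  have hout : ∀ p, p ∉ W → ∃ i, p ∉ G.approx m i := fun p hp => ⟨n, hp⟩
  have hin : ∀ p, p ∈ W → ∃ r, p ∈ G.attr m W r := by
    intro p hp
    rw [hWfix] at hp
    exact Set.mem_iUnion.1 hp
  let rank : G.Pos → ℕ := fun p => if h : ∃ r, p ∈ G.attr m W r then Nat.find h else 0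
  let stage : G.Pos → ℕ := fun p => if h : ∃ i, p ∉ G.approx m i then Nat.find h else 0
  have rank_le : ∀ p r, p ∈ G.attr m W r → rank p ≤ r := by
    intro p r h
    have h' : ∃ r, p ∈ G.attr m W r := ⟨r, h⟩
    simp only [rank, dif_pos h']
    exact Nat.find_min' h' h
  have stage_le : ∀ p i, p ∉ G.approx m i → stage p ≤ i := by
    intro p i h
    have h' : ∃ i, p ∉ G.approx m i := ⟨i, h⟩
    simp only [stage, dif_pos h']
    exact Nat.find_min' h' h
  refine ⟨⟨W, rank, stage, ?_, ?_⟩⟩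
  · intro p hp
    have h := hin p hp
    have e : rank p = Nat.find h := by simp only [rank, dif_pos h]
    have hs := Nat.find_spec h
    rw [← e] at hs
    cases hr : rank p with
    | zero => rw [hr] at hs; exact hs.elim
    | succ r =>
      rw [hr] at hs
      obtain ⟨C, hC, h⟩ := hs
      refine ⟨C, hC, fun c hc => ⟨(h c hc).1, fun ht => ((h c hc).2 ht).mono fun o _ ho => ?_⟩⟩
      exact Nat.lt_succ_of_le (rank_le _ _ ho)
  · intro p hp C hC
    have h := hout p hp
    have e : stage p = Nat.find h := by simp only [stage, dif_pos h]
    have hs := Nat.find_spec h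
    have hmin := fun i => Nat.find_min h (m := i)
    rw [← e] at hs hmin
    cases hr : stage p with
    | zero => rw [hr] at hs; exact (hs trivial).elim
    | succ i =>
      rw [hr] at hs hmin
      have h1 : p ∉ G.pre m (G.approx m i) (G.approx m (i + 1)) := fun h => hs (hpre _ h)
      have h2 : ∃ c, G.CLegal p C c ∧ ¬ ((∀ o ∈ (G.law p c).support, G.next p c o ∈ G.approx m i) ∧
          (c ∉ G.tick → m.Hits (G.law p c).support
            fun o => G.next p c o ∈ G.approx m (i + 1))) := by
        by_contra hcon
        push Not at hcon
        exact h1 ⟨C, hC, hcon⟩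
      obtain ⟨c, hc, h3⟩ := h2
      refine ⟨c, hc, ?_⟩
      by_cases h4 : ∀ o ∈ (G.law p c).support, G.next p c o ∈ G.approx m i
      · have h5 : ¬ (c ∉ G.tick → m.Hits (G.law p c).support
            fun o => G.next p c o ∈ G.approx m (i + 1)) := fun h => h3 ⟨h4, h⟩
        rw [Classical.not_imp, Mode.not_hits] at h5
        exact Or.inr ⟨h5.1, h5.2.mono fun o _ ho => ⟨fun h => ho (hWsub _ h), stage_le _ _ ho⟩⟩
      · push Not at h4
        obtain ⟨o, ho, h4⟩ := h4
        exact Or.inl ⟨o, ho, fun h => h4 (hWsub _ h), Nat.lt_succ_of_le (stage_le _ _ h4)⟩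

/-- The `●`-player has a winning strategy. -/
def Winnable (m : Mode) : Prop :=
  ∃ σ : G.BStrategy, ∀ τ : G.CStrategy, CObeys σ τ →
    BObeys σ τ ∧ m.Wins (playLaw σ τ) (InfTick σ τ)

variable {G}

/-- The strategy is positional. Replacing offers by ones with finitely many answers leaves only
finitely many random choices in the region, hence a common positive lower bound on their
probabilities. -/
theorem Solution.winnable [Finite G.Pos] {m : Mode} (S : G.Solution m)
    (hfin : ∀ p C, G.BLegal p C → ∃ C', G.BLegal p C' ∧ {c | G.CLegal p C' c}.Finite ∧
      ∀ c, G.CLegal p C' c → G.CLegal p C c)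
    (hinit : G.init ∈ S.region) : G.Winnable m := by
  classical
  have hstrat : ∀ p, ∃ C, p ∈ S.region → G.BLegal p C ∧ {c | G.CLegal p C c}.Finite ∧
      ∀ c, G.CLegal p C c → (∀ o ∈ (G.law p c).support, G.next p c o ∈ S.region) ∧
      (c ∉ G.tick → m.Hits (G.law p c).support fun o => S.rank (G.next p c o) < S.rank p) := by
    intro p
    by_cases hp : p ∈ S.region
    · obtain ⟨C, hC, h⟩ := S.win p hp
      obtain ⟨C', h1, h2, h3⟩ := hfin p C hC
      exact ⟨C', fun _ => ⟨h1, h2, fun c hc => h c (h3 c hc)⟩⟩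
    · exact ⟨(S.win _ hinit).choose, fun h => (hp h).elim⟩
  choose strat hstrat using hstrat
  refine ⟨fun h => strat (G.pos h), fun τ hτ => ?_⟩
  set σ : G.BStrategy := fun h => strat (G.pos h) with hσ
  have hreg : ∀ h, FeasibleHistory (playLaw σ τ) h → G.pos (play σ τ h) ∈ S.region := by
    intro h
    induction h with
    | nil => exact fun _ => hinit
    | cons o h ih =>
      rintro ⟨ho, hh⟩
      have hp := ih hh
      have hs := hstrat _ hp
      exact (hs.2.2 _ (hτ h hh hs.1)).1 o ho
  refine ⟨fun h hh => (hstrat _ (hreg h hh)).1, ?_⟩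
  let T : Set (G.Pos × G.CMove × G.Out) := {x | x.1 ∈ S.region ∧
    G.CLegal x.1 (strat x.1) x.2.1 ∧ x.2.2 ∈ (G.law x.1 x.2.1).support}
  have hT : T.Finite := by
    have : T ⊆ ⋃ p ∈ S.region, {p} ×ˢ ({c | G.CLegal p (strat p) c} ×ˢ Set.univ) := by
      rintro ⟨p, c, o⟩ ⟨h1, h2, _⟩
      exact Set.mem_biUnion h1 ⟨rfl, h2, trivial⟩
    refine Set.Finite.subset (Set.Finite.biUnion (Set.toFinite _) fun p hp => ?_) this
    exact (Set.finite_singleton p).prod ((hstrat p hp).2.1.prod Set.finite_univ)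
  obtain ⟨ε, hε, hεT⟩ := exists_pos_lower_bound hT (g := fun x => G.law x.1 x.2.1 x.2.2)
    fun x hx => (PMF.mem_support_iff _ _).1 hx.2.2
  obtain ⟨n, hn⟩ := exists_forall_le_of_finite S.rank
  refine Mode.wins_of_rank (Good := fun h => cmove σ τ h ∈ G.tick)
    (rank := fun h => S.rank (G.pos (play σ τ h))) hε (fun h => hn _) fun h hh hg => ?_
  have hs := hstrat _ (hreg h hh)
  have hc := hτ h hh hs.1
  exact ⟨fun o ho => hεT (G.pos (play σ τ h), cmove σ τ h, o) ⟨hreg h hh, hc, ho⟩,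
    (hs.2.2 _ hc).2 hg⟩

/-- Otherwise the ○-player answers by `S.lose` outside the region. After a feasible history of least
stage outside the region, the stage-lowering alternative is impossible, so ticks are avoided along
some path that the objective must cover. `Inv` provides legal answers where `S.lose` does not apply.
-/
theorem Solution.init_mem_of_winnable [Nonempty G.CMove] {m : Mode} (S : G.Solution m)
    (Inv : G.Pos → Prop) (hInv0 : Inv G.init)
    (hInv : ∀ p C c, Inv p → G.BLegal p C → G.CLegal p C c →
      ∀ o ∈ (G.law p c).support, Inv (G.next p c o))
    (hlegal : ∀ p C, Inv p → ∃ c, G.CLegal p C c ∧ ∀ o ∈ (G.law p c).support, Inv (G.next p c o))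
    (hwin : G.Winnable m) : G.init ∈ S.region := by
  classical
  by_contra hinit
  obtain ⟨σ, hσ⟩ := hwin
  have hresp : ∀ p C, ∃ c, (Inv p → G.CLegal p C c ∧
      ∀ o ∈ (G.law p c).support, Inv (G.next p c o)) ∧ (p ∉ S.region → G.BLegal p C →
      ((∃ o ∈ (G.law p c).support, G.next p c o ∉ S.region ∧ S.stage (G.next p c o) < S.stage p) ∨
      (c ∉ G.tick ∧ m.DualHits (G.law p c).support fun o =>
        G.next p c o ∉ S.region ∧ S.stage (G.next p c o) ≤ S.stage p))) := by
    intro p C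
    by_cases hp : p ∉ S.region ∧ G.BLegal p C
    · obtain ⟨c, h1, h2⟩ := S.lose p hp.1 C hp.2
      exact ⟨c, fun hi => ⟨h1, hInv p C c hi hp.2 h1⟩, fun _ _ => h2⟩
    · by_cases hi : Inv p
      · obtain ⟨c, hc⟩ := hlegal p C hi
        exact ⟨c, fun _ => hc, fun h1 h2 => (hp ⟨h1, h2⟩).elim⟩
      · exact ⟨Classical.arbitrary _, fun h => (hi h).elim, fun h1 h2 => (hp ⟨h1, h2⟩).elim⟩
  choose resp hresp1 hresp2 using hresp
  let τ : G.CStrategy := fun h C => resp (G.pos h) C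
  have hI : ∀ h, FeasibleHistory (playLaw σ τ) h → Inv (G.pos (play σ τ h)) := by
    intro h
    induction h with
    | nil => exact fun _ => hInv0
    | cons o h ih =>
      rintro ⟨ho, hh⟩
      exact (hresp1 _ _ (ih hh)).2 o ho
  obtain ⟨hB, hw⟩ := hσ τ fun h hh _ => (hresp1 _ _ (hI h hh)).1
  have hex : ∃ k h, FeasibleHistory (playLaw σ τ) h ∧ G.pos (play σ τ h) ∉ S.region ∧
      S.stage (G.pos (play σ τ h)) = k := ⟨_, [], trivial, hinit, rfl⟩
  obtain ⟨h₀, hf, hr, hk⟩ := Nat.find_spec hex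
  have hmin : ∀ h, FeasibleHistory (playLaw σ τ) h → G.pos (play σ τ h) ∉ S.region →
      Nat.find hex ≤ S.stage (G.pos (play σ τ h)) :=
    fun h h1 h2 => Nat.find_min' hex ⟨h, h1, h2, rfl⟩
  let P : List G.Out → Prop := fun h => G.pos (play σ τ h) ∉ S.region ∧
    S.stage (G.pos (play σ τ h)) ≤ Nat.find hex
  have hstep : ∀ h, FeasibleHistory (playLaw σ τ) h → P h → cmove σ τ h ∉ G.tick ∧
      m.DualHits (playLaw σ τ h).support fun o => P (o :: h) := by
    intro h hh hP
    rcases hresp2 (G.pos (play σ τ h)) (bmove σ τ h) hP.1 (hB h hh) with ⟨o, ho, h1, h2⟩ | ⟨h1, h2⟩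
    · have : Nat.find hex ≤ S.stage (G.pos (play σ τ (o :: h))) := hmin (o :: h) ⟨ho, hh⟩ h1
      exact absurd (lt_of_lt_of_le h2 hP.2) (not_lt.2 this)
    · exact ⟨h1, h2.mono fun o _ ho => ⟨ho.1, ho.2.trans hP.2⟩⟩
  obtain ⟨ω, h1, h2, h3⟩ := Mode.exists_staying hw hf (S := P) ⟨hr, hk.le⟩
    fun h hh hP => (hstep h hh hP).2
  obtain ⟨n, hn, ht⟩ := frequently_atTop.1 h3 h₀.length
  obtain ⟨k, rfl⟩ := Nat.exists_eq_add_of_le hn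
  exact (hstep _ (feasible_iff.1 h1 _) (h2 k)).1 ht

end StochasticGame


/-! ### Regions -/

section Order

/-- Either `t` is one of the points `p i`, matched by `q i`, or it lies in a gap between them, and
the corresponding gap for `q` is inhabited by density. -/
theorem exists_order_match {ι : Type*} [Finite ι] {p q : ι → ℝ}
    (h : ∀ i j, p i < p j ↔ q i < q j) (t : ℝ) :
    ∃ t', ∀ i, (t < p i ↔ t' < q i) ∧ (p i < t ↔ q i < t') := by
  classical
  have := Fintype.ofFinite ι
  by_cases hex : ∃ i, p i = t
  · obtain ⟨i, rfl⟩ := hex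
    exact ⟨q i, fun j => ⟨h i j, h j i⟩⟩
  · push Not at hex
    obtain ⟨t', h1, h2⟩ := Order.exists_between_finsets
      ((Finset.univ.filter fun i => p i < t).image q) ((Finset.univ.filter fun i => t < p i).image q)
      (by
        simp only [Finset.mem_image, Finset.mem_filter, Finset.mem_univ, true_and]
        rintro _ ⟨i, hi, rfl⟩ _ ⟨j, hj, rfl⟩
        exact (h i j).1 (hi.trans hj))
    simp only [Finset.mem_image, Finset.mem_filter, Finset.mem_univ, true_and,
      forall_exists_index, and_imp, forall_apply_eq_imp_iff₂] at h1 h2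
    refine ⟨t', fun i => ?_⟩
    rcases lt_or_gt_of_ne (hex i) with hi | hi
    · exact ⟨⟨fun h => absurd h hi.not_gt, fun h => absurd h (h1 i hi).not_gt⟩,
        fun _ => h1 i hi, fun _ => hi⟩
    · exact ⟨⟨fun _ => h2 i hi, fun _ => hi⟩, fun h => absurd h hi.not_gt,
        fun h => absurd h (h2 i hi).not_gt⟩

/-- If the thresholds `thr i` of the clocks `clk i` are passed in the same order from `v` and
from `w`, then each delay from `v` is matched by a delay from `w`. -/
theorem exists_delay_match {C : Type u} {ι : Type*} [Finite ι] {v w : Valuation C}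
    (clk : ι → C) (thr : ι → ℕ)
    (h1 : ∀ i, ((v (clk i) : ℝ) < thr i ↔ (w (clk i) : ℝ) < thr i) ∧
      ((thr i : ℝ) < v (clk i) ↔ (thr i : ℝ) < w (clk i)))
    (h2 : ∀ i j, (thr i - v (clk i) : ℝ) < thr j - v (clk j) ↔
      (thr i - w (clk i) : ℝ) < thr j - w (clk j)) (t : ℝ≥0) :
    ∃ t' : ℝ≥0, (t = 0 ↔ t' = 0) ∧ ∀ i,
      (((v.delay t (clk i) : ℝ≥0) : ℝ) < thr i ↔ ((w.delay t' (clk i) : ℝ≥0) : ℝ) < thr i) ∧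
      ((thr i : ℝ) < (v.delay t (clk i) : ℝ≥0) ↔ (thr i : ℝ) < (w.delay t' (clk i) : ℝ≥0)) := by
  -- The extra index `none`, placed at `0`, records the sign of the delay: it makes `t'` nonnegative
  -- and yields `t = 0 ↔ t' = 0`.
  let p : Option ι → ℝ := fun o => o.elim 0 fun i => thr i - v (clk i)
  let q : Option ι → ℝ := fun o => o.elim 0 fun i => thr i - w (clk i)
  have hpq : ∀ i j, p i < p j ↔ q i < q j := by
    rintro (_ | i) (_ | j)
    · simp [p, q]
    · simpa [p, q] using (h1 j).1
    · simpa [p, q] using (h1 i).2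
    · exact h2 i j
  obtain ⟨t', ht'⟩ := exists_order_match hpq t
  have h0 := ht' none
  simp only [p, q, Option.elim] at h0
  have hnn : 0 ≤ t' := by
    by_contra hneg
    exact absurd (h0.1.2 (not_le.1 hneg)) (not_lt.2 t.2)
  lift t' to ℝ≥0 using hnn
  refine ⟨t', ?_, fun i => ?_⟩
  · have h3 : (0 : ℝ) < t ↔ (0 : ℝ) < t' := h0.2
    rw [NNReal.coe_pos, NNReal.coe_pos, pos_iff_ne_zero, pos_iff_ne_zero] at h3
    exact not_iff_not.1 h3
  · have h3 := ht' (some i)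
    simp only [p, q, Option.elim] at h3
    simp only [Valuation.delay, NNReal.coe_add]
    constructor
    · have := h3.1
      constructor <;> intro h <;> grind
    · have := h3.2
      constructor <;> intro h <;> grind

end Order

namespace Region

variable {N : ℕ} {X : Type u}

theorem of_eq_iff {v w : Valuation X} : of N v = of N w ↔ (regionSetoid N X) v w :=
  ⟨fun h => Quotient.exact h, fun h => Quotient.sound (s := regionSetoid N X) h⟩

theorem exists_of_eq (θ : Region N X) : ∃ v, of N v = θ := Quotient.exists_rep θ

theorem sat_iff {v w : Valuation X} (h : of N v = of N w) {g : Guard X} (hg : g.BoundedBy N) :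
    v ∈ g.sat ↔ w ∈ g.sat := of_eq_iff.1 h g hg

theorem reset_of (v : Valuation X) (Y : Set X) : (of N v).reset Y = of N (v.reset Y) := rfl

theorem clock_lt_iff {v w : Valuation X} (h : of N v = of N w) (x : X) {c : ℕ} (hc : c ≤ N) :
    (v x : ℝ) < c ↔ (w x : ℝ) < c :=
  equiv_iff_atoms.1 (of_eq_iff.1 h) (.clock x .lt c) hc

theorem lt_clock_iff {v w : Valuation X} (h : of N v = of N w) (x : X) {c : ℕ} (hc : c ≤ N) :
    (c : ℝ) < v x ↔ (c : ℝ) < w x :=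
  equiv_iff_atoms.1 (of_eq_iff.1 h) (.clock x .gt c) hc

theorem diff_lt_iff {v w : Valuation X} (h : of N v = of N w) (x y : X) {d : ℤ} (hd : |d| ≤ N) :
    (v x - v y : ℝ) < d ↔ (w x - w y : ℝ) < d := by
  have h' := equiv_iff_atoms.1 (of_eq_iff.1 h)
  rcases le_total 0 d with h0 | h0
  · lift d to ℕ using h0
    have hd' : d ≤ N := by simpa using hd
    exact h' (.diff x y .lt d) hd'
  · obtain ⟨n, hn⟩ := Int.eq_ofNat_of_zero_le (neg_nonneg.2 h0)
    obtain rfl : d = -(n : ℤ) := by omega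
    have hd' : n ≤ N := by simpa using hd
    have : ((v y - v x : ℝ) > n ↔ (w y - w x : ℝ) > n) := h' (.diff y x .gt n) hd'
    push_cast
    constructor <;> intro h <;> grind

/-- Nonstrict comparisons are negations of strict ones, and a lower bound on a difference is an
upper bound on the reversed difference; this is why `d` ranges over integers of both signs. -/
theorem of_eq_of_comparisons {v w : Valuation X}
    (h1 : ∀ x, ∀ c : ℕ, c ≤ N → ((v x : ℝ) < c ↔ (w x : ℝ) < c) ∧ ((c : ℝ) < v x ↔ (c : ℝ) < w x))
    (h2 : ∀ x y, ∀ d : ℤ, |d| ≤ N → ((v x - v y : ℝ) < d ↔ (w x - w y : ℝ) < d)) :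
    of N v = of N w := by
  rw [of_eq_iff, equiv_iff_atoms]
  rintro (⟨x, r, c⟩ | ⟨x, y, r, c⟩) hc
  · have h := h1 x c hc
    cases r <;> simp only [Atom.Holds, Cmp.Holds, gt_iff_lt, ge_iff_le]
    · rw [← not_lt, h.2, not_lt]
    · exact h.1
    · exact h.2
    · rw [← not_lt, h.1, not_lt]
  · replace hc : c ≤ N := hc
    have ha := h2 x y c (by simpa using hc)
    have hb := h2 y x (-c) (by simpa using hc)
    push_cast at ha hb
    have hb' : (c : ℝ) < v x - v y ↔ (c : ℝ) < w x - w y := by constructor <;> intro h <;> grind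
    cases r <;> simp only [Atom.Holds, Cmp.Holds, gt_iff_lt, ge_iff_le]
    · rw [← not_lt, hb', not_lt]
    · exact ha
    · exact hb'
    · rw [← not_lt, ha, not_lt]

/-- Delays preserve clock differences, so only the order in which the clocks pass integers up to `N`
matters, and the comparisons of differences with constants bounded by `N` determine it. -/
theorem exists_delay [Finite X] {v w : Valuation X} (h : of N v = of N w) (t : ℝ≥0) :
    ∃ t', of N (v.delay t) = of N (w.delay t') := by
  obtain ⟨t', -, ht'⟩ := exists_delay_match (v := v) (w := w) (ι := X × Fin (N + 1))
    (fun i => i.1) (fun i => i.2)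
    (fun i => ⟨clock_lt_iff h _ (Nat.lt_succ_iff.1 i.2.2), lt_clock_iff h _ (Nat.lt_succ_iff.1 i.2.2)⟩)
    (fun i j => by
      have := diff_lt_iff h j.1 i.1 (d := (j.2 : ℕ) - (i.2 : ℕ))
        (by have := i.2.2; have := j.2.2; rw [abs_le]; omega)
      push_cast at this
      constructor <;> intro h <;> grind) t
  refine ⟨t', of_eq_of_comparisons (fun x c hc => ht' (x, ⟨c, Nat.lt_succ_of_le hc⟩)) ?_⟩
  intro x y d hd
  simpa [Valuation.delay] using diff_lt_iff h x y hd

theorem exists_delay_of_isSucc [Finite X] {v : Valuation X} {θ' : Region N X}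
    (h : (of N v).IsSucc θ') : ∃ t, of N (v.delay t) = θ' := by
  obtain ⟨w, hw, t, ht⟩ := h
  obtain ⟨t', h'⟩ := exists_delay hw t
  exact ⟨t', h'.symm.trans ht⟩

theorem isSucc_delay (v : Valuation X) (t : ℝ≥0) : (of N v).IsSucc (of N (v.delay t)) :=
  ⟨v, rfl, t, rfl⟩

/-- Regions are convex along delays: differences are constant and single clocks are monotone. -/
theorem of_delay_eq_of_between {v : Valuation X} {a b c : ℝ≥0} (hab : a ≤ b) (hbc : b ≤ c)
    (h : of N (v.delay a) = of N (v.delay c)) : of N (v.delay b) = of N (v.delay a) := by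
  have hab' : (a : ℝ) ≤ b := hab
  have hbc' : (b : ℝ) ≤ c := hbc
  refine of_eq_of_comparisons (fun x k hk => ?_) (fun x y d hd => by simp [Valuation.delay])
  have h1 := clock_lt_iff h x hk
  have h2 := lt_clock_iff h x hk
  simp only [Valuation.delay, NNReal.coe_add] at h1 h2 ⊢
  constructor <;> constructor <;> intro h3 <;> grind

theorem finite_atoms [Finite X] (N : ℕ) : {a : Atom X | a.const ≤ N}.Finite := by
  have hc : Finite Cmp := Finite.of_injective
    (fun r : Cmp => (match r with | .le => 0 | .lt => 1 | .gt => 2 | .ge => 3 : Fin 4))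
    (by intro r s; cases r <;> cases s <;> simp)
  let f : (X × Cmp × Fin (N + 1)) ⊕ (X × X × Cmp × Fin (N + 1)) → Atom X := fun s =>
    s.elim (fun p => .clock p.1 p.2.1 p.2.2) (fun p => .diff p.1 p.2.1 p.2.2.1 p.2.2.2)
  refine (Set.finite_range f).subset ?_
  rintro (⟨x, r, c⟩ | ⟨x, y, r, c⟩) h
  · exact ⟨.inl (x, r, ⟨c, Nat.lt_succ_of_le h⟩), rfl⟩
  · exact ⟨.inr (x, y, r, ⟨c, Nat.lt_succ_of_le h⟩), rfl⟩

instance [Finite X] : Finite (Region N X) := by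
  have : Finite {a : Atom X | a.const ≤ N} := finite_atoms N
  choose r hr using exists_of_eq (N := N) (X := X)
  refine Finite.of_injective
    (fun θ : Region N X => {a : {a : Atom X | a.const ≤ N} | a.1.Holds (r θ)}) ?_
  intro θ θ' h
  rw [← hr θ, ← hr θ', of_eq_iff, equiv_iff_atoms]
  intro a ha
  exact Set.ext_iff.1 h ⟨a, ha⟩

theorem exists_negated_atom (a : Atom X) :
    ∃ b : Atom X, b.const = a.const ∧ ∀ v, b.Holds v ↔ ¬ a.Holds v := by
  rcases a with ⟨x, r, c⟩ | ⟨x, y, r, c⟩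
  · cases r
    · exact ⟨.clock x .gt c, rfl, fun v => not_le.symm⟩
    · exact ⟨.clock x .ge c, rfl, fun v => not_lt.symm⟩
    · exact ⟨.clock x .le c, rfl, fun v => not_lt.symm⟩
    · exact ⟨.clock x .lt c, rfl, fun v => not_le.symm⟩
  · cases r
    · exact ⟨.diff x y .gt c, rfl, fun v => not_le.symm⟩
    · exact ⟨.diff x y .ge c, rfl, fun v => not_lt.symm⟩
    · exact ⟨.diff x y .le c, rfl, fun v => not_lt.symm⟩
    · exact ⟨.diff x y .lt c, rfl, fun v => not_le.symm⟩

/-- The guard collects all bounded atoms true at one valuation. Atoms are closed under negation, so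
it also fixes the atoms that fail there. -/
theorem exists_guard [Finite X] (θ : Region N X) :
    ∃ g : Guard X, g.BoundedBy N ∧ g.sat = θ.toSet := by
  obtain ⟨v, rfl⟩ := exists_of_eq θ
  have hfin : {a : Atom X | a.const ≤ N ∧ a.Holds v}.Finite :=
    (finite_atoms N).subset fun a ha => ha.1
  refine ⟨hfin.toFinset.toList, ?_, ?_⟩
  · intro a ha
    simp only [Finset.mem_toList, Set.Finite.mem_toFinset] at ha
    exact ha.1
  · ext w
    simp only [Guard.sat, Set.mem_ofPred_eq, Finset.mem_toList, Set.Finite.mem_toFinset, toSet,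
      of_eq_iff, equiv_iff_atoms]
    constructor
    · intro h a ha
      refine ⟨fun haw => ?_, fun hav => h a ⟨ha, hav⟩⟩
      by_contra hav
      obtain ⟨b, hb, hneg⟩ := exists_negated_atom a
      exact (hneg w).1 (h b ⟨hb ▸ ha, (hneg v).2 hav⟩) haw
    · intro h a ha
      exact (h a ha.1).2 ha.2

/-- A guard that defines the region. -/
noncomputable def guard [Finite X] (θ : Region N X) : Guard X := (exists_guard θ).choose

theorem guard_boundedBy [Finite X] (θ : Region N X) : θ.guard.BoundedBy N :=
  (exists_guard θ).choose_spec.1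

theorem sat_guard [Finite X] (θ : Region N X) : θ.guard.sat = θ.toSet :=
  (exists_guard θ).choose_spec.2

theorem toSet_nonempty (θ : Region N X) : θ.toSet.Nonempty := exists_of_eq θ

theorem eq_of_toSet_subset {θ θ' : Region N X} (h : θ.toSet ⊆ θ'.toSet) : θ = θ' := by
  obtain ⟨v, hv⟩ := θ.toSet_nonempty
  exact Eq.trans (Eq.symm hv) (h hv)

theorem toSet_subset_sat {θ : Region N X} {v : Valuation X} (hv : of N v = θ) {g : Guard X}
    (hg : g.BoundedBy N) (h : v ∈ g.sat) : θ.toSet ⊆ g.sat :=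
  fun _ hw => (sat_iff (hv.trans (Eq.symm hw)) hg).1 h

theorem equiv_comp_some {v w : Valuation (Option X)} (h : (regionSetoid N (Option X)) v w) :
    (regionSetoid N X) (fun x => v (some x)) (fun x => w (some x)) := by
  rw [equiv_iff_atoms] at h ⊢
  rintro (⟨x, r, c⟩ | ⟨x, y, r, c⟩) ha
  · exact h (.clock (some x) r c) ha
  · exact h (.diff (some x) (some y) r c) ha

/-- Forgetting the tick clock. -/
def restrict (θ : Region N (Option X)) : Region N X :=
  Quotient.map (fun (v : Valuation (Option X)) (x : X) => v (some x))
    (fun _ _ h => equiv_comp_some h) θ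

theorem restrict_of (v : Valuation (Option X)) :
    (of N v).restrict = of N (fun x => v (some x)) := rfl

theorem reset_image_some (v : Valuation (Option X)) (Y : Set X) :
    (fun x => v.reset (some '' Y) (some x)) = Valuation.reset (fun x => v (some x)) Y := by
  ext x; by_cases h : x ∈ Y <;> simp [Valuation.reset, h]

theorem restrict_reset (θ : Region N (Option X)) (Y : Set X) :
    (θ.reset (some '' Y)).restrict = θ.restrict.reset Y := by
  obtain ⟨v, rfl⟩ := exists_of_eq θ
  rw [reset_of, restrict_of, restrict_of, reset_of, reset_image_some]

end Region


/-! ### Coarse equivalence of valuations with a tick clock -/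

section Coarse

variable {N : ℕ} {X : Type u}

/-- The valuation of the clocks other than the tick clock. -/
def Valuation.base (u : Valuation (Option X)) : Valuation X := fun x => u (some x)

theorem Valuation.base_delay (u : Valuation (Option X)) (t : ℝ≥0) :
    (u.delay t).base = u.base.delay t := rfl

theorem Valuation.base_reset_none (u : Valuation (Option X)) :
    (u.reset {none}).base = u.base := by
  ext x; simp [Valuation.base, Valuation.reset]

theorem Valuation.base_reset_some (u : Valuation (Option X)) (Y : Set X) :
    (u.reset (some '' Y)).base = u.base.reset Y := Region.reset_image_some u Y

theorem Valuation.reset_some_none (u : Valuation (Option X)) (Y : Set X) :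
    u.reset (some '' Y) none = u none := by simp [Valuation.reset]

theorem Valuation.reset_none_none (u : Valuation (Option X)) : u.reset {none} none = 0 := by
  simp [Valuation.reset]

theorem Valuation.delay_delay {C : Type u} (v : Valuation C) (s t : ℝ≥0) :
    (v.delay s).delay t = v.delay (s + t) := by
  ext x; simp [Valuation.delay, add_assoc]

/-- Two valuations agree on the regions of the clocks in `X` and, as long as the tick clock is at
most `1`, on the order in which the tick clock and the clocks in `X` below the bound reach
integers. This is coarser than region equivalence: the distance between the tick clock and a
clock above the bound is ignored. -/
structure Coarse (N : ℕ) (u w : Valuation (Option X)) : Prop where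
  base : Region.of N u.base = Region.of N w.base
  le_left : (u none : ℝ) ≤ 1
  le_right : (w none : ℝ) ≤ 1
  pos : (0 : ℝ) < u none ↔ (0 : ℝ) < w none
  lt_one : (u none : ℝ) < 1 ↔ (w none : ℝ) < 1
  diff : ∀ x, (u (some x) : ℝ) ≤ N → ∀ c : ℤ,
    ((u none - u (some x) : ℝ) < c ↔ (w none - w (some x) : ℝ) < c) ∧
    ((c : ℝ) < u none - u (some x) ↔ (c : ℝ) < w none - w (some x))

theorem clock_le_iff {v w : Valuation X} (h : Region.of N v = Region.of N w) (x : X) {c : ℕ}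
    (hc : c ≤ N) : (v x : ℝ) ≤ c ↔ (w x : ℝ) ≤ c := by
  rw [← not_lt, Region.lt_clock_iff h x hc, not_lt]

/-- A clock with value in `[0, N]` compares trivially with integers outside this interval, so its
region fixes its comparison with every integer. -/
theorem clock_lt_int_iff {v w : Valuation X} (h : Region.of N v = Region.of N w) (x : X)
    (hx : (v x : ℝ) ≤ N) (c : ℤ) :
    ((v x : ℝ) < c ↔ (w x : ℝ) < c) ∧ ((c : ℝ) < v x ↔ (c : ℝ) < w x) := by
  have hw := (clock_le_iff h x le_rfl).1 hx
  have h1 : (0 : ℝ) ≤ v x := (v x).2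
  have h2 : (0 : ℝ) ≤ w x := (w x).2
  rcases lt_or_ge c 0 with hc | hc
  · have : (c : ℝ) < 0 := by exact_mod_cast hc
    constructor <;> constructor <;> intro _ <;> linarith
  · lift c to ℕ using hc
    rcases le_or_gt c N with hcN | hcN
    · exact ⟨Region.clock_lt_iff h x hcN, Region.lt_clock_iff h x hcN⟩
    · have : (N : ℝ) < c := by exact_mod_cast hcN
      push_cast
      constructor <;> constructor <;> intro _ <;> linarith

namespace Coarse

theorem symm {u w : Valuation (Option X)} (h : Coarse N u w) : Coarse N w u :=
  ⟨h.base.symm, h.le_right, h.le_left, h.pos.symm, h.lt_one.symm, fun x hx c =>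
    ⟨(h.diff x ((clock_le_iff h.base x le_rfl).2 hx) c).1.symm,
      (h.diff x ((clock_le_iff h.base x le_rfl).2 hx) c).2.symm⟩⟩

theorem trans {u w z : Valuation (Option X)} (h : Coarse N u w) (k : Coarse N w z) :
    Coarse N u z :=
  ⟨h.base.trans k.base, h.le_left, k.le_right, h.pos.trans k.pos, h.lt_one.trans k.lt_one,
    fun x hx c =>
    have hx' := (clock_le_iff h.base x le_rfl).1 hx
    ⟨(h.diff x hx c).1.trans (k.diff x hx' c).1, (h.diff x hx c).2.trans (k.diff x hx' c).2⟩⟩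

/-- The relevant differences lie in `[-N, 1]`, so constants of absolute value above `N` compare
trivially. -/
theorem of_region_eq (hN : 1 ≤ N) {u w : Valuation (Option X)}
    (h : Region.of N u = Region.of N w) (hu : (u none : ℝ) ≤ 1) : Coarse N u w := by
  have hb : Region.of N u.base = Region.of N w.base := congrArg Region.restrict h
  have h1 : (u none : ℝ) ≤ 1 ↔ (w none : ℝ) ≤ 1 := by
    have := Region.lt_clock_iff h none hN
    rw [← not_lt, ← not_lt]
    exact_mod_cast not_congr this
  have hw := h1.1 hu
  refine ⟨hb, hu, hw, ?_, ?_, ?_⟩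
  · exact_mod_cast Region.lt_clock_iff h none (Nat.zero_le N)
  · exact_mod_cast Region.clock_lt_iff h none hN
  · intro x hx c
    have hxw : (w (some x) : ℝ) ≤ N := (clock_le_iff hb x le_rfl).1 hx
    have p1 : (0 : ℝ) ≤ u (some x) := (u (some x)).2
    have p2 : (0 : ℝ) ≤ w (some x) := (w (some x)).2
    have p3 : (0 : ℝ) ≤ u none := (u none).2
    have p4 : (0 : ℝ) ≤ w none := (w none).2
    have hN' : (1 : ℝ) ≤ N := by exact_mod_cast hN
    rcases le_or_gt |c| N with hc | hc
    · refine ⟨Region.diff_lt_iff h none (some x) hc, ?_⟩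
      have := Region.diff_lt_iff h (some x) none (d := -c) (by rwa [abs_neg])
      push_cast at this
      constructor <;> intro h3 <;> grind
    · rcases lt_abs.1 hc with hc | hc
      · have : (N : ℝ) < c := by exact_mod_cast hc
        constructor <;> constructor <;> intro _ <;> linarith
      · have : (N : ℝ) < -c := by exact_mod_cast hc
        constructor <;> constructor <;> intro _ <;> linarith

theorem delay [Finite X] {u w : Valuation (Option X)} (h : Coarse N u w) {t : ℝ≥0}
    (ht : (u none : ℝ) + t ≤ 1) : ∃ t', Coarse N (u.delay t) (w.delay t') := by
  -- The thresholds are `1` for the tick clock and, for each other clock, the integers up to `N` not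
  -- yet passed. A clock above `N` has none left, so the differences ignored by `Coarse` are never
  -- needed.
  let ι := Option {i : X × Fin (N + 1) // (u (some i.1) : ℝ) ≤ (i.2 : ℕ)}
  let clk : ι → Option X := fun i => i.map fun j => j.1.1
  let thr : ι → ℕ := fun i => i.elim 1 fun j => j.1.2
  have hNx : ∀ (x : X) (c : ℕ), c ≤ N → (u (some x) : ℝ) ≤ c → (u (some x) : ℝ) ≤ N :=
    fun x c hc hx => hx.trans (by exact_mod_cast hc)
  obtain ⟨t', ht0, ht'⟩ := exists_delay_match (v := u) (w := w) clk thr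
    (by
      rintro (_ | ⟨⟨x, c⟩, hx⟩)
      · have h1 := h.le_left
        have h2 := h.le_right
        have h3 := h.lt_one
        simp only [clk, thr, Option.map_none, Option.elim, Nat.cast_one]
        exact ⟨h3, ⟨fun h => absurd h1 (not_le.2 h), fun h => absurd h2 (not_le.2 h)⟩⟩
      · have hc := Nat.lt_succ_iff.1 c.2
        exact ⟨Region.clock_lt_iff h.base x hc, Region.lt_clock_iff h.base x hc⟩)
    (by
      rintro (_ | ⟨⟨x, c⟩, hx⟩) (_ | ⟨⟨y, d⟩, hy⟩)
      · simp
      · have h3 := (h.diff y (hNx y d (Nat.lt_succ_iff.1 d.2) hy) (1 - (d : ℕ))).2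
        simp only [clk, thr, Option.map_none, Option.elim, Nat.cast_one, Option.map_some]
        push_cast at h3
        constructor <;> intro h4 <;> grind
      · have h3 := (h.diff x (hNx x c (Nat.lt_succ_iff.1 c.2) hx) (1 - (c : ℕ))).1
        simp only [clk, thr, Option.map_none, Option.elim, Nat.cast_one, Option.map_some]
        push_cast at h3
        constructor <;> intro h4 <;> grind
      · have h3 := Region.diff_lt_iff h.base y x (d := (d : ℕ) - (c : ℕ))
          (by have := c.2; have := d.2; rw [abs_le]; omega)
        simp only [clk, thr, Option.elim, Option.map_some]
        simp only [Valuation.base] at h3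
        push_cast at h3
        constructor <;> intro h4 <;> grind) t
  have hn := ht' none
  simp only [clk, thr, Option.map_none, Option.elim, Nat.cast_one] at hn
  have hle : ((u.delay t none : ℝ≥0) : ℝ) ≤ 1 := by simpa [Valuation.delay] using ht
  have hle' : ((w.delay t' none : ℝ≥0) : ℝ) ≤ 1 := by
    rw [← not_lt, ← hn.2, not_lt]; exact hle
  refine ⟨t', Region.of_eq_of_comparisons (fun x c hc => ?_) (fun x y d hd => ?_), hle, hle', ?_,
    hn.1, ?_⟩
  · by_cases hx : (u (some x) : ℝ) ≤ c
    · exact ht' (some ⟨(x, ⟨c, Nat.lt_succ_of_le hc⟩), hx⟩)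
    · have hw : (c : ℝ) < w (some x) := (Region.lt_clock_iff h.base x hc).1 (not_le.1 hx)
      have hu := not_le.1 hx
      have q1 : (0 : ℝ) ≤ t := t.2
      have q2 : (0 : ℝ) ≤ t' := t'.2
      simp only [Valuation.base, Valuation.delay, NNReal.coe_add]
      constructor <;> constructor <;> intro _ <;> linarith
  · simpa [Valuation.base, Valuation.delay] using Region.diff_lt_iff h.base x y hd
  · have h1 := h.pos
    have : (0 : ℝ) < t ↔ (0 : ℝ) < t' := by
      rw [NNReal.coe_pos, NNReal.coe_pos, pos_iff_ne_zero, pos_iff_ne_zero, ne_eq, ne_eq, ht0]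
    have p1 : (0 : ℝ) ≤ u none := (u none).2
    have p2 : (0 : ℝ) ≤ w none := (w none).2
    have p3 : (0 : ℝ) ≤ t := t.2
    have p4 : (0 : ℝ) ≤ t' := t'.2
    simp only [Valuation.delay, NNReal.coe_add]
    constructor <;> intro h2
    · by_contra h3
      have e1 : ¬ (0 : ℝ) < t' := by intro h4; linarith
      have e2 : ¬ (0 : ℝ) < w none := by intro h4; linarith
      rw [← this] at e1
      rw [← h1] at e2
      linarith
    · by_contra h3
      have e1 : ¬ (0 : ℝ) < t := by intro h4; linarith
      have e2 : ¬ (0 : ℝ) < u none := by intro h4; linarith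
      rw [this] at e1
      rw [h1] at e2
      linarith
  · intro x hx c
    have hx' : (u (some x) : ℝ) ≤ N := by
      refine le_trans ?_ hx
      simp [Valuation.delay]
    simpa [Valuation.delay] using h.diff x hx' c

/-- For a clock just reset the difference is the tick clock itself. It lies in `[0, 1]`, so `pos`
and `lt_one` decide its comparison with all integers. -/
theorem reset_some {u w : Valuation (Option X)} (h : Coarse N u w) (Y : Set X) :
    Coarse N (u.reset (some '' Y)) (w.reset (some '' Y)) := by
  refine ⟨?_, ?_, ?_, ?_, ?_, ?_⟩
  · rw [Valuation.base_reset_some, Valuation.base_reset_some, ← Region.reset_of, h.base,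
      Region.reset_of]
  · rw [Valuation.reset_some_none]; exact h.le_left
  · rw [Valuation.reset_some_none]; exact h.le_right
  · rw [Valuation.reset_some_none, Valuation.reset_some_none]; exact h.pos
  · rw [Valuation.reset_some_none, Valuation.reset_some_none]; exact h.lt_one
  · intro x hx c
    rw [Valuation.reset_some_none, Valuation.reset_some_none]
    by_cases hY : x ∈ Y
    · have e : ∀ v : Valuation (Option X), v.reset (some '' Y) (some x) = 0 := by
        intro v; simp [Valuation.reset, hY]
      rw [e, e, NNReal.coe_zero, sub_zero, sub_zero]
      have p1 : (0 : ℝ) ≤ u none := (u none).2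
      have p2 : (0 : ℝ) ≤ w none := (w none).2
      have h1 := h.pos
      have h2 := h.lt_one
      have h3 := h.le_left
      have h4 := h.le_right
      have hc : c ≤ -1 ∨ c = 0 ∨ c = 1 ∨ 2 ≤ c := by omega
      rcases hc with hc | rfl | rfl | hc
      · have : (c : ℝ) ≤ -1 := by exact_mod_cast hc
        constructor <;> constructor <;> intro _ <;> linarith
      · push_cast
        exact ⟨⟨fun h => absurd p1 (not_le.2 h), fun h => absurd p2 (not_le.2 h)⟩, h1⟩
      · push_cast
        exact ⟨h2, ⟨fun h => absurd h3 (not_le.2 h), fun h => absurd h4 (not_le.2 h)⟩⟩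
      · have : (2 : ℝ) ≤ c := by exact_mod_cast hc
        constructor <;> constructor <;> intro _ <;> linarith
    · have e : ∀ v : Valuation (Option X), v.reset (some '' Y) (some x) = v (some x) := by
        intro v; simp [Valuation.reset, hY]
      rw [e] at hx
      rw [e, e]
      exact h.diff x hx c

/-- When the tick clock is an integer, its differences are integer translates of the other clocks,
hence determined by the region over `X`. In particular a tick resynchronises valuations that agree
over `X`. -/
theorem of_none_eq {u w : Valuation (Option X)} (h : Region.of N u.base = Region.of N w.base)
    (h1 : u none = w none) {k : ℕ} (hk : u none = k) (hk1 : k ≤ 1) : Coarse N u w := by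
  have hk' : (k : ℝ) ≤ 1 := by exact_mod_cast hk1
  have e : (u none : ℝ) = k := by rw [hk]; simp
  have e' : (w none : ℝ) = k := by rw [← h1]; exact e
  refine ⟨h, e ▸ hk', e' ▸ hk', by rw [h1], by rw [h1], fun x hx c => ?_⟩
  rw [e, e']
  have := clock_lt_int_iff h x hx (k - c)
  simp only [Valuation.base] at this
  push_cast at this
  constructor <;> constructor <;> intro h2 <;> grind

theorem reset_none {u w : Valuation (Option X)} (h : Region.of N u.base = Region.of N w.base) :
    Coarse N (u.reset {none}) (w.reset {none}) := by
  refine of_none_eq (k := 0) ?_ ?_ ?_ zero_le_one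
  · rw [Valuation.base_reset_none, Valuation.base_reset_none]; exact h
  · rw [Valuation.reset_none_none, Valuation.reset_none_none]
  · rw [Valuation.reset_none_none]; simp

theorem delay_of_between {u : Valuation (Option X)} {a b c : ℝ≥0} (hab : a ≤ b) (hbc : b ≤ c)
    (h : Coarse N (u.delay a) (u.delay c)) : Coarse N (u.delay a) (u.delay b) := by
  have hab' : (a : ℝ) ≤ b := hab
  have hbc' : (b : ℝ) ≤ c := hbc
  obtain ⟨h1, h2, h3, h4, h5, h6⟩ := h
  simp only [Valuation.delay, NNReal.coe_add] at h2 h3 h4 h5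
  refine ⟨(Region.of_delay_eq_of_between hab hbc h1).symm, ?_, ?_, ?_, ?_, ?_⟩ <;>
    simp only [Valuation.delay, NNReal.coe_add]
  · exact h2
  · linarith
  · constructor <;> intro h <;> grind
  · constructor <;> intro h <;> grind
  · intro x _ c'
    simp

/-- Coarse equivalence persists for some smaller value of the tick clock when the clocks in `X`
stay in their region. -/
theorem exists_extension [Finite X] {u : Valuation (Option X)} (hu : (u none : ℝ) ≤ 1) {t : ℝ≥0}
    (h : Region.of N u.base = Region.of N (u.delay t).base) :
    ∃ w, w.base = (u.delay t).base ∧ w none ≤ u none + t ∧ Coarse N u w := by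
  let W : ℝ≥0 → Valuation (Option X) := fun z o => o.elim z fun x => u.delay t (some x)
  have hW : ∀ z, (W z).base = (u.delay t).base := fun z => rfl
  rcases eq_or_ne (u none) 0 with h0 | h0
  · exact ⟨W 0, rfl, zero_le, of_none_eq (k := 0) h (by rw [h0]; rfl) (by simp [h0]) zero_le_one⟩
  rcases hu.lt_or_eq with h1 | h1
  swap
  · have h1' : u none = 1 := by exact_mod_cast h1
    refine ⟨W 1, rfl, by rw [h1']; exact le_self_add, ?_⟩
    exact of_none_eq (k := 1) h (by rw [h1']; rfl) (by simp [h1']) le_rfl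
  have h0' : (0 : ℝ) < u none := NNReal.coe_pos.2 (pos_iff_ne_zero.2 h0)
  have ht0 : (0 : ℝ) ≤ t := t.2
  rcases lt_or_ge ((u none : ℝ) + t) 1 with h2 | h2
  · refine ⟨u.delay t, rfl, le_rfl, h, hu, ?_, ?_, ?_, ?_⟩ <;>
      simp only [Valuation.delay, NNReal.coe_add]
    · exact h2.le
    · constructor <;> intro _ <;> linarith
    · constructor <;> intro _ <;> linarith
    · intro x _ c
      simp
  -- Here `t > 0`, so every clock `x` up to `N` stays strictly between two integers `k x` and `k x +
  -- 1`. Since the tick clock would reach `1` within the delay and `x` does not reach `k x + 1`, the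
  -- tick clock exceeds the fractional part of `x`. Its new value must therefore lie above all new
  -- fractional parts and below `1`.
  · have hkey : ∀ x, (u (some x) : ℝ) ≤ N → ∃ k : ℤ, (k : ℝ) < u (some x) ∧
        (u (some x) : ℝ) + t < k + 1 := by
      intro x hx
      have p : (0 : ℝ) ≤ u (some x) := (u (some x)).2
      have hlt : (u (some x) : ℝ) < ⌊(u (some x) : ℝ)⌋ + 1 := Int.lt_floor_add_one _
      have hle : (⌊(u (some x) : ℝ)⌋ : ℝ) ≤ u (some x) := Int.floor_le _
      have hc := clock_lt_int_iff h x hx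
      simp only [Valuation.base, Valuation.delay, NNReal.coe_add] at hc
      refine ⟨⌊(u (some x) : ℝ)⌋, ?_, ?_⟩
      · refine lt_of_le_of_ne hle fun he => ?_
        have := (hc ⌊(u (some x) : ℝ)⌋).2.2 (by linarith)
        linarith
      · have := (hc (⌊(u (some x) : ℝ)⌋ + 1)).1.1 (by push_cast; exact hlt)
        push_cast at this
        exact this
    choose! k hk1 hk2 using hkey
    have := Fintype.ofFinite X
    classical
    obtain ⟨z, hz1, hz2⟩ := Order.exists_between_finsets
      (insert 0 ((Finset.univ.filter fun x => (u (some x) : ℝ) ≤ N).image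
        fun x => (u (some x) : ℝ) + t - k x)) {(1 : ℝ)} (by
        simp only [Finset.mem_insert, Finset.mem_image, Finset.mem_filter, Finset.mem_univ,
          true_and, Finset.mem_singleton]
        rintro _ (rfl | ⟨x, hx, rfl⟩) _ rfl
        · exact zero_lt_one
        · have := hk2 x hx
          linarith)
    simp only [Finset.mem_insert, Finset.mem_image, Finset.mem_filter, Finset.mem_univ,
      true_and, Finset.mem_singleton] at hz1 hz2
    have hz0 : 0 < z := hz1 0 (Or.inl rfl)
    have hzlt : z < 1 := hz2 1 rfl
    have hzx : ∀ x, (u (some x) : ℝ) ≤ N → (u (some x) : ℝ) + t - k x < z :=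
      fun x hx => hz1 _ (Or.inr ⟨x, hx, rfl⟩)
    lift z to ℝ≥0 using hz0.le
    refine ⟨W z, rfl, ?_, h, hu, hzlt.le, ?_, ?_, ?_⟩
    · change z ≤ u none + t
      rw [← NNReal.coe_le_coe, NNReal.coe_add]; linarith
    · exact ⟨fun _ => hz0, fun _ => h0'⟩
    · exact ⟨fun _ => hzlt, fun _ => h1⟩
    · intro x hx c
      have e1 := hk1 x hx
      have e2 := hk2 x hx
      have e3 := hzx x hx
      have e4 : ((W z (some x) : ℝ≥0) : ℝ) = u (some x) + t := by
        simp [W, Valuation.delay]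
      have e5 : ((W z none : ℝ≥0) : ℝ) = z := rfl
      rw [e4, e5]
      rcases le_or_gt c (-k x) with hc | hc
      · have : (c : ℝ) ≤ -k x := by exact_mod_cast hc
        constructor <;> constructor <;> intro _ <;> linarith
      · have hc' : -k x + 1 ≤ c := hc
        have : (-k x : ℝ) + 1 ≤ c := by exact_mod_cast hc'
        constructor <;> constructor <;> intro _ <;> linarith

end Coarse

end Coarse


/-! ### Belief updates

A timed automaton over the clocks `X` does not see the tick clock, but it can maintain a belief
about the region of the tick clock that never overestimates the elapsed time. -/

section Belief

variable {N : ℕ} {X : Type u}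

/-- `u` is coarsely equivalent to a valuation in the region. -/
def Sim (θ : Region N (Option X)) (u : Valuation (Option X)) : Prop :=
  ∃ w ∈ θ.toSet, Coarse N w u

/-- Time elapses until the tick clock equals `1`, then it is reset. -/
def TickStep (θ θ₁ : Region N (Option X)) : Prop :=
  ∃ θ', Region.IsSucc θ θ' ∧ (∀ v ∈ θ'.toSet, v none = 1) ∧ θ₁ = θ'.reset {none}

/-- The regions reached after `k` ticks. -/
inductive Ticks : ℕ → Region N (Option X) → Region N (Option X) → Prop
  | refl (θ) : Ticks 0 θ θ
  | step {k θ θ₁ θ₂} : TickStep θ θ₁ → Ticks k θ₁ θ₂ → Ticks (k + 1) θ θ₂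

/-- When an edge is taken in the region `χ`, the belief `θ` is updated to `θ''` after `k` ticks
have led to `θ'`; the time elapsed according to the belief is at most the real one. -/
structure Update (θ : Region N (Option X)) (χ : Region N X) (k : ℕ) (θ' θ'' : Region N (Option X)) :
    Prop where
  ticks : Ticks k θ θ'
  succ : Region.IsSucc θ' θ''
  le_one : ∀ v ∈ θ''.toSet, v none ≤ 1
  restrict : θ''.restrict = χ
  sound : ∀ u t, Sim θ u → Region.of N (u.delay t).base = χ →
    ∃ u', Sim θ'' u' ∧ u'.base = (u.delay t).base ∧ u' none + k ≤ u none + t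

theorem le_one_of_region_eq (hN : 1 ≤ N) {u w : Valuation (Option X)}
    (h : Region.of N u = Region.of N w) (hu : u none ≤ 1) : w none ≤ 1 := by
  have := (Coarse.of_region_eq hN h (by exact_mod_cast hu)).le_right
  exact_mod_cast this

theorem eq_one_of_region_eq (hN : 1 ≤ N) {u w : Valuation (Option X)}
    (h : Region.of N u = Region.of N w) (hu : u none = 1) : w none = 1 := by
  have hc := Coarse.of_region_eq hN h (by simp [hu])
  have h1 := hc.lt_one
  have h2 := hc.le_right
  rw [hu] at h1
  have h3 : (w none : ℝ) = 1 := le_antisymm h2 (not_lt.1 fun h => by simpa using h1.2 h)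
  exact_mod_cast h3

theorem Sim.coarse (hN : 1 ≤ N) {w u : Valuation (Option X)} (hw : w none ≤ 1)
    (h : Sim (Region.of N w) u) : Coarse N w u := by
  obtain ⟨w', hw', hc⟩ := h
  exact (Coarse.of_region_eq hN (Eq.symm hw') (by exact_mod_cast hw)).trans hc

theorem Sim.reset_some {θ : Region N (Option X)} {u : Valuation (Option X)} (h : Sim θ u)
    (Y : Set X) : Sim (θ.reset (some '' Y)) (u.reset (some '' Y)) := by
  obtain ⟨w, rfl, hc⟩ := h
  exact ⟨_, rfl, hc.reset_some Y⟩

theorem tickStep_of_delay (hN : 1 ≤ N) {w : Valuation (Option X)} {s : ℝ≥0}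
    (h : w none + s = 1) :
    TickStep (Region.of N w) (Region.of N ((w.delay s).reset {none})) :=
  ⟨Region.of N (w.delay s), Region.isSucc_delay w s,
    fun _ hv => eq_one_of_region_eq hN (Eq.symm hv) h, rfl⟩

/-- Among the delays satisfying `P` there is one that is earliest up to region equivalence. -/
theorem exists_earliest [Finite X] (w : Valuation X) (P : ℝ≥0 → Prop) (hP : ∃ s, P s) :
    ∃ s, P s ∧ ∀ s', P s' → s' < s → Region.of N (w.delay s') = Region.of N (w.delay s) := by
  let R : Set (Region N X) := {r | ∃ s, P s ∧ Region.of N (w.delay s) = r}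
  have hR : ∀ r, ∃ s, r ∈ R → P s ∧ Region.of N (w.delay s) = r := by
    intro r
    by_cases h : r ∈ R
    · exact ⟨h.choose, fun _ => h.choose_spec⟩
    · exact ⟨0, fun h' => (h h').elim⟩
  choose f hf using hR
  obtain ⟨s₀, hs₀⟩ := hP
  obtain ⟨r, hr, hmin⟩ := Set.exists_min_image R f (Set.toFinite R) ⟨_, s₀, hs₀, rfl⟩
  refine ⟨f r, (hf r hr).1, fun s' hs' hlt => ?_⟩
  have hr' : Region.of N (w.delay s') ∈ R := ⟨s', hs', rfl⟩
  exact (Region.of_delay_eq_of_between hlt.le (hmin _ hr') (hf _ hr').2.symm).symm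

/-- Let `t₁` from `u` match `s` from `w`. If `t₁ ≤ t`, the clocks in `X` remain in `χ` between these
delays, and `exists_extension` lowers the tick clock to a similar value. If `t < t₁`, then `t` is
matched by some `t'` from `w`: either `t' < s`, and minimality of `s` applies, or convexity
identifies the delays `t` and `t₁`. -/
theorem Coarse.sound_of_earliest [Finite X] {w u : Valuation (Option X)} (hc : Coarse N w u)
    {χ : Region N X} {s : ℝ≥0} (hsχ : Region.of N (w.delay s).base = χ) (hs1 : w none + s ≤ 1)
    (hs : ∀ s', Region.of N (w.delay s').base = χ → w none + s' ≤ 1 → s' < s →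
      Region.of N (w.delay s') = Region.of N (w.delay s)) {t : ℝ≥0}
    (ht : Region.of N (u.delay t).base = χ) :
    ∃ u', Sim (Region.of N (w.delay s)) u' ∧ u'.base = (u.delay t).base ∧
      u' none ≤ u none + t := by
  obtain ⟨t₁, ht₁⟩ := hc.delay (t := s) (by exact_mod_cast hs1)
  have key : t₁ ≤ t → ∃ u', Sim (Region.of N (w.delay s)) u' ∧ u'.base = (u.delay t).base ∧
      u' none ≤ u none + t := by
    intro hle
    have e : (u.delay t₁).delay (t - t₁) = u.delay t := by
      rw [Valuation.delay_delay, add_tsub_cancel_of_le hle]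
    obtain ⟨u', h1, h2, h3⟩ := Coarse.exists_extension (N := N) (u := u.delay t₁) (t := t - t₁)
      ht₁.le_right (by rw [e, ht, ← ht₁.base, hsχ])
    rw [e] at h1
    refine ⟨u', ⟨_, rfl, ht₁.trans h3⟩, h1, h2.trans_eq ?_⟩
    change u none + t₁ + (t - t₁) = _
    rw [add_assoc, add_tsub_cancel_of_le hle]
  rcases le_or_gt (u none + t) 1 with hut | hut
  · obtain ⟨t', ht'⟩ := hc.symm.delay (t := t) (by exact_mod_cast hut)
    have hχ : Region.of N (w.delay t').base = χ := by rw [← ht'.base, ht]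
    have h1 : w none + t' ≤ 1 := by
      have := ht'.le_right
      exact_mod_cast this
    rcases lt_or_ge t' s with hlt | hge
    · exact ⟨u.delay t, ⟨w.delay t', hs t' hχ h1 hlt, ht'.symm⟩, rfl, le_rfl⟩
    · rcases le_or_gt t₁ t with hle | hgt
      · exact key hle
      -- From `u`, the delays `t` and `t₁ + t₂` lead to equivalent valuations, and `t₁` lies between
      -- them.
      · obtain ⟨t₂, ht₂⟩ := ht₁.delay (t := t' - s) (by
          have : (w.delay s none + (t' - s) : ℝ≥0) ≤ 1 := by
            change w none + s + (t' - s) ≤ 1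
            rwa [add_assoc, add_tsub_cancel_of_le hge]
          exact_mod_cast this)
        rw [Valuation.delay_delay, Valuation.delay_delay, add_tsub_cancel_of_le hge] at ht₂
        have h3 := Coarse.delay_of_between hgt.le (le_self_add : t₁ ≤ t₁ + t₂) (ht'.trans ht₂)
        exact ⟨u.delay t, ⟨_, rfl, ht₁.trans h3.symm⟩, rfl, le_rfl⟩
  · apply key
    by_contra hgt
    have h1 : u none + t₁ ≤ 1 := by
      have := ht₁.le_right
      exact_mod_cast this
    exact absurd (hut.trans_le ((add_le_add_right (not_le.1 hgt).le _).trans h1)) (lt_irrefl _)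

/-- If the target region can be reached before the next tick, an earliest such delay is used and no
tick is counted. Otherwise the belief ticks first. So must every similar valuation, since a delay
within the current unit could be matched from `w`. After the tick the two are again similar and the
bound `n` has dropped by one. -/
theorem exists_update_of_delay [Finite X] (hN : 1 ≤ N) (n : ℕ) :
    ∀ (w : Valuation (Option X)) (t : ℝ≥0), w none ≤ 1 → w none + t ≤ n →
      ∃ k θ' θ'', Update (Region.of N w) (Region.of N (w.delay t).base) k θ' θ'' := by
  induction n with
  | zero =>
    intro w t hw hn
    have h0 : w none = 0 := by
      have := le_self_add.trans hn
      simpa using this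
    have h1 : t = 0 := by
      rw [h0] at hn
      simpa using hn
    subst h1
    have e : w.delay 0 = w := by ext x; simp [Valuation.delay]
    have hs1 : w none + 0 ≤ 1 := by simpa using hw
    refine ⟨0, _, Region.of N (w.delay 0), .refl _, Region.isSucc_delay w 0, ?_, rfl, ?_⟩
    · intro v hv
      exact le_one_of_region_eq hN (u := w.delay 0) (Eq.symm hv) hs1
    · intro u t hu ht
      obtain ⟨u', h1, h2, h3⟩ := (hu.coarse hN hw).sound_of_earliest rfl hs1
        (fun s' _ _ hlt => absurd hlt (not_lt.2 zero_le)) ht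
      exact ⟨u', h1, h2, by simpa using h3⟩
  | succ n ih =>
    intro w t hw hn
    by_cases hcand : ∃ s, Region.of N (w.delay s).base = Region.of N (w.delay t).base ∧
        w none + s ≤ 1
    · obtain ⟨s, ⟨hs1, hs2⟩, hs3⟩ := exists_earliest (N := N) w _ hcand
      refine ⟨0, _, Region.of N (w.delay s), .refl _, Region.isSucc_delay w s, ?_, hs1, ?_⟩
      · intro v hv
        exact le_one_of_region_eq hN (u := w.delay s) (Eq.symm hv) hs2
      · intro u t' hu ht'
        obtain ⟨u', h1, h2, h3⟩ := (hu.coarse hN hw).sound_of_earliest hs1 hs2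
          (fun s' h1 h2 => hs3 s' ⟨h1, h2⟩) ht'
        exact ⟨u', h1, h2, by simpa using h3⟩
    · have hlt : 1 < w none + t := not_le.1 fun h => hcand ⟨t, rfl, h⟩
      have hle : 1 - w none ≤ t := tsub_le_iff_left.2 hlt.le
      have e1 : w none + (1 - w none) = 1 := add_tsub_cancel_of_le hw
      set w₁ := (w.delay (1 - w none)).reset {none} with hw₁
      have hw₁0 : w₁ none = 0 := Valuation.reset_none_none _
      have e2 : (w₁.delay (t - (1 - w none))).base = (w.delay t).base := by
        rw [Valuation.base_delay, hw₁, Valuation.base_reset_none, ← Valuation.base_delay,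
          Valuation.delay_delay, add_tsub_cancel_of_le hle]
      obtain ⟨k, θ', θ'', hU⟩ := ih w₁ (t - (1 - w none)) (by rw [hw₁0]; exact zero_le) (by
        rw [hw₁0, zero_add, tsub_le_iff_left]
        rw [← add_le_add_iff_left (w none), ← add_assoc, e1]
        push_cast at hn
        rwa [add_comm 1])
      rw [e2] at hU
      refine ⟨k + 1, θ', θ'', .step (tickStep_of_delay hN e1) hU.ticks, hU.succ, hU.le_one,
        hU.restrict, ?_⟩
      intro u t' hu ht'
      have hc := hu.coarse hN hw
      have hu1 : u none ≤ 1 := by exact_mod_cast hc.le_right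
      have hut : 1 < u none + t' := by
        by_contra hcon
        obtain ⟨s, hs⟩ := hc.symm.delay (t := t') (by exact_mod_cast not_lt.1 hcon)
        refine hcand ⟨s, by rw [← hs.base, ht'], ?_⟩
        have := hs.le_right
        exact_mod_cast this
      have hle' : 1 - u none ≤ t' := tsub_le_iff_left.2 hut.le
      have e1' : u none + (1 - u none) = 1 := add_tsub_cancel_of_le hu1
      obtain ⟨s, hs⟩ := hc.symm.delay (t := 1 - u none) (by exact_mod_cast e1'.le)
      have hs1 : w none + s = 1 := by
        have h1 : ((w none + s : ℝ≥0) : ℝ) ≤ 1 := hs.le_right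
        have h2 : ((u none + (1 - u none) : ℝ≥0) : ℝ) < 1 ↔ ((w none + s : ℝ≥0) : ℝ) < 1 :=
          hs.lt_one
        rw [e1'] at h2
        have h3 : ((w none + s : ℝ≥0) : ℝ) = 1 :=
          le_antisymm h1 (not_lt.1 fun h => by simpa using h2.2 h)
        exact_mod_cast h3
      have hs' : s = 1 - w none := by rw [← hs1, add_tsub_cancel_left]
      subst hs'
      have hsim : Sim (Region.of N w₁) ((u.delay (1 - u none)).reset {none}) :=
        ⟨w₁, rfl, Coarse.reset_none hs.base.symm⟩
      have e3 : (((u.delay (1 - u none)).reset {none}).delay (t' - (1 - u none))).base =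
          (u.delay t').base := by
        rw [Valuation.base_delay, Valuation.base_reset_none, ← Valuation.base_delay,
          Valuation.delay_delay, add_tsub_cancel_of_le hle']
      obtain ⟨u', h1, h2, h3⟩ := hU.sound _ (t' - (1 - u none)) hsim (by rw [e3, ht'])
      refine ⟨u', h1, h2.trans e3, ?_⟩
      rw [Valuation.reset_none_none, zero_add] at h3
      calc u' none + ((k + 1 : ℕ) : ℝ≥0) = u' none + k + 1 := by push_cast; ring
        _ ≤ t' - (1 - u none) + 1 := by gcongr
        _ = t' - (1 - u none) + (u none + (1 - u none)) := by rw [e1']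
        _ = u none + (t' - (1 - u none) + (1 - u none)) := by ring
        _ = u none + t' := by rw [tsub_add_cancel_of_le hle']

theorem exists_update [Finite X] (hN : 1 ≤ N) {θ : Region N (Option X)}
    (hθ : ∀ v ∈ θ.toSet, v none ≤ 1) {χ : Region N X} (h : θ.restrict.IsSucc χ) :
    ∃ k θ' θ'', Update θ χ k θ' θ'' := by
  obtain ⟨w, rfl⟩ := Region.exists_of_eq θ
  obtain ⟨t, rfl⟩ := Region.exists_delay_of_isSucc h
  obtain ⟨n, hn⟩ := exists_nat_ge (w none + t)
  exact exists_update_of_delay hN n w t (hθ w rfl) hn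

end Belief


/-! ### Solving the game of an APTA -/

section Game

variable {A X AP : Type u} [Finite X] {𝒜 : APTA A X AP} {N : ℕ}

instance : Finite (𝒜.game N).Pos := inferInstanceAs (Finite (𝒜.Loc × TickRegion N X))

instance : Nonempty (𝒜.game N).CMove := ⟨CircMove.tick (Region.zero _ _)⟩

theorem one_le_max (N : ℕ) : 1 ≤ max N 1 := le_max_right N 1

/-- One witness for each must-edge and each region suffices, and there are finitely many of both. -/
theorem LegalOffer.exists_finite {l : 𝒜.Loc} {θ : TickRegion N X} {C : Set (OfferedEdge 𝒜 N)}
    (h : LegalOffer 𝒜 N l θ C) : ∃ C' ⊆ C, C'.Finite ∧ LegalOffer 𝒜 N l θ C' := by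
  let P : (𝒜.Loc × Guard X × A × 𝒜.PC.Constraint) × TickRegion N X → Prop := fun i =>
    𝒜.T l i.1.2.1 i.1.2.2.1 i.1.2.2.2 = Modality.must ∧ i.1.1 = l ∧ TickRegion.IsSucc θ i.2 ∧
      i.2.Within i.1.2.1
  have hP : ∀ i : {i // P i}, ∃ μ ∈ 𝒜.PC.Sat i.1.1.2.2.2,
      (⟨i.1.2, i.1.1.2.2.1, μ⟩ : OfferedEdge 𝒜 N) ∈ C :=
    fun i => h.must _ _ _ i.2.1 _ i.2.2.2.1 i.2.2.2.2
  choose μ hμ1 hμ2 using hP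
  have hfin : Finite {i // P i} := by
    have : {i | P i} ⊆ {e | 𝒜.T e.1 e.2.1 e.2.2.1 e.2.2.2 ≠ Modality.absent} ×ˢ Set.univ := by
      rintro ⟨⟨l', g, a, φ⟩, θ'⟩ ⟨h1, h2, _⟩
      simp only at h1 h2
      subst h2
      refine ⟨?_, trivial⟩
      simp [h1]
    exact (𝒜.finite_edges.prod Set.finite_univ).subset this
  refine ⟨Set.range fun i : {i // P i} => ⟨i.1.2, i.1.1.2.2.1, μ i⟩, ?_, Set.finite_range _, ?_⟩
  · rintro _ ⟨i, rfl⟩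
    exact hμ2 i
  · refine ⟨h.label, fun g a φ hT θ' hs hw => ?_, ?_⟩
    · let i : {i // P i} := ⟨((l, g, a, φ), θ'), hT, rfl, hs, hw⟩
      exact ⟨μ i, hμ1 i, i, rfl⟩
    · rintro _ ⟨i, rfl⟩
      exact h.may _ (hμ2 i)

theorem finite_setOf_legalCirc {θ : TickRegion N X} {C : Set (OfferedEdge 𝒜 N)} (hC : C.Finite) :
    {c | LegalCirc θ C c}.Finite := by
  refine ((Set.finite_range (CircMove.tick (𝒜 := 𝒜) (N := N))).union
    (hC.image CircMove.edge)).subset ?_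
  rintro (θ₁ | e) h
  · exact Or.inl ⟨θ₁, rfl⟩
  · exact Or.inr ⟨e, h, rfl⟩

/-- The invariant that the tick clock is at most `1` guarantees that a tick is always a legal
answer; for the converse, offers are thinned to finite ones. -/
theorem game_winnable_iff {m : Mode} (S : (𝒜.game N).Solution m) :
    (𝒜.game N).Winnable m ↔ (𝒜.game N).init ∈ S.region := by
  constructor
  · refine S.init_mem_of_winnable (fun p => ∀ v ∈ Region.toSet p.2, v none ≤ 1) ?_ ?_ ?_
    · intro v hv
      exact le_one_of_region_eq (one_le_max N) (u := fun _ => 0) (Eq.symm hv) zero_le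
    · rintro ⟨l, θ⟩ C (θ₁ | e) hI hC hc o ho v hv
      · obtain ⟨θ', -, -, h1⟩ := hc
        obtain ⟨w, rfl⟩ := Region.exists_of_eq θ'
        have hv' : Region.of _ v = Region.of _ (w.reset {none}) := Eq.trans hv h1
        refine le_one_of_region_eq (one_le_max N) hv'.symm ?_
        rw [Valuation.reset_none_none]
        exact zero_le
      · have h1 := ((LegalOffer.may hC e hc).1).2
        obtain ⟨w, hw⟩ := Region.exists_of_eq e.region
        rcases o with ⟨Y, l₁⟩
        have hv' : Region.of (max N 1) v = Region.of _ (w.reset (some '' Y)) := by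
          refine Eq.trans hv ?_
          change e.region.reset _ = _
          rw [← hw]; rfl
        refine le_one_of_region_eq (one_le_max N) hv'.symm ?_
        rw [Valuation.reset_some_none]
        exact h1 w hw
    · rintro ⟨l, θ⟩ C hI
      obtain ⟨w, rfl⟩ := Region.exists_of_eq θ
      have hw : w none + (1 - w none) = 1 := add_tsub_cancel_of_le (hI w rfl)
      refine ⟨CircMove.tick _, tickStep_of_delay (one_le_max N) hw, fun o _ v hv => ?_⟩
      refine le_one_of_region_eq (one_le_max N) (Eq.symm hv) ?_
      rw [Valuation.reset_none_none]
      exact zero_le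
  · refine S.winnable fun p C hC => ?_
    obtain ⟨C', h1, h2, h3⟩ := LegalOffer.exists_finite hC
    refine ⟨C', h3, finite_setOf_legalCirc h2, ?_⟩
    rintro (θ₁ | e) hc
    · exact hc
    · exact h1 hc

end Game


/-! ### Divergent implementations yield winning strategies -/

section Implementation

variable {A X AP : Type u}

/-- A pair of locations of an automaton and of its specification, and a valuation that includes
the tick clock. -/
structure JointState (M : PTA A X AP) (𝒜 : APTA A X AP) where
  loc : M.Loc
  spec : 𝒜.Loc
  val : Valuation (Option X)

/-- The locations are related by `R` and were jointly reached in a common region, possibly some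
time ago. -/
structure JointState.Inv {M : PTA A X AP} {𝒜 : APTA A X AP} (N' : ℕ) (R : M.Loc → 𝒜.Loc → Prop)
    (s : JointState M 𝒜) : Prop where
  rel : R s.loc s.spec
  reach : ∃ v t, s.val.base = Valuation.delay v t ∧ M.Reach N' (s.loc, Region.of N' v) ∧
    𝒜.Reach N' (s.spec, Region.of N' v)

/-- A delay and an edge of the automaton, together with the next locations of the specification
and the valuation in which the edge is taken. -/
structure Decision (M : PTA A X AP) (𝒜 : APTA A X AP) where
  delay : ℝ≥0
  guard : Guard X
  action : A
  dist : PMF (Set X × M.Loc)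
  val : Valuation (Option X)
  spec : Set X × M.Loc → 𝒜.Loc

/-- The joint state after the decision and the outcome. -/
noncomputable def Decision.apply {M : PTA A X AP} {𝒜 : APTA A X AP} (d : Decision M 𝒜)
    (o : Set X × M.Loc) : JointState M 𝒜 :=
  ⟨o.2, d.spec o, d.val.reset (some '' o.1)⟩

/-- The position of the game that corresponds to a joint state. -/
def JointState.pos {M : PTA A X AP} {𝒜 : APTA A X AP} [Finite X] (N : ℕ) (s : JointState M 𝒜) :
    (𝒜.game N).Pos :=
  (s.spec, Region.of (max N 1) s.val)

/-- The offer of the `●`-player that is derived from the edges of the automaton. -/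
def JointState.offer {M : PTA A X AP} {𝒜 : APTA A X AP} (N : ℕ) (R : M.Loc → 𝒜.Loc → Prop)
    (s : JointState M 𝒜) : Set (OfferedEdge 𝒜 N) :=
  {e | ∃ t : ℝ≥0, Region.of (max N 1) (s.val.delay t) = e.region ∧ s.val none + t ≤ 1 ∧
    ∃ g μ, M.T s.loc g e.action μ = true ∧ (s.val.delay t).base ∈ g.sat ∧
    ∃ g' φ, 𝒜.T s.spec g' e.action φ ≠ Modality.absent ∧ (s.val.delay t).base ∈ g'.sat ∧
    e.dist ∈ 𝒜.PC.Sat φ ∧ Lifting R μ e.dist}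

theorem Guard.BoundedBy.mono {N N' : ℕ} (h : N ≤ N') {g : Guard X} (hg : g.BoundedBy N) :
    g.BoundedBy N' := fun a ha => (hg a ha).trans h

variable {M : PTA A X AP} {𝒜 : APTA A X AP} {N N' : ℕ} {R : M.Loc → 𝒜.Loc → Prop}

theorem TickRegion.within_of_mem {g : Guard X} (hg : g.BoundedBy N) {w : Valuation (Option X)}
    (hw : w.base ∈ g.sat) : TickRegion.Within (N := N) (Region.of (max N 1) w) g := by
  intro v hv
  have h : Region.of (max N 1) v.base = Region.of (max N 1) w.base :=
    congrArg Region.restrict (hv : Region.of (max N 1) v = Region.of (max N 1) w)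
  exact (Region.sat_iff h (hg.mono (le_max_left N 1))).2 hw

/-- After a tick the automaton has not moved, so the present valuation is only a delay of one whose
region was jointly reached. The must condition is applied in that earlier region; its time
successors include everything that can be reached now. -/
theorem JointState.legalOffer [Finite X] (hN : 𝒜.BoundedBy N) (hR : IsSatisfaction N' M 𝒜 R)
    {s : JointState M 𝒜} (hs : s.Inv N' R) :
    LegalOffer 𝒜 N s.spec (Region.of (max N 1) s.val) (s.offer N R) := by
  obtain ⟨v, t₀, hv, hr1, hr2⟩ := hs.reach
  refine ⟨⟨_, hR.label _ _ hs.rel⟩, ?_, ?_⟩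
  · intro g a φ hT θ' hθ' hw
    obtain ⟨t, rfl⟩ := Region.exists_delay_of_isSucc hθ'.1
    have hg : (s.val.delay t).base ∈ g.sat := hw _ rfl
    obtain ⟨n, gs, μs, hcov, hi⟩ := hR.must _ _ hs.rel a φ g (Region.of N' v) hT hr1 hr2
    have hmem : (s.val.delay t).base ∈ (Region.of N' v).succ ∩ g.sat := by
      refine ⟨?_, hg⟩
      rw [Valuation.base_delay, hv, Valuation.delay_delay]
      exact Region.isSucc_delay v _
    obtain ⟨i, hgi⟩ := Set.mem_iUnion.1 (hcov hmem).2
    obtain ⟨hTi, μ', hμ', hl⟩ := hi i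
    exact ⟨μ', hμ', t, rfl, hθ'.2 _ rfl, gs i, μs i, hTi, hgi, g, φ, by rw [hT]; simp, hg, hμ', hl⟩
  · rintro ⟨θ', a, μ'⟩ ⟨t, ht, ht1, g, μ, hT, hg, g', φ, hT', hg', hμ', hl⟩
    simp only at ht
    subst ht
    refine ⟨⟨Region.isSucc_delay _ _, fun v hv => ?_⟩, g', φ, hT', ?_, hμ'⟩
    · exact le_one_of_region_eq (one_le_max N) (u := s.val.delay t) (Eq.symm hv) ht1
    · exact TickRegion.within_of_mem (hN _ _ _ _ hT') hg'

/-- The decision is possible, maintains the invariant, and either may decrease the stage, or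
avoids ticks. -/
structure Decision.Valid [Finite X] {m : Mode} (S : (𝒜.game N).Solution m) (N' : ℕ)
    (R : M.Loc → 𝒜.Loc → Prop) (s : JointState M 𝒜) (d : Decision M 𝒜) : Prop where
  edge : M.T s.loc d.guard d.action d.dist = true
  base : d.val.base = s.val.base.delay d.delay
  sat : d.val.base ∈ d.guard.sat
  inv : ∀ o ∈ d.dist.support, (d.apply o).Inv N' R
  progress : (∃ o ∈ d.dist.support, (d.apply o).pos N ∉ S.region ∧
      S.stage ((d.apply o).pos N) < S.stage (s.pos N)) ∨
    (d.val none = s.val none + d.delay ∧ d.val none ≤ 1 ∧ m.DualHits d.dist.support fun o =>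
      (d.apply o).pos N ∉ S.region ∧ S.stage ((d.apply o).pos N) ≤ S.stage (s.pos N))

/-- Induction on the stage. A tick can only use the stage-lowering alternative; its waiting time is
added to the delay of the decision found afterwards. An edge answer comes from an edge of the
automaton, and the correspondence `δ` supplies the next location of the specification for each
outcome. -/
theorem exists_decision [Finite X] {m : Mode} (S : (𝒜.game N).Solution m) (hN : 𝒜.BoundedBy N)
    (hM' : M.BoundedBy N') (hN' : 𝒜.BoundedBy N') (hR : IsSatisfaction N' M 𝒜 R) (n : ℕ) :
    ∀ s : JointState M 𝒜, S.stage (s.pos N) < n → s.Inv N' R → s.pos N ∉ S.region →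
      ∃ d : Decision M 𝒜, d.Valid S N' R s := by
  induction n with
  | zero => intro s h; omega
  | succ n ih =>
    intro s hn hs hpos
    obtain ⟨c, hc, hprog⟩ := S.lose _ hpos _ (s.legalOffer hN hR hs)
    rcases c with θ₁ | e
    · have htick : (CircMove.tick θ₁ : CircMove 𝒜 N) ∈ (𝒜.game N).tick := ⟨θ₁, rfl⟩
      obtain ⟨θ', h1, h2, rfl⟩ := hc
      obtain ⟨t, rfl⟩ := Region.exists_delay_of_isSucc h1
      rcases hprog with ⟨o, -, h3, h4⟩ | ⟨h3, -⟩
      swap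
      · exact absurd htick h3
      let s₁ : JointState M 𝒜 := ⟨s.loc, s.spec, (s.val.delay t).reset {none}⟩
      have hb : s₁.val.base = s.val.base.delay t := by
        change ((s.val.delay t).reset {none}).base = _
        rw [Valuation.base_reset_none, Valuation.base_delay]
      have hs₁ : s₁.Inv N' R := by
        obtain ⟨v, t₀, hv, hr1, hr2⟩ := hs.reach
        exact ⟨hs.rel, v, t₀ + t, by rw [hb, hv, Valuation.delay_delay], hr1, hr2⟩
      have hlt : S.stage (s₁.pos N) < S.stage (s.pos N) := h4
      obtain ⟨d, hd⟩ := ih s₁ (by omega) hs₁ h3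
      refine ⟨⟨t + d.delay, d.guard, d.action, d.dist, d.val, d.spec⟩, hd.edge, ?_, hd.sat, hd.inv,
        Or.inl ?_⟩
      · simp only
        rw [hd.base, hb, Valuation.delay_delay]
      · rcases hd.progress with ⟨o, ho, h5, h6⟩ | ⟨-, -, h5⟩
        · exact ⟨o, ho, h5, h6.trans hlt⟩
        · obtain ⟨o, ho, h5, h6⟩ := h5.exists d.dist.support_nonempty
          exact ⟨o, ho, h5, h6.trans_lt hlt⟩
    · obtain ⟨θ', a, μ'⟩ := e
      obtain ⟨t, ht, ht1, g, μ, hT, hg, g', φ, hT', hg', hμ', δ, hδ, hδR⟩ := hc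
      simp only at ht hT hT' hμ' hδ
      subst ht
      have hmem : ∀ o ∈ μ.support, ∀ o' ∈ (δ o).support, o' ∈ μ'.support := by
        intro o ho o' ho'
        rw [← hδ, PMF.mem_support_bind_iff]
        exact ⟨o, ho, ho'⟩
      let c : CircMove 𝒜 N := .edge ⟨Region.of (max N 1) (s.val.delay t), a, μ'⟩
      let D : (Set X × M.Loc → 𝒜.Loc) → Decision M 𝒜 := fun f => ⟨t, g, a, μ, s.val.delay t, f⟩
      obtain ⟨v, t₀, hv, hr1, hr2⟩ := hs.reach
      have hbase : (s.val.delay t).base = v.delay (t₀ + t) := by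
        rw [Valuation.base_delay, hv, Valuation.delay_delay]
      have hvalid : ∀ f : Set X × M.Loc → 𝒜.Loc,
          (∀ o ∈ μ.support, (o.1, f o) ∈ (δ o).support) →
          ((∃ o ∈ (D f).dist.support, ((D f).apply o).pos N ∉ S.region ∧
            S.stage (((D f).apply o).pos N) < S.stage (s.pos N)) ∨
          (m.DualHits (D f).dist.support fun o => ((D f).apply o).pos N ∉ S.region ∧
            S.stage (((D f).apply o).pos N) ≤ S.stage (s.pos N))) →
          (D f).Valid S N' R s := by
        intro f hf hp
        refine ⟨hT, rfl, hg, ?_, hp.imp_right fun h => ⟨rfl, ht1, h⟩⟩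
        rintro ⟨Y, l₁⟩ ho
        have ho' := hf _ ho
        refine ⟨(hδR _ ho _ ho').2, (s.val.delay t).base.reset Y, 0, ?_, ?_, ?_⟩
        · change ((s.val.delay t).reset (some '' Y)).base = _
          rw [Valuation.base_reset_some]
          ext x; simp [Valuation.delay]
        · rw [hbase] at hg ⊢
          exact PTA.Reach.step hr1 hT (Region.isSucc_delay v _)
            (Region.toSet_subset_sat rfl (hM' _ _ _ _ hT) hg) ho
        · rw [hbase] at hg' ⊢
          exact Reach.step hr2 hT' (Region.isSucc_delay v _)
            (Region.toSet_subset_sat rfl (hN' _ _ _ _ hT') hg') hμ' (hmem _ ho _ ho')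
      have hchoice : ∀ o, ∃ l' : 𝒜.Loc, o ∈ μ.support → (o.1, l') ∈ (δ o).support := by
        intro o
        obtain ⟨⟨Y, l'⟩, h⟩ := (δ o).support_nonempty
        refine ⟨l', fun ho => ?_⟩
        rw [(hδR o ho _ h).1]
        exact h
      choose f hf using hchoice
      -- Changing the choice at a single outcome realises any prescribed outcome of `μ'`, as needed
      -- when progress is promised on one outcome only.
      have hpick : ∀ o' ∈ μ'.support, ∃ f' : Set X × M.Loc → 𝒜.Loc,
          (∀ o ∈ μ.support, (o.1, f' o) ∈ (δ o).support) ∧ ∃ o ∈ μ.support, (o.1, f' o) = o' := by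
        classical
        rintro ⟨Y, l'⟩ ho'
        rw [← hδ, PMF.mem_support_bind_iff] at ho'
        obtain ⟨o, ho, hoo'⟩ := ho'
        have hY : o.1 = Y := (hδR _ ho _ hoo').1
        refine ⟨Function.update f o l', fun o₁ ho₁ => ?_, o, ho, ?_⟩
        · by_cases h : o₁ = o
          · subst h
            rw [Function.update_self, hY]
            exact hoo'
          · rw [Function.update_of_ne h]
            exact hf _ ho₁
        · rw [Function.update_self, hY]
      rcases hprog with ⟨o', ho', h3⟩ | ⟨-, h3⟩
      · obtain ⟨f', hf', o, ho, rfl⟩ := hpick o' ho'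
        exact ⟨D f', hvalid f' hf' (Or.inl ⟨o, ho, h3⟩)⟩
      · replace h3 : m.DualHits μ'.support fun o => (𝒜.game N).next (s.pos N) c o ∉ S.region ∧
          S.stage ((𝒜.game N).next (s.pos N) c o) ≤ S.stage (s.pos N) := h3
        cases m with
        | almost =>
          exact ⟨D f, hvalid f hf (Or.inr fun o ho => h3 _ (hmem o ho _ (hf o ho)))⟩
        | sure =>
          obtain ⟨o', ho', h3⟩ := h3
          obtain ⟨f', hf', o, ho, rfl⟩ := hpick o' ho'
          exact ⟨D f', hvalid f' hf' (Or.inr ⟨o, ho, h3⟩)⟩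

/-- The joint state after a history of outcomes, when decisions are made by `act`. -/
noncomputable def track (act : JointState M 𝒜 → Option (Decision M 𝒜)) :
    List (Set X × M.Loc) → JointState M 𝒜
  | [] => ⟨M.init, 𝒜.init, fun _ => 0⟩
  | o :: h => (act (track act h)).elim (track act h) fun d => d.apply o

/-- The scheduler that makes the decisions `act`. -/
noncomputable def schedulerOf (act : JointState M 𝒜 → Option (Decision M 𝒜)) : M.Scheduler :=
  fun h => (act (track act h)).map fun d => (d.delay, d.guard, d.action, d.dist)

theorem schedulerOf_state {act : JointState M 𝒜 → Option (Decision M 𝒜)}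
    (hact : ∀ s d, act s = some d → d.val.base = s.val.base.delay d.delay)
    (h : List (Set X × M.Loc)) :
    (schedulerOf act).state h = ((track act h).loc, (track act h).val.base) := by
  induction h with
  | nil => rfl
  | cons o h ih =>
    rw [PTA.Scheduler.state, track]
    cases hd : act (track act h) with
    | none =>
      have : schedulerOf act h = none := by simp [schedulerOf, hd]
      rw [this]
      exact ih
    | some d =>
      have : schedulerOf act h = some (d.delay, d.guard, d.action, d.dist) := by
        simp [schedulerOf, hd]
      rw [this]
      simp only [ih, Option.elim, Decision.apply, Valuation.base_reset_some, hact _ _ hd]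

theorem tsum_ne_top_of_tail_le {f : ℕ → ℝ≥0∞} (n₀ : ℕ) (h1 : ∀ n, f n ≠ ⊤)
    (h2 : ∀ j, ∑ i ∈ Finset.range j, f (n₀ + i) ≤ 1) : ∑' n, f n ≠ ⊤ := by
  rw [← Summable.sum_add_tsum_nat_add' (f := f) (k := n₀) ENNReal.summable]
  refine ENNReal.add_ne_top.2 ⟨ENNReal.sum_ne_top.2 fun n _ => h1 n, ?_⟩
  refine ne_top_of_le_ne_top ENNReal.one_ne_top (ENNReal.tsum_le_of_sum_range_le fun j => ?_)
  simpa only [add_comm] using h2 j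

/-- Outside the region the scheduler follows the decisions of `exists_decision`. After a feasible
history of least stage only tick-free decisions remain, and a path that keeps this stage has finite
duration, contradicting divergence. -/
theorem init_mem_of_satisfies [Finite X] {m : Mode} (S : (𝒜.game N).Solution m)
    (hN : 𝒜.BoundedBy N) (hM : Satisfies M 𝒜)
    (hdiv : ∀ σ : M.Scheduler, σ.Legal → m.Wins σ.law σ.Divergent) :
    (𝒜.game N).init ∈ S.region := by
  classical
  by_contra hinit
  obtain ⟨N', hM', hN', -, R, hR, hR0⟩ := hM
  have hex : ∀ s : JointState M 𝒜, s.Inv N' R ∧ s.pos N ∉ S.region →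
      ∃ d : Decision M 𝒜, d.Valid S N' R s :=
    fun s hs => exists_decision S hN hM' hN' hR _ s (Nat.lt_succ_self _) hs.1 hs.2
  let act : JointState M 𝒜 → Option (Decision M 𝒜) := fun s =>
    if h : s.Inv N' R ∧ s.pos N ∉ S.region then some (hex s h).choose else none
  have hvalid : ∀ s d, act s = some d → d.Valid S N' R s := by
    intro s d h
    by_cases hs : s.Inv N' R ∧ s.pos N ∉ S.region
    · simp only [act, dif_pos hs, Option.some.injEq] at h
      exact h ▸ (hex s hs).choose_spec
    · simp [act, dif_neg hs] at h
  have hsome : ∀ s : JointState M 𝒜, s.Inv N' R → s.pos N ∉ S.region → ∃ d, act s = some d := by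
    intro s h1 h2
    exact ⟨_, dif_pos ⟨h1, h2⟩⟩
  set σ := schedulerOf act with hσ
  have hstate := schedulerOf_state fun s d h => (hvalid s d h).base
  have hσsome : ∀ {h d}, act (track act h) = some d →
      σ h = some (d.delay, d.guard, d.action, d.dist) := by
    intro h d hd
    simp [hσ, schedulerOf, hd]
  have hlaw : ∀ {h d}, act (track act h) = some d → σ.law h = d.dist := by
    intro h d hd
    simp [PTA.Scheduler.law, hσsome hd]
  have hdur : ∀ {h d}, act (track act h) = some d → σ.duration h = (d.delay : ℝ≥0∞) := by
    intro h d hd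
    simp [PTA.Scheduler.duration, hσsome hd]
  have htrack : ∀ {h d} o, act (track act h) = some d → track act (o :: h) = d.apply o := by
    intro h d o hd
    simp [track, hd]
  have hlegal : σ.Legal := by
    intro h t g a μ heq
    cases hd : act (track act h) with
    | none => simp [hσ, schedulerOf, hd] at heq
    | some d =>
      rw [hσsome hd] at heq
      simp only [Option.some.injEq, Prod.mk.injEq] at heq
      obtain ⟨rfl, rfl, rfl, rfl⟩ := heq
      have hv := hvalid _ _ hd
      rw [hstate]
      exact ⟨hv.edge, hv.base ▸ hv.sat⟩
  let P : ℕ → List (Set X × M.Loc) → Prop := fun k h => (track act h).Inv N' R ∧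
    (track act h).pos N ∉ S.region ∧ S.stage ((track act h).pos N) ≤ k
  have hinv0 : (track act []).Inv N' R := by
    refine ⟨hR0, fun _ => 0, 0, ?_, .init, .init⟩
    ext x; simp [track, Valuation.base, Valuation.delay]
  have hex0 : ∃ k h, FeasibleHistory σ.law h ∧ P k h := ⟨_, [], trivial, hinv0, hinit, le_rfl⟩
  obtain ⟨h₀, hf, hP0⟩ := Nat.find_spec hex0
  set k := Nat.find hex0 with hk
  have hmin : ∀ {k' h}, FeasibleHistory σ.law h → P k' h → k ≤ k' :=
    fun h1 h2 => Nat.find_min' hex0 ⟨_, h1, h2⟩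
  have hstep : ∀ h, FeasibleHistory σ.law h → P k h → ∃ d, act (track act h) = some d ∧
      d.val none = (track act h).val none + d.delay ∧ d.val none ≤ 1 ∧
      m.DualHits (σ.law h).support fun o => P k (o :: h) := by
    intro h hh hP
    obtain ⟨d, hd⟩ := hsome _ hP.1 hP.2.1
    have hv := hvalid _ _ hd
    refine ⟨d, hd, ?_⟩
    rcases hv.progress with ⟨o, ho, h1, h2⟩ | ⟨h1, h2, h3⟩
    · have : k ≤ S.stage ((d.apply o).pos N) := by
        refine hmin (h := o :: h) ⟨by rw [hlaw hd]; exact ho, hh⟩ ?_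
        simp only [P, htrack o hd]
        exact ⟨hv.inv o ho, h1, le_rfl⟩
      have := hP.2.2
      omega
    · refine ⟨h1, h2, ?_⟩
      rw [hlaw hd]
      refine h3.mono fun o ho h4 => ?_
      simp only [P, htrack o hd]
      exact ⟨hv.inv o ho, h4.1, h4.2.trans hP.2.2⟩
  obtain ⟨ω, hω, hstay, hD⟩ := Mode.exists_staying (hdiv σ hlegal) hf (S := P k) hP0
    fun h hh hP => by
      obtain ⟨_, _, _, _, h4⟩ := hstep h hh hP
      exact h4
  set n₀ := h₀.length
  have hfeas := feasible_iff.1 hω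
  -- Without a decision the joint state is frozen forever, but decisions do exist at late times
  -- along `ω`.
  have hact : ∀ n, ∃ d, act (track act (history ω n)) = some d := by
    by_contra hcon
    push Not at hcon
    obtain ⟨n, hn⟩ := hcon
    have hnone : ∀ j, act (track act (history ω (n + j))) = none := by
      intro j
      induction j with
      | zero => exact Option.eq_none_iff_forall_ne_some.2 hn
      | succ j ih =>
        have : track act (history ω (n + (j + 1))) = track act (history ω (n + j)) := by
          rw [← add_assoc, history, track, ih]; rfl
        rw [this, ih]
    obtain ⟨d, hd⟩ := hsome _ (hstay n).1 (hstay n).2.1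
    rw [add_comm, hnone] at hd
    exact absurd hd (by simp)
  choose d hd using hact
  have hstepn : ∀ j, (track act (history ω (n₀ + j + 1))).val none =
      (track act (history ω (n₀ + j))).val none + (d (n₀ + j)).delay ∧
      (track act (history ω (n₀ + j + 1))).val none ≤ 1 := by
    intro j
    obtain ⟨d', h1, h2, h3, -⟩ := hstep _ (hfeas _) (hstay j)
    have e : d' = d (n₀ + j) := Option.some.inj (h1.symm.trans (hd _))
    subst e
    rw [history, htrack _ (hd _)]
    simp only [Decision.apply, Valuation.reset_some_none]
    exact ⟨h2, h3⟩
  -- From time `n₀` on the tick clock is never reset, so it accumulates all delays.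
  have hsum : ∀ j, ∑ i ∈ Finset.range j, (d (n₀ + i)).delay ≤
      (track act (history ω (n₀ + j))).val none := by
    intro j
    induction j with
    | zero => simp
    | succ j ih =>
      rw [Finset.sum_range_succ, ← add_assoc, (hstepn j).1]
      gcongr
  refine tsum_ne_top_of_tail_le n₀ (fun n => ?_) (fun j => ?_) hD
  · rw [hdur (hd n)]
    exact ENNReal.coe_ne_top
  · have : ∀ i, σ.duration (history ω (n₀ + i)) = ((d (n₀ + i)).delay : ℝ≥0∞) :=
      fun i => hdur (hd _)
    simp only [this]
    rw [← ENNReal.ofNNReal_finsetSum]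
    have h1 : ∑ i ∈ Finset.range j, (d (n₀ + i)).delay ≤ 1 := by
      cases j with
      | zero => simp
      | succ j => exact (hsum _).trans (hstepn j).2
    exact_mod_cast h1

end Implementation


/-! ### Winning strategies yield divergent implementations -/

section Belief

variable {N : ℕ} {X : Type u}

theorem Region.IsSucc.trans [Finite X] {θ₁ θ₂ θ₃ : Region N X} (h : θ₁.IsSucc θ₂)
    (h' : θ₂.IsSucc θ₃) : θ₁.IsSucc θ₃ := by
  obtain ⟨v, rfl⟩ := Region.exists_of_eq θ₁
  obtain ⟨t, rfl⟩ := Region.exists_delay_of_isSucc h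
  obtain ⟨s, rfl⟩ := Region.exists_delay_of_isSucc h'
  rw [Valuation.delay_delay]
  exact Region.isSucc_delay v _

theorem Region.IsSucc.restrict {θ θ' : Region N (Option X)} (h : θ.IsSucc θ') :
    θ.restrict.IsSucc θ'.restrict := by
  obtain ⟨v, rfl, t, rfl⟩ := h
  exact Region.isSucc_delay v.base t

theorem Ticks.isSucc_restrict [Finite X] {k : ℕ} {θ θ' : Region N (Option X)} (h : Ticks k θ θ') :
    θ.restrict.IsSucc θ'.restrict := by
  induction h with
  | refl θ =>
    obtain ⟨v, rfl⟩ := Region.exists_of_eq θ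
    exact ⟨v.base, rfl, 0, by
      have : v.base.delay 0 = v.base := by ext x; simp [Valuation.delay]
      rw [this]; rfl⟩
  | step h _ ih =>
    obtain ⟨θ', h1, -, rfl⟩ := h
    obtain ⟨v, rfl⟩ := Region.exists_of_eq θ'
    refine h1.restrict.trans ?_
    have : (Region.reset (Region.of N v) {none}).restrict = (Region.of N v).restrict := by
      change Region.of N (v.reset {none}).base = Region.of N v.base
      rw [Valuation.base_reset_none]
    rwa [this] at ih

theorem Update.isSucc_restrict [Finite X] {θ θ' θ'' : Region N (Option X)} {χ : Region N X} {k : ℕ}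
    (h : Update θ χ k θ' θ'') : θ.restrict.IsSucc χ := by
  rw [← h.restrict]
  exact h.ticks.isSucc_restrict.trans h.succ.restrict

end Belief

theorem map_congr_of_support {α β : Type*} {p : PMF α} {f g : α → β}
    (h : ∀ a ∈ p.support, f a = g a) : p.map f = p.map g := by
  ext b
  simp only [PMF.map_apply]
  refine tsum_congr fun a => ?_
  by_cases ha : p a = 0
  · simp [ha]
  · rw [h a ((PMF.mem_support_iff _ _).2 ha)]

/-! ### The automaton of beliefs -/

section Positional

variable {A X AP : Type u} {𝒜 : APTA A X AP} {N : ℕ}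

/-- The position reached by an offered edge. -/
noncomputable def OfferedEdge.target (e : OfferedEdge 𝒜 N) (o : Set X × 𝒜.Loc) :
    𝒜.Loc × TickRegion N X :=
  (o.2, e.region.reset (some '' o.1))

/-- Finite offers, depending only on the position, that witness a solution of the game. -/
structure Positional [Finite X] {m : Mode} (S : (𝒜.game N).Solution m)
    (C : 𝒜.Loc × TickRegion N X → Set (OfferedEdge 𝒜 N)) : Prop where
  finite : ∀ p, (C p).Finite
  legal : ∀ p ∈ S.region, LegalOffer 𝒜 N p.1 p.2 (C p)
  tick : ∀ p ∈ S.region, ∀ θ₁, TickStep p.2 θ₁ → (p.1, θ₁) ∈ S.region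
  edge : ∀ p ∈ S.region, ∀ e ∈ C p, (∀ o ∈ e.dist.support, e.target o ∈ S.region) ∧
    m.Hits e.dist.support fun o => S.rank (e.target o) < S.rank p

theorem exists_positional [Finite X] {m : Mode} (S : (𝒜.game N).Solution m) :
    ∃ C, Positional S C := by
  have : ∀ p : 𝒜.Loc × TickRegion N X, ∃ C : Set (OfferedEdge 𝒜 N), C.Finite ∧ (p ∈ S.region →
      LegalOffer 𝒜 N p.1 p.2 C ∧ (∀ θ₁, TickStep p.2 θ₁ → (p.1, θ₁) ∈ S.region) ∧
      ∀ e ∈ C, (∀ o ∈ e.dist.support, e.target o ∈ S.region) ∧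
        m.Hits e.dist.support fun o => S.rank (e.target o) < S.rank p) := by
    intro p
    by_cases hp : p ∈ S.region
    · obtain ⟨C, hC, h⟩ := S.win p hp
      obtain ⟨C', h1, h2, h3⟩ := LegalOffer.exists_finite hC
      refine ⟨C', h2, fun _ => ⟨h3, fun θ₁ hθ₁ => ?_, fun e he => ?_⟩⟩
      · exact (h (CircMove.tick θ₁) hθ₁).1 (∅, p.1) (by
          change (∅, p.1) ∈ (PMF.pure ((∅ : Set X), p.1)).support
          simp)
      · have := h (CircMove.edge e) (h1 he)
        exact ⟨this.1, this.2 (by rintro ⟨θ₁, h⟩; cases h)⟩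
    · exact ⟨∅, Set.finite_empty, fun h => (hp h).elim⟩
  choose C hC1 hC2 using this
  exact ⟨C, hC1, fun p hp => (hC2 p hp).1, fun p hp => (hC2 p hp).2.1, fun p hp => (hC2 p hp).2.2⟩

/-- From the belief `p`, the edge `e` can be taken in the region `χ` after `k` ticks. -/
def BeliefEdge (C : 𝒜.Loc × TickRegion N X → Set (OfferedEdge 𝒜 N)) (p : 𝒜.Loc × TickRegion N X)
    (χ : Region (max N 1) X) (k : ℕ) (e : OfferedEdge 𝒜 N) : Prop :=
  ∃ θ', Update p.2 χ k θ' e.region ∧ e ∈ C (p.1, θ')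

/-- The reachable beliefs. -/
inductive BeliefReach (C : 𝒜.Loc × TickRegion N X → Set (OfferedEdge 𝒜 N)) :
    𝒜.Loc × TickRegion N X → Prop
  | init : BeliefReach C (𝒜.init, Region.zero _ _)
  | step {p χ k e o} : BeliefReach C p → BeliefEdge C p χ k e → o ∈ e.dist.support →
      BeliefReach C (e.target o)

open Classical in
/-- The reachable belief after an outcome. -/
noncomputable def beliefOutcome (C : 𝒜.Loc × TickRegion N X → Set (OfferedEdge 𝒜 N))
    (e : OfferedEdge 𝒜 N) (o : Set X × 𝒜.Loc) : Set X × {p // BeliefReach C p} :=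
  -- The default is irrelevant on outcomes of edges from reachable beliefs; see `beliefOutcome_eq`.
  (o.1, if h : BeliefReach C (e.target o) then ⟨_, h⟩ else ⟨_, .init⟩)

/-- The distribution over reset sets and reachable beliefs. -/
noncomputable def beliefDist (C : 𝒜.Loc × TickRegion N X → Set (OfferedEdge 𝒜 N))
    (e : OfferedEdge 𝒜 N) : PMF (Set X × {p // BeliefReach C p}) :=
  e.dist.map (beliefOutcome C e)

/-- The edges of the automaton of beliefs. -/
def BeliefTrans [Finite X] (C : 𝒜.Loc × TickRegion N X → Set (OfferedEdge 𝒜 N))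
    (p : 𝒜.Loc × TickRegion N X) (k : ℕ) (g : Guard X) (a : A)
    (μ : PMF (Set X × {p // BeliefReach C p})) : Prop :=
  ∃ χ e, BeliefEdge C p χ k e ∧ g = χ.guard ∧ a = e.action ∧ μ = beliefDist C e

open Classical in
/-- The automaton whose locations are the reachable beliefs. -/
noncomputable def beliefPTA [Finite X] (C : 𝒜.Loc × TickRegion N X → Set (OfferedEdge 𝒜 N))
    (hC : ∀ p, (C p).Finite) : PTA A X AP where
  Loc := {p // BeliefReach C p}
  finite_loc := inferInstance
  init := ⟨_, .init⟩
  V p := if h : (𝒜.V p.1.1).Nonempty then h.some else ∅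
  T p g a μ := decide (∃ k, BeliefTrans C p.1 k g a μ)
  finite_edges := by
    let E : Set (OfferedEdge 𝒜 N) := ⋃ p, C p
    have hE : E.Finite := Set.finite_iUnion hC
    let f : {p // BeliefReach C p} × Region (max N 1) X × OfferedEdge 𝒜 N →
        {p // BeliefReach C p} × Guard X × A × PMF (Set X × {p // BeliefReach C p}) :=
      fun x => (x.1, x.2.1.guard, x.2.2.action, beliefDist C x.2.2)
    refine ((Set.finite_univ.prod (Set.finite_univ.prod hE)).image f).subset ?_
    rintro ⟨p, g, a, μ⟩ h
    obtain ⟨k, χ, e, ⟨θ', -, he⟩, rfl, rfl, rfl⟩ := of_decide_eq_true h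
    exact ⟨(p, χ, e), ⟨trivial, trivial, Set.mem_iUnion.2 ⟨_, he⟩⟩, rfl⟩

variable {C : 𝒜.Loc × TickRegion N X → Set (OfferedEdge 𝒜 N)}

theorem beliefOutcome_eq {p : 𝒜.Loc × TickRegion N X} (hp : BeliefReach C p)
    {χ : Region (max N 1) X} {k : ℕ} {e : OfferedEdge 𝒜 N} (he : BeliefEdge C p χ k e)
    {o : Set X × 𝒜.Loc} (ho : o ∈ e.dist.support) :
    beliefOutcome C e o = (o.1, ⟨e.target o, .step hp he ho⟩) := by
  unfold beliefOutcome
  rw [dif_pos (BeliefReach.step hp he ho)]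

theorem mem_support_beliefDist {p : 𝒜.Loc × TickRegion N X} (hp : BeliefReach C p)
    {χ : Region (max N 1) X} {k : ℕ} {e : OfferedEdge 𝒜 N} (he : BeliefEdge C p χ k e)
    {o : Set X × {p // BeliefReach C p}} (ho : o ∈ (beliefDist C e).support) :
    ∃ o' ∈ e.dist.support, o.1 = o'.1 ∧ o.2.1 = e.target o' := by
  unfold beliefDist at ho
  rw [PMF.mem_support_map_iff] at ho
  obtain ⟨o', ho', rfl⟩ := ho
  rw [beliefOutcome_eq hp he ho']
  exact ⟨o', ho', rfl, rfl⟩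

theorem BeliefReach.le_one {p : 𝒜.Loc × TickRegion N X} (hp : BeliefReach C p) :
    ∀ v ∈ p.2.toSet, v none ≤ 1 := by
  cases hp with
  | init =>
    intro v hv
    exact le_one_of_region_eq (one_le_max N) (u := fun _ => 0) (Eq.symm hv) zero_le
  | @step p χ k e o hp he ho =>
    intro v hv
    obtain ⟨θ', hU, he⟩ := he
    obtain ⟨w, hw⟩ := Region.exists_of_eq e.region
    have hv' : Region.of (max N 1) v = Region.of _ (w.reset (some '' o.1)) := by
      refine Eq.trans hv ?_
      rw [← Region.reset_of, hw]
      rfl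
    refine le_one_of_region_eq (one_le_max N) hv'.symm ?_
    rw [Valuation.reset_some_none]
    exact hU.le_one w hw

theorem restrict_target {p : 𝒜.Loc × TickRegion N X} {χ : Region (max N 1) X} {k : ℕ}
    {e : OfferedEdge 𝒜 N} (he : BeliefEdge C p χ k e) (o : Set X × 𝒜.Loc) :
    (e.target o).2.restrict = χ.reset o.1 := by
  obtain ⟨θ', hU, -⟩ := he
  rw [← hU.restrict]
  exact Region.restrict_reset _ _

/-- A belief remembers the location of the specification, so the correspondence is deterministic: on
the support, projection undoes `beliefOutcome`. -/
theorem beliefPTA_lifting {p : 𝒜.Loc × TickRegion N X} (hp : BeliefReach C p)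
    {χ : Region (max N 1) X} {k : ℕ} {e : OfferedEdge 𝒜 N} (he : BeliefEdge C p χ k e) :
    Lifting (fun (p : {p // BeliefReach C p}) l => p.1.1 = l) (beliefDist C e) e.dist := by
  refine ⟨fun o => PMF.pure (o.1, o.2.1.1), ?_, ?_⟩
  · change (beliefDist C e).map (fun o => (o.1, o.2.1.1)) = e.dist
    unfold beliefDist
    rw [PMF.map_comp, map_congr_of_support (g := id), PMF.map_id]
    intro o ho
    simp only [Function.comp, beliefOutcome_eq hp he ho]
    rfl
  · intro o _ o' ho'
    rw [PMF.support_pure, Set.mem_singleton_iff] at ho'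
    subst ho'
    exact ⟨rfl, rfl⟩

variable [Finite X] {m : Mode} {S : (𝒜.game N).Solution m}

theorem beliefPTA_T {hC : ∀ p, (C p).Finite} {p : {p // BeliefReach C p}} {g : Guard X} {a : A}
    {μ : PMF (Set X × {p // BeliefReach C p})} :
    (beliefPTA C hC).T p g a μ = true ↔ ∃ k, BeliefTrans C p.1 k g a μ := by
  simp [beliefPTA]

theorem ticks_mem_region (hpos : Positional S C) {k : ℕ} {θ θ' : TickRegion N X}
    (h : Ticks k θ θ') {l : 𝒜.Loc} (hl : (l, θ) ∈ S.region) : (l, θ') ∈ S.region := by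
  induction h with
  | refl => exact hl
  | step h1 _ ih => exact ih (hpos.tick _ hl _ h1)

theorem BeliefReach.mem_region (hpos : Positional S C) (hinit : (𝒜.game N).init ∈ S.region)
    {p : 𝒜.Loc × TickRegion N X} (hp : BeliefReach C p) : p ∈ S.region := by
  induction hp with
  | init => exact hinit
  | step hp he ho ih =>
    obtain ⟨θ', hU, he⟩ := he
    exact (hpos.edge _ (ticks_mem_region hpos hU.ticks ih) _ he).1 _ ho

/-- The belief may be wrong about the tick clock, but its restriction to `X` is exact. Locations
thus determine their regions, which is the source of the normal form. -/
theorem beliefPTA_reach_eq {hC : ∀ p, (C p).Finite}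
    {s : (beliefPTA C hC).Loc × Region (max N 1) X} (h : (beliefPTA C hC).Reach (max N 1) s) :
    s.2 = s.1.1.2.restrict := by
  induction h with
  | init => rfl
  | @step p θ χ g a μ Y p' _ hT _ hsub ho ih =>
    obtain ⟨k, χ', e, he, rfl, rfl, rfl⟩ := beliefPTA_T.1 hT
    rw [Region.sat_guard] at hsub
    obtain rfl := Region.eq_of_toSet_subset hsub
    obtain ⟨o', ho', h1, h2⟩ := mem_support_beliefDist p.2 he ho
    simp only at h1 h2 ⊢
    rw [h1, h2, restrict_target he]

theorem beliefPTA_reach {hC : ∀ p, (C p).Finite} {p : 𝒜.Loc × TickRegion N X}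
    (h : BeliefReach C p) : (beliefPTA C hC).Reach (max N 1) (⟨p, h⟩, p.2.restrict) := by
  induction h with
  | init => exact .init
  | @step p χ k e o hp he ho ih =>
    rw [restrict_target he]
    obtain ⟨θ', hU, he'⟩ := he
    have he : BeliefEdge C p χ k e := ⟨θ', hU, he'⟩
    refine PTA.Reach.step (M := beliefPTA C hC) (g := χ.guard) (a := e.action)
      (μ := beliefDist C e) ih (beliefPTA_T.2 ⟨k, χ, e, he, rfl, rfl, rfl⟩) hU.isSucc_restrict
      (Region.sat_guard χ).ge ?_
    exact (PMF.mem_support_map_iff _ _ _).2 ⟨o, ho, beliefOutcome_eq hp he ho⟩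

theorem beliefDist_map {hC : ∀ p, (C p).Finite} {p : 𝒜.Loc × TickRegion N X}
    (hp : BeliefReach C p) {χ : Region (max N 1) X} {k : ℕ} {e : OfferedEdge 𝒜 N}
    (he : BeliefEdge C p χ k e) :
    ((beliefDist C e).map fun o => (o.1, (o.2, χ.reset o.1)) :
      PMF (Set X × ((beliefPTA C hC).Loc × Region (max N 1) X))) =
    (beliefDist C e).map fun o => (o.1, (o.2, o.2.1.2.restrict)) := by
  refine map_congr_of_support fun o ho => ?_
  obtain ⟨o', -, h1, h2⟩ := mem_support_beliefDist hp he ho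
  rw [h2, restrict_target he, h1]
  rfl

/-- Each location occurs with exactly one region and each guard is a single region, so passing to
the region automaton only renames locations. -/
theorem beliefPTA_normalForm (hC : ∀ p, (C p).Finite) : (beliefPTA C hC).NormalForm (max N 1) := by
  refine ⟨⟨fun p => ⟨(p, p.1.2.restrict), beliefPTA_reach p.2⟩, fun s => s.1.1, fun p => rfl, ?_⟩,
    rfl, fun l => rfl, ?_, ?_⟩
  · rintro ⟨⟨p, χ⟩, h⟩
    have := beliefPTA_reach_eq h
    simp only at this
    subst this
    rfl
  · intro p g a μ hT
    obtain ⟨k, χ, e, he, rfl, rfl, rfl⟩ := beliefPTA_T.1 hT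
    refine ⟨χ, Region.sat_guard χ, ?_⟩
    have h := PTA.RegionEdge.mk (beliefPTA_reach (hC := hC) p.2) hT
      (show p.1.2.restrict.IsSucc χ from he.choose_spec.1.isSucc_restrict) (Region.sat_guard χ).ge
    exact beliefDist_map (hC := hC) p.2 he ▸ h
  · intro p θ' a ν h
    obtain ⟨hr, hT, hs, hsub⟩ := h
    rename_i g μ
    obtain ⟨k, χ, e, he, rfl, rfl, rfl⟩ := beliefPTA_T.1 hT
    have hsub' := hsub
    rw [Region.sat_guard] at hsub'
    obtain rfl := Region.eq_of_toSet_subset hsub'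
    exact ⟨_, _, hT, Region.sat_guard _, beliefDist_map p.2 he⟩

/-- The edges come from the offer made at the position after the ticks of the update, which is still
in the winning region. Legality of that offer there gives both the must and the may condition. -/
theorem beliefPTA_satisfies (hpos : Positional S C) (hN : 𝒜.BoundedBy N)
    (hinit : (𝒜.game N).init ∈ S.region) : Satisfies (beliefPTA C hpos.finite) 𝒜 := by
  have hN' : 𝒜.BoundedBy (max N 1) := fun l g a φ h => (hN l g a φ h).mono (le_max_left N 1)
  refine ⟨max N 1, ?_, hN', beliefPTA_normalForm _, fun p l => p.1.1 = l, ⟨?_, ?_, ?_⟩, rfl⟩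
  · intro p g a μ hT
    obtain ⟨k, χ, e, he, rfl, rfl, rfl⟩ := beliefPTA_T.1 hT
    exact Region.guard_boundedBy χ
  · rintro p _ rfl a φ g θ hT hr -
    obtain rfl : θ = p.1.2.restrict := beliefPTA_reach_eq hr
    -- One edge is provided for each successor region inside `g`; these finitely many regions cover
    -- the required set.
    let I := {χ : Region (max N 1) X // p.1.2.restrict.IsSucc χ ∧ χ.toSet ⊆ g.sat}
    obtain ⟨n, ⟨eq⟩⟩ := Finite.exists_equiv_fin I
    have hmove : ∀ χ : I, ∃ k e, BeliefEdge C p.1 χ.1 k e ∧ e.action = a ∧ e.dist ∈ 𝒜.PC.Sat φ := by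
      rintro ⟨χ, hχ, hsub⟩
      obtain ⟨k, θ', θ'', hU⟩ := exists_update (one_le_max N) p.2.le_one hχ
      have hreg := ticks_mem_region hpos hU.ticks (p.2.mem_region hpos hinit)
      obtain ⟨μ, hμ, hC⟩ := (hpos.legal _ hreg).must g a φ hT θ'' ⟨hU.succ, hU.le_one⟩ (by
        intro v hv
        apply hsub
        change Region.of _ v.base = χ
        rw [← hU.restrict, ← (hv : Region.of _ v = θ'')]
        rfl)
      exact ⟨k, _, ⟨θ', hU, hC⟩, rfl, hμ⟩
    choose k e he ha hφ using hmove
    refine ⟨n, fun i => (eq.symm i).1.guard, fun i => beliefDist C (e (eq.symm i)), ?_, fun i => ?_⟩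
    · rintro w ⟨hw1, hw2⟩
      refine ⟨hw1, Set.mem_iUnion.2 ⟨eq ⟨Region.of _ w, hw1,
        Region.toSet_subset_sat rfl (hN' _ _ _ _ (by rw [hT]; simp)) hw2⟩, ?_⟩⟩
      have h' := eq.symm_apply_apply ⟨Region.of _ w, hw1,
        Region.toSet_subset_sat rfl (hN' _ _ _ _ (by rw [hT]; simp)) hw2⟩
      simp only [h', Region.sat_guard]
      rfl
    · exact ⟨beliefPTA_T.2 ⟨_, _, _, he _, rfl, (ha _).symm, rfl⟩, _, hφ _,
        beliefPTA_lifting p.2 (he _)⟩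
  · rintro p _ rfl a μ g hT
    obtain ⟨k, χ, e, he, rfl, rfl, rfl⟩ := beliefPTA_T.1 hT
    have hlift := beliefPTA_lifting p.2 he
    obtain ⟨θ', hU, hC⟩ := he
    have hreg := ticks_mem_region hpos hU.ticks (p.2.mem_region hpos hinit)
    obtain ⟨-, g', φ, hT', hw, hφ⟩ := (hpos.legal _ hreg).may e hC
    refine ⟨g', φ, hT', ?_, e.dist, hφ, hlift⟩
    rw [Region.sat_guard]
    obtain ⟨w, hw'⟩ := Region.exists_of_eq e.region
    refine Region.toSet_subset_sat (v := w.base) ?_ (hN' _ _ _ _ hT') (hw w hw')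
    rw [← hU.restrict, ← hw']
    rfl
  · rintro p _ rfl
    have h := (hpos.legal _ (p.2.mem_region hpos hinit)).label
    simp only [beliefPTA, dif_pos h]
    exact h.some_mem

end Positional


/-! ### Divergence of the belief automaton -/

/-- The sum of `f` over the proper suffixes of a history. -/
def histSum {O R : Type*} [AddCommMonoid R] (f : List O → R) : List O → R
  | [] => 0
  | _ :: h => histSum f h + f h

theorem histSum_history {O : Type u} {R : Type*} [AddCommMonoid R] (f : List O → R) (ω : ℕ → O)
    (n : ℕ) : histSum f (history ω n) = ∑ i ∈ Finset.range n, f (history ω i) := by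
  induction n with
  | zero => rfl
  | succ n ih =>
    rw [Finset.sum_range_succ, ← ih]
    rfl

/-- A series that dominates a frequently positive sequence of natural numbers diverges. -/
theorem tsum_eq_top_of_sum_le {d : ℕ → ℝ≥0} {k : ℕ → ℕ}
    (h : ∀ n, ((∑ i ∈ Finset.range n, k i : ℕ) : ℝ≥0) ≤ ∑ i ∈ Finset.range n, d i)
    (hk : ∃ᶠ n in atTop, 0 < k n) : ∑' n, (d n : ℝ≥0∞) = ⊤ := by
  have hunb : ∀ b : ℕ, ∃ n, b ≤ ∑ i ∈ Finset.range n, k i := by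
    intro b
    induction b with
    | zero => exact ⟨0, Nat.zero_le _⟩
    | succ b ih =>
      obtain ⟨n, hn⟩ := ih
      obtain ⟨j, hj, hkj⟩ := frequently_atTop.1 hk n
      refine ⟨j + 1, ?_⟩
      rw [Finset.sum_range_succ]
      have := Finset.sum_le_sum_of_subset (f := k) (Finset.range_mono hj)
      omega
  refine ENNReal.eq_top_of_forall_nnreal_le fun r => ?_
  obtain ⟨b, hb⟩ := exists_nat_ge r
  obtain ⟨n, hn⟩ := hunb b
  refine le_trans ?_ (ENNReal.sum_le_tsum (Finset.range n))
  rw [← ENNReal.ofNNReal_finsetSum, ENNReal.coe_le_coe]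
  exact hb.trans ((Nat.cast_le.2 hn).trans (h n))

/-- The delay chosen by a scheduler, with default value zero. -/
noncomputable def PTA.Scheduler.delay {A X AP : Type u} {M : PTA A X AP} (σ : M.Scheduler)
    (h : List (Set X × M.Loc)) : ℝ≥0 :=
  (σ h).elim 0 fun c => c.1

section Divergence

variable {A X AP : Type u} {𝒜 : APTA A X AP} {N : ℕ} [Finite X] {m : Mode}
  {S : (𝒜.game N).Solution m} {C : 𝒜.Loc × TickRegion N X → Set (OfferedEdge 𝒜 N)}
  {hC : ∀ p, (C p).Finite}

/-- The belief never overestimates the time elapsed under a scheduler. -/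
theorem exists_sim {σ : (beliefPTA C hC).Scheduler} (hσ : σ.Legal)
    {k : List (Set X × (beliefPTA C hC).Loc) → ℕ} (hk0 : ∀ h, σ h = none → k h = 0)
    (hk : ∀ h t g a μ, σ h = some (t, g, a, μ) → BeliefTrans C (σ.state h).1.1 (k h) g a μ)
    {h : List (Set X × (beliefPTA C hC).Loc)} (hh : FeasibleHistory σ.law h) :
    ∃ u, Sim (σ.state h).1.1.2 u ∧ u.base = (σ.state h).2 ∧
      u none + histSum (fun h => (k h : ℝ≥0)) h ≤ histSum σ.delay h := by
  induction h with
  | nil =>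
    refine ⟨fun _ => 0, ⟨fun _ => 0, rfl, Coarse.of_region_eq (one_le_max N) rfl (by simp)⟩,
      rfl, ?_⟩
    simp [histSum]
  | cons o h ih =>
    obtain ⟨u, hsim, hbase, hle⟩ := ih hh.2
    rcases hσh : σ h with _ | ⟨t, g, a, μ⟩
    · have hst : σ.state (o :: h) = σ.state h := by
        simp only [PTA.Scheduler.state, hσh]
      refine ⟨u, hst ▸ hsim, hst ▸ hbase, ?_⟩
      simpa [histSum, hk0 h hσh, PTA.Scheduler.delay, hσh] using hle
    · have hst : σ.state (o :: h) = (o.2, ((σ.state h).2.delay t).reset o.1) := by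
        simp only [PTA.Scheduler.state, hσh]
      have hlaw : σ.law h = μ := by simp only [PTA.Scheduler.law, hσh]
      obtain ⟨χ, e, he, rfl, rfl, rfl⟩ := hk h t g a μ hσh
      have ho := hh.1
      rw [hlaw] at ho
      obtain ⟨o', -, h1, h2⟩ := mem_support_beliefDist (σ.state h).1.2 he ho
      obtain ⟨θ', hU, -⟩ := he
      have hχ := (hσ h t _ _ _ hσh).2
      rw [Region.sat_guard, ← hbase] at hχ
      obtain ⟨u', hs', hb', hle'⟩ := hU.sound u t hsim hχ
      rw [hst]
      refine ⟨u'.reset (some '' o.1), ?_, ?_, ?_⟩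
      · change Sim o.2.1.2 _
        rw [h2, h1]
        exact hs'.reset_some _
      · rw [Valuation.base_reset_some, hb', ← hbase]
        rfl
      · rw [Valuation.reset_some_none]
        simp only [histSum, PTA.Scheduler.delay, hσh, Option.elim_some]
        calc u' none + (histSum (fun h => (k h : ℝ≥0)) h + k h)
            = (u' none + k h) + histSum (fun h => (k h : ℝ≥0)) h := by ring
          _ ≤ (u none + t) + histSum (fun h => (k h : ℝ≥0)) h := by gcongr
          _ = (u none + histSum (fun h => (k h : ℝ≥0)) h) + t := by ring
          _ ≤ _ := by gcongr

/-- With no tick counted the offer is the one made at `p` itself, so the rank of `p` is the one that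
drops. After ticks no bound by the rank of `p` is claimed. -/
theorem beliefDist_hits (hpos : Positional S C) (hinit : (𝒜.game N).init ∈ S.region)
    {p : 𝒜.Loc × TickRegion N X} (hp : BeliefReach C p) {χ : Region (max N 1) X}
    {e : OfferedEdge 𝒜 N} (he : BeliefEdge C p χ 0 e) :
    m.Hits (beliefDist C e).support fun o => S.rank o.2.1 < S.rank p := by
  have hlow : m.Hits e.dist.support fun o => S.rank (e.target o) < S.rank p := by
    obtain ⟨θ', hU, hC⟩ := he
    cases hU.ticks
    exact (hpos.edge p (hp.mem_region hpos hinit) e hC).2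
  cases m with
  | sure =>
    intro o ho
    obtain ⟨o', ho', -, h2⟩ := mem_support_beliefDist hp he ho
    rw [h2]
    exact hlow o' ho'
  | almost =>
    obtain ⟨o, ho, h⟩ := hlow
    refine ⟨_, (PMF.mem_support_map_iff _ _ _).2 ⟨o, ho, beliefOutcome_eq hp he ho⟩, h⟩

/-- A history is good if time then passes forever or the next edge counts a tick. All others lower
the rank, so good ones recur. Either one step has infinite duration, or the counted ticks are
unbounded and `exists_sim` bounds the real time below by them. -/
theorem beliefPTA_divergent (hpos : Positional S C) (hinit : (𝒜.game N).init ∈ S.region)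
    (σ : (beliefPTA C hC).Scheduler) (hσ : σ.Legal) : m.Wins σ.law σ.Divergent := by
  -- An edge records only that some tick count exists, so one count is fixed for each history.
  have hkex : ∀ h, ∃ k : ℕ, (σ h = none → k = 0) ∧
      ∀ t g a μ, σ h = some (t, g, a, μ) → BeliefTrans C (σ.state h).1.1 k g a μ := by
    intro h
    rcases hσh : σ h with _ | ⟨t, g, a, μ⟩
    · exact ⟨0, fun _ => rfl, by simp⟩
    · obtain ⟨k, hk⟩ := beliefPTA_T.1 (hσ h t g a μ hσh).1
      refine ⟨k, by simp, ?_⟩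
      rintro t' g' a' μ' ⟨⟩
      exact hk
  choose k hk0 hk using hkex
  obtain ⟨n, hn⟩ := exists_forall_le_of_finite S.rank
  obtain ⟨ε, hε0, hε⟩ := exists_pos_lower_bound
    (T := {x : _ × (Set X × (beliefPTA C hC).Loc) |
      x.1 ∈ {e : (beliefPTA C hC).Loc × Guard X × A × PMF (Set X × (beliefPTA C hC).Loc) |
        (beliefPTA C hC).T e.1 e.2.1 e.2.2.1 e.2.2.2 = true} ∧ x.2 ∈ x.1.2.2.2.support})
    (((beliefPTA C hC).finite_edges.prod Set.finite_univ).subset fun x hx => ⟨hx.1, trivial⟩)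
    (g := fun x => x.1.2.2.2 x.2) fun x hx => (PMF.mem_support_iff _ _).1 hx.2
  have hwin : m.Wins σ.law fun ω =>
      ∃ᶠ n in atTop, (σ (history ω n) = none ∨ 0 < k (history ω n)) := by
    refine Mode.wins_of_rank (Good := fun h => σ h = none ∨ 0 < k h)
      (rank := fun h => S.rank (σ.state h).1.1) hε0 (fun h => hn _) fun h _ hg => ?_
    rw [not_or, not_lt, Nat.le_zero] at hg
    obtain ⟨⟨t, g, a, μ⟩, hσh⟩ := Option.ne_none_iff_exists'.1 hg.1
    have hlaw : σ.law h = μ := by simp only [PTA.Scheduler.law, hσh]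
    have hst : ∀ o, (σ.state (o :: h)).1 = o.2 := by
      intro o
      simp only [PTA.Scheduler.state, hσh]
    rw [hlaw]
    refine ⟨fun o ho => hε (((σ.state h).1, g, a, μ), o) ⟨(hσ h t g a μ hσh).1, ho⟩, ?_⟩
    have htr := hk h t g a μ hσh
    rw [hg.2] at htr
    obtain ⟨χ, e, he, rfl, rfl, rfl⟩ := htr
    refine (beliefDist_hits hpos hinit (σ.state h).1.2 he).mono fun o _ ho => ?_
    exact (congrArg (fun p => S.rank p.1) (hst o)).trans_lt ho
  refine hwin.mono fun ω hω hfreq => ?_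
  by_cases hnone : ∃ n, σ (history ω n) = none
  · obtain ⟨n, hn⟩ := hnone
    exact ENNReal.tsum_eq_top_of_eq_top ⟨n, by simp only [PTA.Scheduler.duration, hn]⟩
  · push Not at hnone
    have hdur : ∀ n, σ.duration (history ω n) = (σ.delay (history ω n) : ℝ≥0∞) := by
      intro n
      obtain ⟨c, hc⟩ := Option.ne_none_iff_exists'.1 (hnone n)
      simp only [PTA.Scheduler.duration, PTA.Scheduler.delay, hc, Option.elim_some]
    unfold PTA.Scheduler.Divergent
    simp only [hdur]
    refine tsum_eq_top_of_sum_le (k := fun n => k (history ω n)) (fun n => ?_)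
      (hfreq.mono fun n h => h.resolve_left (hnone n))
    obtain ⟨u, -, -, hle⟩ := exists_sim hσ hk0 hk (feasible_iff.1 hω n)
    rw [histSum_history, histSum_history] at hle
    push_cast
    exact le_add_self.trans hle

end Divergence

/-- Both sides amount to the initial position lying in the region of one solution. The bound `N` of
the game need not be the one in `Satisfies`, so `exists_decision` handles two bounds. -/
theorem exists_divergent_iff {A X AP : Type u} [Finite X] {𝒜 : APTA A X AP} {N : ℕ}
    (hN : 𝒜.BoundedBy N) (m : Mode) :
    (∃ M : PTA A X AP, Satisfies M 𝒜 ∧ ∀ σ : M.Scheduler, σ.Legal → m.Wins σ.law σ.Divergent) ↔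
      (𝒜.game N).Winnable m := by
  obtain ⟨S⟩ := (𝒜.game N).exists_solution m
  rw [game_winnable_iff S]
  constructor
  · rintro ⟨M, hM, hdiv⟩
    exact init_mem_of_satisfies S hN hM hdiv
  · intro hinit
    obtain ⟨C, hpos⟩ := exists_positional S
    exact ⟨_, beliefPTA_satisfies hpos hN hinit, beliefPTA_divergent hpos hinit⟩

end APTA

theorem mainTheorem2 {A X AP : Type u} [Finite A] [Finite X] [Finite AP]
    (𝒜 : APTA A X AP) (N : ℕ) (hN : 𝒜.BoundedBy N) :
    (𝒜.PdConsistent ↔ (𝒜.game N).AlmostSureWin) ∧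
      (𝒜.SdConsistent ↔ (𝒜.game N).SureWin) :=
  -- Consistency and winning unfold to the statements for the two modes.
  ⟨APTA.exists_divergent_iff hN .almost, APTA.exists_divergent_iff hN .sure⟩
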